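/- **Setting.** Let $\mathbf x=(X_1,\dots,X_p)$ be features and $\mathbf y\in\mathbb R^q$ a response such that each $X_k$ and $\mathbf y$ have continuous (atomless) laws. For random vectors $\mathbf u,\mathbf v$ put $$\mathrm{Pcov}(\mathbf u,\mathbf v)^2=\iiint \mathrm{cov}^2\{I(\mathbf a^{T}\mathbf u\le s),I(\mathbf b^{T}\mathbf v\le t)\}\,dF_{\mathbf a^T\mathbf u,\mathbf b^T\mathbf v}(s,t)\,d\mathbf a\,d\mathbf b$$ ($\mathbf a,\mathbf b$ ranging over the unit spheres with surface measure) and $\mathrm{PC}(\mathbf u,\mathbf v)^2=\mathrm{Pcov}(\mathbf u,\mathbf v)^2/\{\mathrm{Pcov}(\mathbf u,\mathbf u)\,\mathrm{Pcov}(\mathbf v,\mathbf v)\}$, $0/0=0$. Assume $\mathrm{Pcov}(X_k,X_k)^2\ge\sigma_0^2$ for all $k\le p$ and $\mathrm{Pcov}(Y_k,Y_k)^2\ge\sigma_0^2$ for all $k\le q$, with $\sigma_0>0$. Let $\mathcal A$ be the set of $k$ such that the conditional distribution $F(\mathbf y\mid\mathbf x)$ functionally depends on $X_k$, and $s=|\mathcal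 A|$. For samples $\mathbf u_1,\dots,\mathbf u_n$ and $\mathbf v_1,\dots,\mathbf v_n$ let $a_{klr}$ be the angle between $\mathbf u_k-\mathbf u_r$ and $\mathbf u_l-\mathbf u_r$ ($a_{klr}=0$ if $k=r$ or $l=r$), let $A_{klr}=a_{klr}-\frac1n\sum_{l'}a_{kl'r}-\frac1n\sum_{k'}a_{k'lr}+\frac1{n^2}\sum_{k',l'}a_{k'l'r}$, define $B_{klr}$ likewise from the $\mathbf v_i$, and put $\widehat{\mathrm{Pcov}}(\mathbf U,\mathbf V)^2=n^{-3}\sum_{k,l,r}A_{klr}B_{klr}$ and $\widehat{\mathrm{PC}}(\mathbf U,\mathbf V)^2=\widehat{\mathrm{Pcov}}(\mathbf U,\mathbf V)^2/\{\widehat{\mathrm{Pcov}}(\mathbf U,\mathbf U)\widehat{\mathrm{Pcov}}(\mathbf V,\mathbf V)\}$. **Procedure (PC-Knockoff).** A random sample of $(\mathbf x,\mathbf y)$ is split into parts of sizes $n_1$ and $n_2$, and $2d<n_2$. On the first part, $\widehat{\mathcal A}_1$ consists of $d$ features with the largest $\widehat{\mathrm{PC}}(\mathbf X_j^{(1)},\mathbf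 Y^{(1)})^2$. Given $\widehat{\mathcal A}_1$, the second part is a random sample of $(\mathbf x_{\widehat{\mathcal A}_1},\tilde{\mathbf x}_{\widehat{\mathcal A}_1},\mathbf y)$, where $\tilde{\mathbf x}_{\widehat{\mathcal A}_1}$ is an exact knockoff copy of $\mathbf x_{\widehat{\mathcal A}_1}$: exchanging $X_j$ and $\tilde X_j$ does not change the joint law of $(\mathbf x_{\widehat{\mathcal A}_1},\tilde{\mathbf x}_{\widehat{\mathcal A}_1})$ for any $j\in\widehat{\mathcal A}_1$, and $\tilde{\mathbf x}_{\widehat{\mathcal A}_1}$ is independent of $\mathbf y$ given $\mathbf x_{\widehat{\mathcal A}_1}$. For $j\in\widehat{\mathcal A}_1$ put $W_j=\mathrm{PC}(X_j,\mathbf y)^2-\mathrm{PC}(\tilde X_j,\mathbf y)^2$ (law given $\widehat{\mathcal A}_1$), $\widehat W_j=\widehat{\mathrm{PC}}(\mathbf X^{(2)}_j,\mathbf Y^{(2)})^2-\widehat{\mathrm{PC}}(\tilde{\mathbf X}^{(2)}_j,\mathbf Y^{(2)})^2$. For $\alpha\in[0,1]$ let $T_\alpha$ be the least $t\in\{|\widehat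 W_j|:j\in\widehat{\mathcal A}_1\}\setminus\{0\}$ with $\frac{1+\#\{j:\widehat W_j\le -t\}}{\#\{j:\widehat W_j\ge t\}}\le\alpha$ ($T_\alpha=+\infty$ if there is none), and let $\widehat{\mathcal A}(T_\alpha)=\{j\in\widehat{\mathcal A}_1:\widehat W_j\ge T_\alpha\}$. Let $\mathcal E=\{\mathcal A\subseteq\widehat{\mathcal A}_1\}$, and suppose $\Pr(\mathcal E)>0$. **Theorem.** There are constants $C(s)\in(0,1)$, $s>2$, depending only on $s$, and for all $q$, $\sigma_0>0$, $c_3>0$ and $0\le\kappa<1/2$ there are $K,c_4>0$, depending only on $q,\sigma_0,c_3,\kappa$, such that the following holds with $\epsilon_{n_2}=K\,n_2\exp(-c_4n_2^{1-2\kappa})$, whenever $\min_{k\in\mathcal A}W_k\ge 4c_3n_2^{-\kappa}$ for every possible value of $\widehat{\mathcal A}_1$ that contains $\mathcal A$. 1. If $\alpha\ge 1/s$, then $\Pr(\mathcal A\subseteq\widehat{\mathcal A}(T_\alpha)\mid\mathcal E)\ge 1-\epsilon_{n_2}$. 2. If $\alpha<1/s$, then $\Pr(\mathcal A\subseteq\widehat{\mathcal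 A}(T_\alpha)\text{ or }\widehat{\mathcal A}(T_\alpha)=\varnothing\mid\mathcal E)\ge 1-\epsilon_{n_2}$. If moreover $s>2$, then $\Pr(\mathcal A\subseteq\widehat{\mathcal A}(T_\alpha)\mid\mathcal E)\le C(s)+\epsilon_{n_2}$. -/

import Mathlib

open MeasureTheory ProbabilityTheory Set

noncomputable section

namespace PCKnockoff

/-! ### Projection correlation of a joint law -/

section Population

variable {E F : Type*}
  [NormedAddCommGroup E] [InnerProductSpace ℝ E] [MeasureSpace E] [BorelSpace E]
  [NormedAddCommGroup F] [InnerProductSpace ℝ F] [MeasureSpace F] [BorelSpace F]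

/-- `cov {I(aᵀx ≤ u), I(bᵀy ≤ v)} = F_{U,V}(u,v) - F_U(u) F_V(v)` for `U = aᵀx`, `V = bᵀy`, when
`(x, y)` has law `μ`. -/
def indicatorCov (μ : Measure (E × F)) (a : E) (b : F) (u v : ℝ) : ℝ :=
  μ.real {w | inner ℝ a w.1 ≤ u ∧ inner ℝ b w.2 ≤ v}
    - μ.real {w | inner ℝ a w.1 ≤ u} * μ.real {w | inner ℝ b w.2 ≤ v}

/-- Squared projection covariance `Pcov(x, y)²` of a random pair with law `μ`: the integral of
`cov² {I(aᵀx ≤ u), I(bᵀy ≤ v)}` over `(u, v)` distributed as `(aᵀx, bᵀy)` and over the unit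
directions `a`, `b` with respect to surface measure. -/
def projCovSq (μ : Measure (E × F)) : ℝ :=
  ∫ a : Metric.sphere (0 : E) 1, ∫ b : Metric.sphere (0 : F) 1,
    (∫ z, indicatorCov μ a b (inner ℝ (a : E) z.1) (inner ℝ (b : F) z.2) ^ 2 ∂μ)
    ∂((volume : Measure F).toSphere) ∂((volume : Measure E).toSphere)

/-- `Pcov(x, x)²` for a random vector `x` with law `ν`. -/
def projVarSq (ν : Measure E) : ℝ := projCovSq (ν.map (fun x => (x, x)))

/-- Squared projection correlation `PC(x, y)²` of a random pair with law `μ` (with `0/0 = 0`). -/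
def projCorrSq (μ : Measure (E × F)) : ℝ :=
  projCovSq μ / (√(projVarSq μ.fst) * √(projVarSq μ.snd))

end Population

/-! ### Sample projection correlation -/

section Sample

variable {n : ℕ} {E F : Type*} [NormedAddCommGroup E] [InnerProductSpace ℝ E]
  [NormedAddCommGroup F] [InnerProductSpace ℝ F]

/-- The angles `a_{klr}` of a sample `x₁, …, xₙ` (zero if `k = r` or `l = r`). -/
def angleArr (x : Fin n → E) (k l r : Fin n) : ℝ :=
  if k = r ∨ l = r then 0
  else Real.arccos (inner ℝ (x k - x r) (x l - x r) / (‖x k - x r‖ * ‖x l - x r‖))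

/-- The doubly centred angles `A_{klr}`. -/
def centredArr (x : Fin n → E) (k l r : Fin n) : ℝ :=
  angleArr x k l r
    - (n : ℝ)⁻¹ * ∑ l', angleArr x k l' r
    - (n : ℝ)⁻¹ * ∑ k', angleArr x k' l r
    + ((n : ℝ) ^ 2)⁻¹ * ∑ k', ∑ l', angleArr x k' l' r

/-- Squared sample projection covariance `n⁻³ ∑ A_{klr} B_{klr}`. -/
def sampleCovSq (x : Fin n → E) (y : Fin n → F) : ℝ :=
  ((n : ℝ) ^ 3)⁻¹ * ∑ k, ∑ l, ∑ r, centredArr x k l r * centredArr y k l r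

/-- Squared sample projection correlation (with `0/0 = 0`). -/
def sampleCorrSq (x : Fin n → E) (y : Fin n → F) : ℝ :=
  sampleCovSq x y / (√(sampleCovSq x x) * √(sampleCovSq y y))

end Sample

/-! ### Active features -/

/-- The features `k` on which the conditional distribution `F(y | x)` functionally depends. -/
def activeSet {p : ℕ} {𝓨 : Type*} [MeasurableSpace 𝓨] (F : Kernel (Fin p → ℝ) 𝓨) :
    Finset (Fin p) := by
  classical
  exact Finset.univ.filter fun k => ¬ DependsOn (fun x => F x) ({k}ᶜ : Set (Fin p))

/-! ### Knockoff copies -/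

/-- Exchange the `j`-th entries of `x` and of its knockoff. -/
def swapAt {ι : Type*} [DecidableEq ι] (j : ι) (z : (ι → ℝ) × (ι → ℝ)) : (ι → ℝ) × (ι → ℝ) :=
  (Function.update z.1 j (z.2 j), Function.update z.2 j (z.1 j))

/-- `ν`, the joint law of `(x, x̃, y)`, makes `x̃` an exact knockoff copy of `x` for the
response `y`. -/
structure IsKnockoff {ι 𝓨 : Type*} [Fintype ι] [DecidableEq ι] [MeasurableSpace 𝓨]
    [StandardBorelSpace 𝓨] (ν : ProbabilityMeasure ((ι → ℝ) × (ι → ℝ) × 𝓨)) : Prop where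
  /-- Swapping `x_j` and `x̃_j` does not change the law of `(x, x̃)`. -/
  exchangeable : ∀ j : ι,
    (ν.toMeasure.map fun w => swapAt j (w.1, w.2.1)) =
      ν.toMeasure.map fun w => (w.1, w.2.1)
  /-- Given `x`, the knockoff `x̃` is independent of `y`. -/
  condIndep : CondIndepFun (MeasurableSpace.comap Prod.fst inferInstance)
    (measurable_fst.comap_le) (fun w => w.2.1) (fun w => w.2.2) ν.toMeasure

/-- Population statistic `W_j = PC(x_j, y)² - PC(x̃_j, y)²` when `(x, x̃, y)` has law `ν`. -/
def popW {ι 𝓨 : Type*} [NormedAddCommGroup 𝓨] [InnerProductSpace ℝ 𝓨] [MeasureSpace 𝓨]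
    [BorelSpace 𝓨] (ν : ProbabilityMeasure ((ι → ℝ) × (ι → ℝ) × 𝓨)) (j : ι) : ℝ :=
  projCorrSq (ν.toMeasure.map fun w => (w.1 j, w.2.2))
    - projCorrSq (ν.toMeasure.map fun w => (w.2.1 j, w.2.2))

/-! ### The knockoff+ threshold and selection -/

section Selection

variable {p : ℕ}

/-- The thresholds `t ∈ {|W_j| : j ∈ S} \ {0}` with
`(1 + #{j ∈ S : W_j ≤ -t}) / #{j ∈ S : W_j ≥ t} ≤ α` (the ratio being `+∞` when the denominator
vanishes). -/
def admissible (S : Finset (Fin p)) (W : Fin p → ℝ) (α : ℝ) : Finset ℝ :=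
  ((S.image fun j => |W j|).erase 0).filter fun t =>
    0 < (S.filter fun j => t ≤ W j).card ∧
      (1 + ((S.filter fun j => W j ≤ -t).card : ℝ)) / ((S.filter fun j => t ≤ W j).card : ℝ) ≤ α

/-- The threshold `T_α`; it is `+∞` if no threshold is admissible. -/
def threshold (S : Finset (Fin p)) (W : Fin p → ℝ) (α : ℝ) : WithTop ℝ :=
  (admissible S W α).min

/-- The selected features `{j ∈ S : W_j ≥ T_α}`. -/
def selected (S : Finset (Fin p)) (W : Fin p → ℝ) (α : ℝ) : Finset (Fin p) :=
  S.filter fun j => threshold S W α ≤ (W j : WithTop ℝ)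

end Selection

/-! ### The two-step procedure -/

/-- The objects entering the two-step procedure: the population law of the features, the
conditional law of the response given the features, the full sample split into a screening half
(`Sum.inl`) and a knockoff half (`Sum.inr`), the set of screened features, the rows of knockoff
features (only the coordinates of screened features matter), and, for every possible screened
set `S`, the joint law of `(x_S, x̃_S, y)`. -/
structure Experiment (n₁ n₂ p q : ℕ) (Ω : Type*) where
  xLaw : ProbabilityMeasure (Fin p → ℝ)
  condLaw : Kernel (Fin p → ℝ) (EuclideanSpace ℝ (Fin q))
  X : Fin n₁ ⊕ Fin n₂ → Ω → Fin p → ℝ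
  Y : Fin n₁ ⊕ Fin n₂ → Ω → EuclideanSpace ℝ (Fin q)
  screened : Ω → Finset (Fin p)
  Xt : Fin n₂ → Ω → Fin p → ℝ
  knockLaw : (S : Finset (Fin p)) →
    ProbabilityMeasure ((S → ℝ) × (S → ℝ) × EuclideanSpace ℝ (Fin q))

namespace Experiment

variable {n₁ n₂ p q : ℕ} {Ω : Type*} (M : Experiment n₁ n₂ p q Ω)

/-- The joint population law of `(x, y)`. -/
def popLaw : Measure ((Fin p → ℝ) × EuclideanSpace ℝ (Fin q)) :=
  M.xLaw.toMeasure ⊗ₘ M.condLaw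

/-- The set of active features. -/
def active : Finset (Fin p) := activeSet M.condLaw

/-- The sample squared projection correlation of the `j`-th feature with the response on the
screening half. -/
def screenStat (ω : Ω) (j : Fin p) : ℝ :=
  sampleCorrSq (fun i : Fin n₁ => M.X (Sum.inl i) ω j) (fun i => M.Y (Sum.inl i) ω)

/-- The statistic `Ŵ_j` computed on the knockoff half. -/
def What (ω : Ω) (j : Fin p) : ℝ :=
  sampleCorrSq (fun i : Fin n₂ => M.X (Sum.inr i) ω j) (fun i => M.Y (Sum.inr i) ω)
    - sampleCorrSq (fun i : Fin n₂ => M.Xt i ω j) (fun i => M.Y (Sum.inr i) ω)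

/-- The output of the procedure at level `α`. -/
def output (α : ℝ) (ω : Ω) : Finset (Fin p) := selected (M.screened ω) (M.What ω) α

/-- The event that all active features survive the screening step. -/
def sureScreen : Set Ω := {ω | M.active ⊆ M.screened ω}

/-- The `i`-th row `(x_S, x̃_S, y)` of the knockoff half restricted to the features in `S`. -/
def knockRow (S : Finset (Fin p)) (i : Fin n₂) (ω : Ω) :
    (S → ℝ) × (S → ℝ) × EuclideanSpace ℝ (Fin q) :=
  (fun j => M.X (Sum.inr i) ω j, fun j => M.Xt i ω j, M.Y (Sum.inr i) ω)

/-- The standing assumptions on the population: non-degeneracy with constant `σ₀`, and continuity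
(no atoms) of the law of each feature and of the law of the response. -/
structure IsRegular (σ₀ : ℝ) : Prop where
  markov : IsMarkovKernel M.condLaw
  feature_continuous : ∀ k, NullSingletonClass (M.xLaw.toMeasure.map fun x => x k)
  response_continuous : NullSingletonClass M.popLaw.snd
  feature_nondeg : ∀ k, σ₀ ^ 2 ≤ projVarSq (M.xLaw.toMeasure.map fun x => x k)
  response_nondeg : ∀ k : Fin q, σ₀ ^ 2 ≤ projVarSq (M.popLaw.snd.map fun y => y k)

variable [MeasurableSpace Ω] (P : Measure Ω)

/-- The full sample is a random sample from the population, the `d` features ranked highest by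
`screenStat` are screened, and, given that `S` is the screened set, the rows `(x_S, x̃_S, y)` of
the knockoff half are a random sample from `knockLaw S`, under which `x̃_S` is an exact knockoff
copy of `x_S`. -/
structure IsProcedure (d : ℕ) : Prop where
  measurable_X : ∀ i, Measurable (M.X i)
  measurable_Y : ∀ i, Measurable (M.Y i)
  measurable_Xt : ∀ i, Measurable (M.Xt i)
  measurable_screened : ∀ S, MeasurableSet {ω | M.screened ω = S}
  sample_indep : iIndepFun (fun i ω => (M.X i ω, M.Y i ω)) P
  sample_law : ∀ i, P.map (fun ω => (M.X i ω, M.Y i ω)) = M.popLaw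
  screened_card : ∀ ω, (M.screened ω).card = d
  screened_top : ∀ ω, ∀ j ∈ M.screened ω, ∀ k ∉ M.screened ω, M.screenStat ω k ≤ M.screenStat ω j
  knock_indep : ∀ S, P {ω | M.screened ω = S} ≠ 0 →
    iIndepFun (M.knockRow S) (P[|{ω | M.screened ω = S}])
  knock_law : ∀ S, P {ω | M.screened ω = S} ≠ 0 → ∀ i,
    (P[|{ω | M.screened ω = S}]).map (M.knockRow S i) = (M.knockLaw S).toMeasure
  knock_marginal : ∀ S, P {ω | M.screened ω = S} ≠ 0 →
    (M.knockLaw S).toMeasure.map (fun w => (w.1, w.2.2)) =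
      M.popLaw.map fun z => ((fun j : S => z.1 j), z.2)
  knock_exact : ∀ S, P {ω | M.screened ω = S} ≠ 0 → IsKnockoff (M.knockLaw S)

/-- Minimum signal strength `min_{k ∈ A} W_k ≥ τ`, for every screened set that can occur and
contains all active features. -/
def SignalAtLeast (τ : ℝ) : Prop :=
  ∀ S, P {ω | M.screened ω = S} ≠ 0 → M.active ⊆ S →
    ∀ k : S, (k : Fin p) ∈ M.active → τ ≤ popW (M.knockLaw S) k

end Experiment

end PCKnockoff

end

noncomputable section

set_option linter.unusedSectionVars false

namespace PCKnockoff

/-! ### Spherical measure of the intersection of two half spaces -/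

section Lune

variable {E : Type*} [NormedAddCommGroup E] [InnerProductSpace ℝ E] [FiniteDimensional ℝ E]
  [MeasurableSpace E] [BorelSpace E] (μ : Measure E) [μ.IsAddHaarMeasure]

lemma addHaar_preimage_linearIsometryEquiv (f : E ≃ₗᵢ[ℝ] E) (s : Set E) :
    μ (f ⁻¹' s) = μ s := by
  have h := fun s => Measure.addHaar_preimage_linearEquiv μ f.toLinearEquiv s
  have hb : μ (f ⁻¹' Metric.ball 0 1) = μ (Metric.ball 0 1) := by
    rw [f.preimage_ball]; simp
  have h1 := h (Metric.ball 0 1)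
  have e : ∀ s, f.toLinearEquiv ⁻¹' s = f ⁻¹' s := fun s => rfl
  rw [e, hb] at h1
  have hpos : μ (Metric.ball (0 : E) 1) ≠ 0 := (Metric.measure_ball_pos μ 0 one_pos).ne'
  have hfin : μ (Metric.ball (0 : E) 1) ≠ ⊤ := measure_ball_lt_top.ne
  have hc : ENNReal.ofReal |LinearMap.det (f.toLinearEquiv.symm : E →ₗ[ℝ] E)| = 1 := by
    have := h1.symm
    nth_rewrite 2 [← one_mul (μ (Metric.ball (0 : E) 1))] at this
    exact (ENNReal.mul_left_inj hpos hfin).1 this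
  rw [← e, h s, hc, one_mul]

/-- The rotation by the angle `t` in the plane spanned by an orthonormal pair. -/
def planeRotLinear (e₁ e₂ : E) (t : ℝ) : E →ₗ[ℝ] E where
  toFun a := a + ((Real.cos t - 1) * inner ℝ e₁ a - Real.sin t * inner ℝ e₂ a) • e₁
    + (Real.sin t * inner ℝ e₁ a + (Real.cos t - 1) * inner ℝ e₂ a) • e₂
  map_add' a b := by
    simp only [inner_add_right]
    module
  map_smul' r a := by
    simp only [inner_smul_right, RingHom.id_apply]
    module

variable {e₁ e₂ : E}

lemma inner_planeRotLinear_left (h₁ : ‖e₁‖ = 1) (h₁₂ : inner ℝ e₁ e₂ = 0)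
    (t : ℝ) (a : E) : inner ℝ e₁ (planeRotLinear e₁ e₂ t a)
      = Real.cos t * inner ℝ e₁ a - Real.sin t * inner ℝ e₂ a := by
  simp only [planeRotLinear, LinearMap.coe_mk, AddHom.coe_mk, inner_add_right, inner_smul_right,
    h₁₂, real_inner_self_eq_norm_sq, h₁]
  ring

lemma inner_planeRotLinear_right (h₂ : ‖e₂‖ = 1) (h₁₂ : inner ℝ e₁ e₂ = 0)
    (t : ℝ) (a : E) : inner ℝ e₂ (planeRotLinear e₁ e₂ t a)
      = Real.sin t * inner ℝ e₁ a + Real.cos t * inner ℝ e₂ a := by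
  have h₂₁ : inner ℝ e₂ e₁ = 0 := by rw [real_inner_comm]; exact h₁₂
  simp only [planeRotLinear, LinearMap.coe_mk, AddHom.coe_mk, inner_add_right, inner_smul_right,
    h₂₁, real_inner_self_eq_norm_sq, h₂]
  ring

lemma norm_planeRotLinear (h₁ : ‖e₁‖ = 1) (h₂ : ‖e₂‖ = 1) (h₁₂ : inner ℝ e₁ e₂ = 0)
    (t : ℝ) (a : E) : ‖planeRotLinear e₁ e₂ t a‖ = ‖a‖ := by
  have h₂₁ : inner ℝ e₂ e₁ = 0 := by rw [real_inner_comm]; exact h₁₂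
  rw [← sq_eq_sq₀ (norm_nonneg _) (norm_nonneg _), ← real_inner_self_eq_norm_sq,
    ← real_inner_self_eq_norm_sq]
  simp only [planeRotLinear, LinearMap.coe_mk, AddHom.coe_mk, inner_add_right, inner_smul_right,
    inner_add_left, inner_smul_left, h₁₂, h₂₁, real_inner_self_eq_norm_sq, h₁, h₂,
    real_inner_comm e₁ a, real_inner_comm e₂ a, conj_trivial]
  linear_combination (inner ℝ e₁ a ^ 2 + inner ℝ e₂ a ^ 2) * Real.sin_sq_add_cos_sq t

/-- The rotation by the angle `t` in the plane spanned by an orthonormal pair, as an isometry. -/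
def planeRot (h₁ : ‖e₁‖ = 1) (h₂ : ‖e₂‖ = 1) (h₁₂ : inner ℝ e₁ e₂ = 0) (t : ℝ) : E ≃ₗᵢ[ℝ] E :=
  LinearIsometry.toLinearIsometryEquiv
    ⟨planeRotLinear e₁ e₂ t, norm_planeRotLinear h₁ h₂ h₁₂ t⟩ rfl

lemma planeRot_apply (h₁ : ‖e₁‖ = 1) (h₂ : ‖e₂‖ = 1) (h₁₂ : inner ℝ e₁ e₂ = 0) (t : ℝ) (a : E) :
    planeRot h₁ h₂ h₁₂ t a = planeRotLinear e₁ e₂ t a := rfl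

lemma integral_indicator_two_arcs {θ : ℝ} (h0 : 0 ≤ θ) (hπ : θ ≤ Real.pi) (φ : ℝ) :
    ∫ t in (0 : ℝ)..2 * Real.pi,
      (if Real.cos (φ + t) ≤ 0 ∧ Real.cos (φ + t - θ) ≤ 0 then (1 : ℝ) else 0) = Real.pi - θ := by
  set g : ℝ → ℝ := fun s => if Real.cos s ≤ 0 ∧ Real.cos (s - θ) ≤ 0 then (1 : ℝ) else 0 with hg
  have hper : Function.Periodic g (2 * Real.pi) := by
    intro s
    simp only [hg]
    rw [Real.cos_add_two_pi, show s + 2 * Real.pi - θ = (s - θ) + 2 * Real.pi by ring,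
      Real.cos_add_two_pi]
  have h1 : (∫ t in (0 : ℝ)..2 * Real.pi, g (φ + t)) = ∫ t in φ..(φ + 2 * Real.pi), g t := by
    rw [intervalIntegral.integral_comp_add_left]; simp
  rw [show (∫ t in (0 : ℝ)..2 * Real.pi,
      (if Real.cos (φ + t) ≤ 0 ∧ Real.cos (φ + t - θ) ≤ 0 then (1 : ℝ) else 0))
      = ∫ t in (0 : ℝ)..2 * Real.pi, g (φ + t) from rfl, h1,
    hper.intervalIntegral_add_eq φ (-(Real.pi / 2))]
  have hpi := Real.pi_pos
  rw [intervalIntegral.integral_of_le (by linarith)]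
  have h2 : (∫ t in Ioc (-(Real.pi / 2)) (-(Real.pi / 2) + 2 * Real.pi), g t)
      = ∫ t in Ioc (-(Real.pi / 2)) (-(Real.pi / 2) + 2 * Real.pi),
        (Icc (Real.pi / 2 + θ) (3 * Real.pi / 2)).indicator (fun _ => (1 : ℝ)) t := by
    apply setIntegral_congr_ae measurableSet_Ioc
    have hne : ∀ᵐ t : ℝ, t ≠ Real.pi / 2 := by
      simp [ae_iff]
    filter_upwards [hne] with s hs hm
    obtain ⟨ha, hb⟩ := hm
    simp only [hg, indicator_apply, mem_Icc]
    rcases lt_or_gt_of_ne hs with h | h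
    · have : 0 < Real.cos s := Real.cos_pos_of_mem_Ioo ⟨ha, h⟩
      rw [if_neg (by rintro ⟨h', _⟩; linarith), if_neg (by rintro ⟨h', _⟩; linarith)]
    · have hc : Real.cos s ≤ 0 := Real.cos_nonpos_of_pi_div_two_le_of_le h.le (by linarith)
      by_cases hlt : s < Real.pi / 2 + θ
      · have : 0 < Real.cos (s - θ) := Real.cos_pos_of_mem_Ioo ⟨by linarith, by linarith⟩
        rw [if_neg (by rintro ⟨_, h'⟩; linarith), if_neg (by rintro ⟨h', _⟩; linarith)]
      · have : Real.cos (s - θ) ≤ 0 :=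
          Real.cos_nonpos_of_pi_div_two_le_of_le (by linarith) (by linarith)
        rw [if_pos ⟨hc, this⟩, if_pos ⟨by linarith, by linarith⟩]
  rw [h2, setIntegral_indicator measurableSet_Icc, show Ioc (-(Real.pi / 2)) (-(Real.pi / 2) + 2 * Real.pi) ∩
      Icc (Real.pi / 2 + θ) (3 * Real.pi / 2) = Icc (Real.pi / 2 + θ) (3 * Real.pi / 2) from
    inter_eq_right.2 (fun x hx => ⟨by linarith [hx.1], by linarith [hx.2]⟩)]
  simp only [integral_const, smul_eq_mul, mul_one, measureReal_restrict_apply_univ]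
  rw [Real.volume_real_Icc_of_le (by linarith)]
  ring

lemma measure_orthogonal_eq_zero {u : E} (hu : u ≠ 0) : μ {a | inner ℝ u a = 0} = 0 := by
  have h := Measure.addHaar_submodule μ (LinearMap.ker (innerₗ E u)) (by
    intro h
    have : u ∈ LinearMap.ker (innerₗ E u) := by rw [h]; trivial
    simp at this
    exact hu this)
  rw [← h]
  congr 1

lemma measurableSet_lune (u v : E) : MeasurableSet {a : E | inner ℝ u a ≤ 0 ∧ inner ℝ v a ≤ 0} := by
  exact (measurableSet_le (f := fun a : E => inner ℝ u a) (by fun_prop) measurable_const).inter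
    (measurableSet_le (f := fun a : E => inner ℝ v a) (by fun_prop) measurable_const)

lemma ball_lune_of_orthonormal (h₁ : ‖e₁‖ = 1) (h₂ : ‖e₂‖ = 1) (h₁₂ : inner ℝ e₁ e₂ = 0)
    {θ : ℝ} (h0 : 0 ≤ θ) (hπ : θ ≤ Real.pi) :
    2 * Real.pi * μ.real (Metric.ball 0 1 ∩
      {a | inner ℝ e₁ a ≤ 0 ∧ inner ℝ (Real.cos θ • e₁ + Real.sin θ • e₂) a ≤ 0})
      = (Real.pi - θ) * μ.real (Metric.ball 0 1) := by
  set L : Set E := {a | inner ℝ e₁ a ≤ 0 ∧ inner ℝ (Real.cos θ • e₁ + Real.sin θ • e₂) a ≤ 0}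
    with hL
  have hLm : MeasurableSet L := measurableSet_lune _ _
  have hpi := Real.pi_pos
  have : IsFiniteMeasure (μ.restrict (Metric.ball 0 1)) := ⟨by simp [measure_ball_lt_top]⟩
  set G : ℝ → E → ℝ := fun t a => if Real.cos t * inner ℝ e₁ a - Real.sin t * inner ℝ e₂ a ≤ 0 ∧
      Real.cos θ * (Real.cos t * inner ℝ e₁ a - Real.sin t * inner ℝ e₂ a) +
        Real.sin θ * (Real.sin t * inner ℝ e₁ a + Real.cos t * inner ℝ e₂ a) ≤ 0 then 1 else 0
    with hG
  have hGL : ∀ t a, G t a = L.indicator (fun _ => (1 : ℝ)) (planeRot h₁ h₂ h₁₂ t a) := by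
    intro t a
    simp only [hG, indicator_apply, hL, mem_ofPred_eq, planeRot_apply, inner_add_left,
      inner_smul_left, inner_planeRotLinear_left h₁ h₁₂, inner_planeRotLinear_right h₂ h₁₂,
      conj_trivial]
  have hin : ∀ t, ∫ a in Metric.ball 0 1, G t a ∂μ = μ.real (Metric.ball 0 1 ∩ L) := by
    intro t
    have : (fun a => G t a) = ((planeRot h₁ h₂ h₁₂ t) ⁻¹' L).indicator (fun _ => (1 : ℝ)) := by
      ext a; rw [hGL]; rfl
    rw [this, setIntegral_indicator ((planeRot h₁ h₂ h₁₂ t).continuous.measurable hLm)]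
    simp only [integral_const, smul_eq_mul, mul_one, measureReal_restrict_apply_univ]
    rw [measureReal_def, measureReal_def,
      ← addHaar_preimage_linearIsometryEquiv μ (planeRot h₁ h₂ h₁₂ t) (Metric.ball 0 1 ∩ L),
      preimage_inter, LinearIsometryEquiv.preimage_ball]
    simp
  have hout : ∀ a, inner ℝ e₁ a ≠ 0 → ∫ t in Ioc 0 (2 * Real.pi), G t a = Real.pi - θ := by
    intro a ha
    rw [← intervalIntegral.integral_of_le (by positivity)]
    set z : ℂ := ⟨inner ℝ e₁ a, inner ℝ e₂ a⟩ with hz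
    have hz0 : 0 < ‖z‖ := norm_pos_iff.2 (fun h => ha (by simpa [hz] using congrArg Complex.re h))
    have hre : inner ℝ e₁ a = ‖z‖ * Real.cos z.arg := by
      rw [Complex.norm_mul_cos_arg]
    have him : inner ℝ e₂ a = ‖z‖ * Real.sin z.arg := by
      rw [Complex.norm_mul_sin_arg]
    rw [← integral_indicator_two_arcs h0 hπ z.arg]
    congr 1
    ext t
    simp only [hG]
    have e1 : Real.cos t * inner ℝ e₁ a - Real.sin t * inner ℝ e₂ a
        = ‖z‖ * Real.cos (z.arg + t) := by
      rw [hre, him, Real.cos_add]; ring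
    have e2 : Real.cos θ * (Real.cos t * inner ℝ e₁ a - Real.sin t * inner ℝ e₂ a) +
        Real.sin θ * (Real.sin t * inner ℝ e₁ a + Real.cos t * inner ℝ e₂ a)
        = ‖z‖ * Real.cos (z.arg + t - θ) := by
      rw [hre, him, Real.cos_sub, Real.sin_add, Real.cos_add]; ring
    rw [e2, e1]
    simp only [mul_nonpos_iff, hz0.le, hz0.not_ge, true_and, false_and, or_false]
  have hswap : ∫ t in Ioc 0 (2 * Real.pi), ∫ a in Metric.ball 0 1, G t a ∂μ
      = ∫ a in Metric.ball 0 1, (∫ t in Ioc 0 (2 * Real.pi), G t a) ∂μ := by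
    apply integral_integral_swap
    apply Integrable.of_bound (C := 1)
    · apply Measurable.aestronglyMeasurable
      apply Measurable.ite _ measurable_const measurable_const
      refine (measurableSet_le (f := fun p : ℝ × E => Real.cos p.1 * inner ℝ e₁ p.2
        - Real.sin p.1 * inner ℝ e₂ p.2) (by fun_prop) measurable_const).inter
        (measurableSet_le (f := fun p : ℝ × E => Real.cos θ * (Real.cos p.1 * inner ℝ e₁ p.2
          - Real.sin p.1 * inner ℝ e₂ p.2) + Real.sin θ * (Real.sin p.1 * inner ℝ e₁ p.2
          + Real.cos p.1 * inner ℝ e₂ p.2)) (by fun_prop) measurable_const)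
    · filter_upwards with p
      simp only [Function.uncurry, hG]
      split_ifs <;> simp
  simp only [hin] at hswap
  rw [integral_const] at hswap
  simp only [smul_eq_mul, measureReal_restrict_apply_univ] at hswap
  rw [Real.volume_real_Ioc_of_le (by positivity), sub_zero] at hswap
  rw [hswap]
  have hne : e₁ ≠ 0 := by rintro rfl; simp at h₁
  have hae : ∀ᵐ a ∂(μ.restrict (Metric.ball 0 1)),
      ∫ t in Ioc 0 (2 * Real.pi), G t a = Real.pi - θ := by
    apply ae_restrict_of_ae
    have := measure_orthogonal_eq_zero μ hne
    have h' : ∀ᵐ a ∂μ, inner ℝ e₁ a ≠ 0 := by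
      rw [ae_iff]; simpa using this
    filter_upwards [h'] with a ha using hout a ha
  rw [integral_congr_ae hae]
  simp [mul_comm]

lemma ball_halfSpace {u : E} (hu : u ≠ 0) :
    2 * μ.real (Metric.ball 0 1 ∩ {a | inner ℝ u a ≤ 0}) = μ.real (Metric.ball 0 1) := by
  set B : Set E := Metric.ball 0 1
  have h0 := measure_orthogonal_eq_zero μ hu
  have hneg : μ.real (B ∩ {a | inner ℝ u a ≤ 0}) = μ.real (B ∩ {a | 0 ≤ inner ℝ u a}) := by
    rw [measureReal_def, measureReal_def,
      ← addHaar_preimage_linearIsometryEquiv μ (LinearIsometryEquiv.neg ℝ)]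
    congr 2
    ext a
    simp [B]
  have hge : μ.real (B ∩ {a | 0 ≤ inner ℝ u a}) = μ.real (B \ {a | inner ℝ u a ≤ 0}) := by
    apply measureReal_congr
    have h' : ∀ᵐ a ∂μ, inner ℝ u a ≠ 0 := by
      rw [ae_iff]; simpa using h0
    filter_upwards [h'] with a ha
    apply propext
    show (a ∈ B ∧ 0 ≤ inner ℝ u a) ↔ (a ∈ B ∧ ¬ inner ℝ u a ≤ 0)
    rw [not_le]
    exact and_congr_right fun _ => ⟨fun h => lt_of_le_of_ne h (Ne.symm ha), le_of_lt⟩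
  have hm : MeasurableSet {a : E | inner ℝ u a ≤ 0} :=
    measurableSet_le (by fun_prop) (by fun_prop)
  have := measureReal_inter_add_sdiff (μ := μ) (s := B) hm (measure_ball_lt_top.ne)
  rw [← this, ← hge, ← hneg]; ring

theorem ball_lune {u v : E} (hu : u ≠ 0) (hv : v ≠ 0) :
    2 * Real.pi * μ.real (Metric.ball 0 1 ∩ {a | inner ℝ u a ≤ 0 ∧ inner ℝ v a ≤ 0})
      = (Real.pi - InnerProductGeometry.angle u v) * μ.real (Metric.ball 0 1) := by
  have hu' : 0 < ‖u‖ := norm_pos_iff.2 hu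
  have hv' : 0 < ‖v‖ := norm_pos_iff.2 hv
  obtain ⟨e₁, he₁⟩ : ∃ e : E, e = ‖u‖⁻¹ • u := ⟨_, rfl⟩
  have h₁ : ‖e₁‖ = 1 := by rw [he₁, norm_smul, norm_inv, norm_norm]; field_simp
  have hue : u = ‖u‖ • e₁ := by rw [he₁, smul_smul]; field_simp; simp
  obtain ⟨w, hw⟩ : ∃ w : E, w = v - (inner ℝ e₁ v) • e₁ := ⟨_, rfl⟩
  have hew : inner ℝ e₁ w = 0 := by
    rw [hw, inner_sub_right, inner_smul_right, real_inner_self_eq_norm_sq, h₁]; ring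
  by_cases hw0 : w = 0
  · have hve : v = (inner ℝ e₁ v / ‖u‖) • u := by
      have h := sub_eq_zero.1 (hw.symm.trans hw0)
      rwa [he₁, smul_smul, ← div_eq_mul_inv, ← he₁] at h
    obtain ⟨r, hr⟩ : ∃ r : ℝ, r = inner ℝ e₁ v / ‖u‖ := ⟨_, rfl⟩
    rw [← hr] at hve
    have hr0 : r ≠ 0 := by rintro h; rw [h, zero_smul] at hve; exact hv hve
    rcases lt_or_gt_of_ne hr0 with hneg | hpos
    · rw [hve, InnerProductGeometry.angle_smul_right_of_neg _ _ hneg,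
        InnerProductGeometry.angle_neg_right, InnerProductGeometry.angle_self hu]
      have : μ.real (Metric.ball 0 1 ∩ {a | inner ℝ u a ≤ 0 ∧ inner ℝ (r • u) a ≤ 0}) = 0 := by
        rw [measureReal_def, measure_mono_null _ (measure_orthogonal_eq_zero μ hu)]
        · simp
        · rintro a ⟨_, h1, h2⟩
          rw [inner_smul_left, conj_trivial] at h2
          exact le_antisymm h1 (nonneg_of_mul_nonpos_right h2 hneg)
      rw [this]; simp
    · rw [hve, InnerProductGeometry.angle_smul_right_of_pos _ _ hpos,
        InnerProductGeometry.angle_self hu]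
      have : {a | inner ℝ u a ≤ 0 ∧ inner ℝ (r • u) a ≤ 0} = {a | inner ℝ u a ≤ 0} := by
        ext a
        simp only [mem_ofPred_eq, inner_smul_left, conj_trivial, and_iff_left_iff_imp]
        exact fun h => mul_nonpos_of_nonneg_of_nonpos hpos.le h
      rw [this, sub_zero, ← ball_halfSpace μ hu]; ring
  · have hw' : 0 < ‖w‖ := norm_pos_iff.2 hw0
    obtain ⟨e₂, he₂⟩ : ∃ e : E, e = ‖w‖⁻¹ • w := ⟨_, rfl⟩
    have h₂ : ‖e₂‖ = 1 := by rw [he₂, norm_smul, norm_inv, norm_norm]; field_simp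
    have hwe : w = ‖w‖ • e₂ := by rw [he₂, smul_smul]; field_simp; simp
    have h₁₂ : inner ℝ e₁ e₂ = 0 := by rw [he₂, inner_smul_right, hew, mul_zero]
    have hvd : v = (inner ℝ e₁ v) • e₁ + ‖w‖ • e₂ := by rw [← hwe, hw]; abel
    set θ := InnerProductGeometry.angle u v with hθ
    have hcos : ‖v‖ * Real.cos θ = inner ℝ e₁ v := by
      rw [hθ, InnerProductGeometry.cos_angle, he₁, inner_smul_left, conj_trivial]; field_simp
    have hsq : ‖v‖ ^ 2 = (inner ℝ e₁ v) ^ 2 + ‖w‖ ^ 2 := by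
      have h21 : inner ℝ e₂ e₁ = 0 := by rw [real_inner_comm]; exact h₁₂
      generalize inner ℝ e₁ v = x at hvd
      rw [hvd, ← real_inner_self_eq_norm_sq]
      simp only [inner_add_right, inner_add_left, inner_smul_left, inner_smul_right, conj_trivial,
        real_inner_self_eq_norm_sq, h₁, h₂, h₁₂, h21]
      ring
    have hsin : ‖v‖ * Real.sin θ = ‖w‖ := by
      have hs0 : 0 ≤ Real.sin θ := InnerProductGeometry.sin_angle_nonneg _ _
      rw [← sq_eq_sq₀ (by positivity) hw'.le]
      rw [← hcos] at hsq
      linear_combination hsq + ‖v‖ ^ 2 * Real.sin_sq_add_cos_sq θ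
    have key := ball_lune_of_orthonormal μ h₁ h₂ h₁₂ (InnerProductGeometry.angle_nonneg u v)
      (InnerProductGeometry.angle_le_pi u v)
    rw [← key]
    congr 4
    have hv2 : v = ‖v‖ • (Real.cos θ • e₁ + Real.sin θ • e₂) := by
      rw [smul_add, smul_smul ‖v‖, smul_smul ‖v‖, hcos, hsin]; exact hvd
    ext a
    have i1 : inner ℝ u a ≤ 0 ↔ inner ℝ e₁ a ≤ 0 := by
      conv_lhs => rw [hue]
      rw [inner_smul_left, conj_trivial]
      exact ⟨fun h => nonpos_of_mul_nonpos_right h hu', mul_nonpos_of_nonneg_of_nonpos hu'.le⟩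
    have i2 : inner ℝ v a ≤ 0 ↔ inner ℝ (Real.cos θ • e₁ + Real.sin θ • e₂) a ≤ 0 := by
      conv_lhs => rw [hv2]
      rw [inner_smul_left, conj_trivial]
      exact ⟨fun h => nonpos_of_mul_nonpos_right h hv', mul_nonpos_of_nonneg_of_nonpos hv'.le⟩
    rw [i1, i2]

/-- The constant relating the surface measure of a lune to its angle. -/
def sphereConst : ℝ := μ.toSphere.real univ / (2 * Real.pi)

lemma sphereConst_pos [Nontrivial E] : 0 < sphereConst μ := by
  have : μ.toSphere.real univ ≠ 0 := by
    have : NeZero μ.toSphere := ⟨μ.toSphere_ne_zero⟩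
    exact measureReal_univ_ne_zero
  have h : 0 ≤ μ.toSphere.real univ := measureReal_nonneg
  have := lt_of_le_of_ne h (Ne.symm this)
  unfold sphereConst
  positivity

open scoped Pointwise in
theorem toSphere_lune {u v : E} (hu : u ≠ 0) (hv : v ≠ 0) :
    μ.toSphere.real {a | inner ℝ (a : E) u ≤ 0 ∧ inner ℝ (a : E) v ≤ 0}
      = sphereConst μ * (Real.pi - InnerProductGeometry.angle u v) := by
  have : Nontrivial E := ⟨⟨u, 0, hu⟩⟩
  set L : Set E := {a | inner ℝ u a ≤ 0 ∧ inner ℝ v a ≤ 0} with hL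
  have hLm : MeasurableSet L := measurableSet_lune u v
  have e0 : {a : Metric.sphere (0 : E) 1 | inner ℝ (a : E) u ≤ 0 ∧ inner ℝ (a : E) v ≤ 0}
      = (fun a : Metric.sphere (0 : E) 1 => (a : E)) ⁻¹' L := by
    ext a; simp [hL, real_inner_comm]
  have hcone : Ioo (0 : ℝ) 1 • ((fun a : Metric.sphere (0 : E) 1 => (a : E)) ''
      ((fun a : Metric.sphere (0 : E) 1 => (a : E)) ⁻¹' L)) = (Metric.ball 0 1 ∩ L) \ {0} := by
    ext a
    simp only [mem_smul, mem_image, mem_preimage, Subtype.exists, mem_sphere_iff_norm, sub_zero,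
      mem_sdiff, mem_inter_iff, Metric.mem_ball, dist_zero_right, mem_singleton_iff, mem_Ioo]
    constructor
    · rintro ⟨r, ⟨h0, h1⟩, b, ⟨c, hc, hcL, rfl⟩, rfl⟩
      refine ⟨⟨?_, ?_, ?_⟩, ?_⟩
      · rw [norm_smul, hc, Real.norm_of_nonneg h0.le]; linarith
      · rw [inner_smul_right]; exact mul_nonpos_of_nonneg_of_nonpos h0.le hcL.1
      · rw [inner_smul_right]; exact mul_nonpos_of_nonneg_of_nonpos h0.le hcL.2
      · rw [smul_eq_zero, not_or]
        exact ⟨h0.ne', by rintro rfl; simp at hc⟩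
    · rintro ⟨⟨hn, haL⟩, ha0⟩
      have hpos : 0 < ‖a‖ := norm_pos_iff.2 ha0
      refine ⟨‖a‖, ⟨hpos, hn⟩, ‖a‖⁻¹ • a, ⟨_, ?_, ⟨?_, ?_⟩, rfl⟩, ?_⟩
      · rw [norm_smul, norm_inv, norm_norm]; field_simp
      · rw [inner_smul_right]
        exact mul_nonpos_of_nonneg_of_nonpos (by positivity) haL.1
      · rw [inner_smul_right]
        exact mul_nonpos_of_nonneg_of_nonpos (by positivity) haL.2
      · rw [smul_smul]; field_simp; simp
  have key := ball_lune μ hu hv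
  rw [e0, measureReal_def, μ.toSphere_apply' (measurable_subtype_coe hLm), hcone,
    measure_sdiff_null (measure_singleton _), sphereConst, μ.toSphere_real_apply_univ,
    ENNReal.toReal_mul, ENNReal.toReal_natCast]
  have hpi := Real.pi_pos
  rw [measureReal_def, measureReal_def] at key
  rw [measureReal_def, div_mul_eq_mul_div, eq_div_iff (by positivity)]
  linear_combination (Module.finrank ℝ E : ℝ) * key

end Lune

/-! ### Angle kernels -/

section Kernel

variable {E F : Type*} [NormedAddCommGroup E] [InnerProductSpace ℝ E]
  [NormedAddCommGroup F] [InnerProductSpace ℝ F]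

/-- The angle between two vectors, with value `0` if one of them vanishes. -/
def vertexAngle (u v : E) : ℝ :=
  open Classical in if u = 0 ∨ v = 0 then 0 else InnerProductGeometry.angle u v

lemma vertexAngle_of_ne {u v : E} (hu : u ≠ 0) (hv : v ≠ 0) :
    vertexAngle u v = InnerProductGeometry.angle u v := by
  simp [vertexAngle, hu, hv]

lemma vertexAngle_nonneg (u v : E) : 0 ≤ vertexAngle u v := by
  unfold vertexAngle
  split_ifs
  exacts [le_rfl, InnerProductGeometry.angle_nonneg u v]

lemma vertexAngle_le_pi (u v : E) : vertexAngle u v ≤ Real.pi := by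
  unfold vertexAngle
  split_ifs
  exacts [Real.pi_pos.le, InnerProductGeometry.angle_le_pi u v]

/-- The double difference of the angles at the vertex `r`. -/
def angleDiff (r k k' l l' : E) : ℝ :=
  vertexAngle (k - r) (l - r) - vertexAngle (k - r) (l' - r)
    - vertexAngle (k' - r) (l - r) + vertexAngle (k' - r) (l' - r)

lemma abs_angleDiff_le (r k k' l l' : E) : |angleDiff r k k' l l'| ≤ 2 * Real.pi := by
  have h1 := vertexAngle_nonneg (k - r) (l - r)
  have h2 := vertexAngle_nonneg (k - r) (l' - r)
  have h3 := vertexAngle_nonneg (k' - r) (l - r)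
  have h4 := vertexAngle_nonneg (k' - r) (l' - r)
  have g1 := vertexAngle_le_pi (k - r) (l - r)
  have g2 := vertexAngle_le_pi (k - r) (l' - r)
  have g3 := vertexAngle_le_pi (k' - r) (l - r)
  have g4 := vertexAngle_le_pi (k' - r) (l' - r)
  unfold angleDiff
  rw [abs_le]
  constructor <;> linarith

/-- The kernel of the squared projection covariance. -/
def covKernel (w : Fin 5 → E × F) : ℝ :=
  4⁻¹ * (angleDiff (w 0).1 (w 1).1 (w 2).1 (w 3).1 (w 4).1
    * angleDiff (w 0).2 (w 1).2 (w 2).2 (w 3).2 (w 4).2)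

lemma abs_covKernel_le (w : Fin 5 → E × F) : |covKernel w| ≤ 10 := by
  unfold covKernel
  rw [abs_mul, abs_mul, abs_of_pos (by norm_num : (0 : ℝ) < 4⁻¹)]
  have h1 := abs_angleDiff_le (w 0).1 (w 1).1 (w 2).1 (w 3).1 (w 4).1
  have h2 := abs_angleDiff_le (w 0).2 (w 1).2 (w 2).2 (w 3).2 (w 4).2
  have h3 := mul_le_mul h1 h2 (abs_nonneg _) (by positivity)
  have := Real.pi_lt_d2
  have := Real.pi_pos
  nlinarith

variable [MeasurableSpace E] [BorelSpace E] [MeasurableSpace F] [BorelSpace F]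
  [SecondCountableTopology E] [SecondCountableTopology F]

lemma measurable_vertexAngle : Measurable fun p : E × E => vertexAngle p.1 p.2 := by
  unfold vertexAngle
  apply Measurable.ite _ measurable_const
  · unfold InnerProductGeometry.angle
    exact Real.continuous_arccos.measurable.comp (by fun_prop)
  · exact (measurableSet_eq_fun measurable_fst measurable_const).union
      (measurableSet_eq_fun measurable_snd measurable_const)

lemma Measurable.vertexAngle {α : Type*} [MeasurableSpace α] {f g : α → E} (hf : Measurable f)
    (hg : Measurable g) : Measurable fun x => vertexAngle (f x) (g x) :=
  measurable_vertexAngle.comp (hf.prodMk hg)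

lemma Measurable.angleDiff {α : Type*} [MeasurableSpace α] {r k k' l l' : α → E}
    (hr : Measurable r) (hk : Measurable k) (hk' : Measurable k') (hl : Measurable l)
    (hl' : Measurable l') :
    Measurable fun x => angleDiff (r x) (k x) (k' x) (l x) (l' x) :=
  (((Measurable.vertexAngle (hk.sub hr) (hl.sub hr)).sub
    (Measurable.vertexAngle (hk.sub hr) (hl'.sub hr))).sub
    (Measurable.vertexAngle (hk'.sub hr) (hl.sub hr))).add
    (Measurable.vertexAngle (hk'.sub hr) (hl'.sub hr))

lemma measurable_covKernel : Measurable (covKernel : (Fin 5 → E × F) → ℝ) := by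
  unfold covKernel
  exact ((Measurable.angleDiff (by fun_prop) (by fun_prop) (by fun_prop) (by fun_prop)
    (by fun_prop)).mul (Measurable.angleDiff (by fun_prop) (by fun_prop) (by fun_prop)
    (by fun_prop) (by fun_prop))).const_mul _

/-- The squared projection covariance, normalised by the surface constants. -/
def angleCov (μ : Measure (E × F)) : ℝ :=
  ∫ w, covKernel w ∂(Measure.pi fun _ : Fin 5 => μ)

end Kernel

/-! ### Ties -/

lemma measure_eq_of_indepFun {Ω E : Type*} [MeasurableSpace Ω] [MeasurableSpace E]
    [MeasurableEq E] {P : Measure Ω} [IsProbabilityMeasure P] {X Y : Ω → E}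
    (hX : Measurable X) (hY : Measurable Y) (h : IndepFun X Y P)
    (ha : NullSingletonClass (P.map Y)) : ∀ᵐ ω ∂P, X ω ≠ Y ω := by
  have hm : MeasurableSet {p : E × E | p.1 = p.2} := 
    measurableSet_eq_fun measurable_fst measurable_snd
  have : IsProbabilityMeasure (P.map X) := Measure.isProbabilityMeasure_map hX.aemeasurable
  have : IsProbabilityMeasure (P.map Y) := Measure.isProbabilityMeasure_map hY.aemeasurable
  have h1 := (indepFun_iff_map_prod_eq_prod_map_map hX.aemeasurable hY.aemeasurable).1 h
  have h2 : (P.map fun ω => (X ω, Y ω)) {p : E × E | p.1 = p.2} = 0 := by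
    rw [h1, Measure.prod_apply hm]
    simp only [lintegral_eq_zero_iff (measurable_measure_prodMk_left hm)]
    filter_upwards with x
    have : Prod.mk x ⁻¹' {p : E × E | p.1 = p.2} = {x} := by ext y; simp [eq_comm]
    rw [this]; simp
  rw [Measure.map_apply (hX.prodMk hY) hm] at h2
  rw [ae_iff]
  simpa using h2

lemma ae_pi_ne {ι Z E : Type*} [Fintype ι] [MeasurableSpace Z] [MeasurableSpace E]
    [MeasurableEq E] {μ : Measure Z} [IsProbabilityMeasure μ] {f : Z → E}
    (hf : Measurable f) (ha : NullSingletonClass (μ.map f)) :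
    ∀ᵐ w ∂(Measure.pi fun _ : ι => μ), ∀ i j, i ≠ j → f (w i) ≠ f (w j) := by
  rw [ae_all_iff]; intro i
  rw [ae_all_iff]; intro j
  rw [ae_all_iff]; intro hij
  have hind : iIndepFun (fun (i : ι) (w : ι → Z) => f (w i)) (Measure.pi fun _ : ι => μ) :=
    iIndepFun_pi (X := fun _ => f) (fun _ => hf.aemeasurable)
  refine measure_eq_of_indepFun (hf.comp (measurable_pi_apply i))
    (hf.comp (measurable_pi_apply j)) (hind.indepFun hij) ?_
  have : (Measure.pi fun _ : ι => μ).map (fun w => f (w j)) = μ.map f := by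
    rw [show (fun w : ι → Z => f (w j)) = f ∘ (fun w => w j) from rfl,
      ← Measure.map_map hf (measurable_pi_apply j), (measurePreserving_eval _ j).map_eq]
  exact this.symm ▸ ha

/-! ### The projection covariance as an expected kernel -/

lemma map_finFive_eq_pi {Z : Type*} [MeasurableSpace Z] (μ : Measure Z) [IsProbabilityMeasure μ] :
    (μ.prod ((μ.prod μ).prod (μ.prod μ))).map
      (fun q => (![q.1, q.2.1.1, q.2.1.2, q.2.2.1, q.2.2.2] : Fin 5 → Z))
      = Measure.pi fun _ => μ := by
  symm
  apply Measure.pi_eq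
  intro s hs
  rw [Measure.map_apply _ (MeasurableSet.univ_pi hs)]
  · have : (fun q : Z × ((Z × Z) × (Z × Z)) =>
        (![q.1, q.2.1.1, q.2.1.2, q.2.2.1, q.2.2.2] : Fin 5 → Z)) ⁻¹' univ.pi s
        = s 0 ×ˢ ((s 1 ×ˢ s 2) ×ˢ (s 3 ×ˢ s 4)) := by
      ext q
      simp [Fin.forall_fin_succ, and_assoc]
    rw [this]
    simp only [Measure.prod_prod, Fin.prod_univ_five]
    ring
  · rw [measurable_pi_iff]
    intro i
    fin_cases i <;> simp <;> fun_prop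

section Population

variable {E F : Type*}
  [NormedAddCommGroup E] [InnerProductSpace ℝ E] [MeasurableSpace E] [BorelSpace E]
  [NormedAddCommGroup F] [InnerProductSpace ℝ F] [MeasurableSpace F] [BorelSpace F]
  [FiniteDimensional ℝ E] [FiniteDimensional ℝ F]

/-- The indicator of `aᵀ x ≤ aᵀ z`. -/
def halfInd (a x z : E) : ℝ := if inner ℝ a x ≤ inner ℝ a z then 1 else 0

lemma abs_halfInd_le (a x z : E) : |halfInd a x z| ≤ 1 := by
  unfold halfInd; split_ifs <;> simp

lemma Measurable.halfInd {α : Type*} [MeasurableSpace α] {a x z : α → E} (ha : Measurable a)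
    (hx : Measurable x) (hz : Measurable z) :
    Measurable fun p => halfInd (a p) (x p) (z p) :=
  Measurable.ite (measurableSet_le (ha.inner hx) (ha.inner hz)) measurable_const measurable_const

lemma integrable_of_abs_le {α : Type*} [MeasurableSpace α] {m : Measure α} [IsFiniteMeasure m]
    {f : α → ℝ} (hf : Measurable f) (C : ℝ) (h : ∀ x, |f x| ≤ C) : Integrable f m :=
  Integrable.of_bound hf.aestronglyMeasurable C (Filter.Eventually.of_forall h)

lemma integral_halfInd_mul (a r : E) (b t : F) (μ : Measure (E × F)) [IsFiniteMeasure μ] :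
    ∫ w, halfInd a w.1 r * halfInd b w.2 t ∂μ
      = μ.real {w | inner ℝ a w.1 ≤ inner ℝ a r ∧ inner ℝ b w.2 ≤ inner ℝ b t} := by
  rw [← integral_indicator_one]
  · congr 1
    ext w
    simp only [halfInd, indicator_apply, mem_ofPred_eq, Pi.one_apply]
    split_ifs <;> simp_all
  · exact (measurableSet_le (f := fun w : E × F => inner ℝ a w.1) (by fun_prop)
      measurable_const).inter (measurableSet_le (f := fun w : E × F => inner ℝ b w.2)
      (by fun_prop) measurable_const)

lemma covariance_eq_half_integral {Z : Type*} [MeasurableSpace Z] (μ : Measure Z)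
    [IsProbabilityMeasure μ] {f g : Z → ℝ} (hf : Measurable f) (hg : Measurable g)
    (hfb : ∀ z, |f z| ≤ 1) (hgb : ∀ z, |g z| ≤ 1) :
    ∫ z, f z * g z ∂μ - (∫ z, f z ∂μ) * ∫ z, g z ∂μ
      = 2⁻¹ * ∫ p, (f p.1 - f p.2) * (g p.1 - g p.2) ∂(μ.prod μ) := by
  have hfg : ∀ x y, |f x * g y| ≤ 1 := fun x y => by
    rw [abs_mul]; exact mul_le_one₀ (hfb _) (abs_nonneg _) (hgb _)
  have i1 : Integrable (fun p : Z × Z => f p.1 * g p.1) (μ.prod μ) :=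
    integrable_of_abs_le (by fun_prop) 1 fun p => hfg _ _
  have i2 : Integrable (fun p : Z × Z => f p.1 * g p.2) (μ.prod μ) :=
    integrable_of_abs_le (by fun_prop) 1 fun p => hfg _ _
  have i3 : Integrable (fun p : Z × Z => g p.1 * f p.2) (μ.prod μ) :=
    integrable_of_abs_le (by fun_prop) 1 fun p => by rw [mul_comm]; exact hfg _ _
  have i4 : Integrable (fun p : Z × Z => f p.2 * g p.2) (μ.prod μ) :=
    integrable_of_abs_le (by fun_prop) 1 fun p => hfg _ _
  have e1 : ∫ p, f p.1 * g p.1 ∂(μ.prod μ) = ∫ z, f z * g z ∂μ := by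
    rw [integral_fun_fst (f := fun z => f z * g z)]; simp
  have e4 : ∫ p, f p.2 * g p.2 ∂(μ.prod μ) = ∫ z, f z * g z ∂μ := by
    rw [integral_fun_snd (f := fun z => f z * g z)]; simp
  have e2 := integral_prod_mul (μ := μ) (ν := μ) f g
  have e3 := integral_prod_mul (μ := μ) (ν := μ) g f
  have : ∀ p : Z × Z, (f p.1 - f p.2) * (g p.1 - g p.2)
      = (f p.1 * g p.1 - f p.1 * g p.2) - (g p.1 * f p.2 - f p.2 * g p.2) := fun p => by ring
  have i12 : Integrable (fun p : Z × Z => f p.1 * g p.1 - f p.1 * g p.2) (μ.prod μ) := i1.sub i2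
  have i34 : Integrable (fun p : Z × Z => g p.1 * f p.2 - f p.2 * g p.2) (μ.prod μ) := i3.sub i4
  simp only [this]
  rw [integral_sub i12 i34, integral_sub i1 i2, integral_sub i3 i4, e1, e2, e3, e4]
  ring

/-- The integrand of the squared projection covariance along the directions `a`, for a vertex `r`
and two pairs of points. -/
def pairDiff (a r k k' l l' : E) : ℝ :=
  (halfInd a k r - halfInd a k' r) * (halfInd a l r - halfInd a l' r)

lemma abs_pairDiff_le (a r k k' l l' : E) : |pairDiff a r k k' l l'| ≤ 1 := by
  unfold pairDiff halfInd
  split_ifs <;> simp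

lemma Measurable.pairDiff {α : Type*} [MeasurableSpace α] {a r k k' l l' : α → E}
    (ha : Measurable a) (hr : Measurable r) (hk : Measurable k) (hk' : Measurable k')
    (hl : Measurable l) (hl' : Measurable l') :
    Measurable fun x => pairDiff (a x) (r x) (k x) (k' x) (l x) (l' x) :=
  ((Measurable.halfInd ha hk hr).sub (Measurable.halfInd ha hk' hr)).mul
    ((Measurable.halfInd ha hl hr).sub (Measurable.halfInd ha hl' hr))

lemma integral_pairDiff (m : Measure E) [m.IsAddHaarMeasure] {r k k' l l' : E} (hk : k ≠ r)
    (hk' : k' ≠ r) (hl : l ≠ r) (hl' : l' ≠ r) :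
    ∫ a : Metric.sphere (0 : E) 1, pairDiff (a : E) r k k' l l' ∂m.toSphere
      = - (sphereConst m * angleDiff r k k' l l') := by
  have key : ∀ x y : E, x ≠ r → y ≠ r →
      ∫ a : Metric.sphere (0 : E) 1, halfInd (a : E) x r * halfInd (a : E) y r ∂m.toSphere
        = sphereConst m * (Real.pi - vertexAngle (x - r) (y - r)) := by
    intro x y hx hy
    rw [vertexAngle_of_ne (sub_ne_zero.2 hx) (sub_ne_zero.2 hy),
      ← toSphere_lune m (sub_ne_zero.2 hx) (sub_ne_zero.2 hy), ← integral_indicator_one]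
    · congr 1
      ext a
      simp only [halfInd, indicator_apply, mem_ofPred_eq, Pi.one_apply, inner_sub_right,
        sub_nonpos]
      split_ifs <;> simp_all
    · exact measurable_subtype_coe
        ((measurableSet_le (f := fun a : E => inner ℝ a (x - r)) (by fun_prop)
          measurable_const).inter
        (measurableSet_le (f := fun a : E => inner ℝ a (y - r)) (by fun_prop) measurable_const))
  have hint : ∀ x y : E, Integrable (fun a : Metric.sphere (0 : E) 1 =>
      halfInd (a : E) x r * halfInd (a : E) y r) m.toSphere := by
    intro x y
    refine integrable_of_abs_le ((Measurable.halfInd measurable_subtype_coe measurable_const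
      measurable_const).mul (Measurable.halfInd measurable_subtype_coe measurable_const
      measurable_const)) 1 fun a => ?_
    rw [abs_mul]
    exact mul_le_one₀ (abs_halfInd_le _ _ _) (abs_nonneg _) (abs_halfInd_le _ _ _)
  have : ∀ a : Metric.sphere (0 : E) 1, pairDiff (a : E) r k k' l l'
      = (halfInd (a : E) k r * halfInd (a : E) l r - halfInd (a : E) k r * halfInd (a : E) l' r)
        - (halfInd (a : E) k' r * halfInd (a : E) l r
          - halfInd (a : E) k' r * halfInd (a : E) l' r) := by
    intro a; unfold pairDiff; ring
  have hint' : ∀ x y z : E, Integrable (fun a : Metric.sphere (0 : E) 1 =>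
      halfInd (a : E) x r * halfInd (a : E) y r - halfInd (a : E) x r * halfInd (a : E) z r)
      m.toSphere := fun x y z => (hint x y).sub (hint x z)
  simp only [this]
  rw [integral_sub (hint' _ _ _) (hint' _ _ _),
    integral_sub (hint _ _) (hint _ _), integral_sub (hint _ _) (hint _ _),
    key _ _ hk hl, key _ _ hk hl', key _ _ hk' hl, key _ _ hk' hl', angleDiff]
  ring

end Population

section ProjCov

variable {E F : Type*}
  [NormedAddCommGroup E] [InnerProductSpace ℝ E] [MeasureSpace E] [BorelSpace E]
  [NormedAddCommGroup F] [InnerProductSpace ℝ F] [MeasureSpace F] [BorelSpace F]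
  [FiniteDimensional ℝ E] [FiniteDimensional ℝ F]
  [(volume : Measure E).IsAddHaarMeasure] [(volume : Measure F).IsAddHaarMeasure]

lemma indicatorCov_eq (μ : Measure (E × F)) [IsProbabilityMeasure μ] (a r : E) (b t : F) :
    indicatorCov μ a b (inner ℝ a r) (inner ℝ b t)
      = 2⁻¹ * ∫ p, (halfInd a p.1.1 r - halfInd a p.2.1 r)
        * (halfInd b p.1.2 t - halfInd b p.2.2 t) ∂(μ.prod μ) := by
  rw [← covariance_eq_half_integral μ
    (f := fun z => halfInd a z.1 r) (g := fun z => halfInd b z.2 t)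
    (Measurable.halfInd measurable_const measurable_fst measurable_const)
    (Measurable.halfInd measurable_const measurable_snd measurable_const)
    (fun _ => abs_halfInd_le _ _ _) (fun _ => abs_halfInd_le _ _ _), integral_halfInd_mul]
  unfold indicatorCov
  congr 2
  · rw [← integral_indicator_one (measurableSet_le (by fun_prop) (by fun_prop))]
    congr 1
  · rw [← integral_indicator_one (measurableSet_le (by fun_prop) (by fun_prop))]
    congr 1

theorem projCovSq_eq_angleCov (μ : Measure (E × F)) [IsProbabilityMeasure μ]
    (h₁ : NullSingletonClass μ.fst) (h₂ : NullSingletonClass μ.snd) :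
    projCovSq μ = sphereConst (volume : Measure E) * sphereConst (volume : Measure F)
      * angleCov μ := by
  set Q := μ.prod ((μ.prod μ).prod (μ.prod μ)) with hQ
  set A : E → (E × F) × (((E × F) × (E × F)) × ((E × F) × (E × F))) → ℝ := fun a q =>
    pairDiff a q.1.1 q.2.1.1.1 q.2.1.2.1 q.2.2.1.1 q.2.2.2.1 with hA
  set B : F → (E × F) × (((E × F) × (E × F)) × ((E × F) × (E × F))) → ℝ := fun b q =>
    pairDiff b q.1.2 q.2.1.1.2 q.2.1.2.2 q.2.2.1.2 q.2.2.2.2 with hB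
  have mA : ∀ {α : Type _} [MeasurableSpace α] {f : α → E}
      {g : α → (E × F) × (((E × F) × (E × F)) × ((E × F) × (E × F)))},
      Measurable f → Measurable g → Measurable fun x => A (f x) (g x) := by
    intro α _ f g hf hg
    exact Measurable.pairDiff hf (by fun_prop) (by fun_prop) (by fun_prop) (by fun_prop)
      (by fun_prop)
  have mB : ∀ {α : Type _} [MeasurableSpace α] {f : α → F}
      {g : α → (E × F) × (((E × F) × (E × F)) × ((E × F) × (E × F)))},
      Measurable f → Measurable g → Measurable fun x => B (f x) (g x) := by
    intro α _ f g hf hg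
    exact Measurable.pairDiff hf (by fun_prop) (by fun_prop) (by fun_prop) (by fun_prop)
      (by fun_prop)
  have bA : ∀ a q, |A a q| ≤ 1 := fun a q => abs_pairDiff_le _ _ _ _ _ _
  have bB : ∀ b q, |B b q| ≤ 1 := fun b q => abs_pairDiff_le _ _ _ _ _ _
  have bAB : ∀ a b q, |4⁻¹ * (A a q * B b q)| ≤ 1 := by
    intro a b q
    rw [abs_mul, abs_mul, abs_of_pos (by norm_num : (0 : ℝ) < 4⁻¹)]
    have := mul_le_one₀ (bA a q) (abs_nonneg _) (bB b q)
    linarith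
  have hinner : ∀ (a : E) (b : F),
      ∫ z, indicatorCov μ a b (inner ℝ a z.1) (inner ℝ b z.2) ^ 2 ∂μ
        = ∫ q, 4⁻¹ * (A a q * B b q) ∂Q := by
    intro a b
    have hi : Integrable (fun q => 4⁻¹ * (A a q * B b q)) Q :=
      integrable_of_abs_le (((mA measurable_const measurable_id).mul
        (mB measurable_const measurable_id)).const_mul _) 1 (bAB a b)
    rw [hQ, integral_prod _ hi]
    congr 1
    ext z
    rw [indicatorCov_eq, mul_pow, sq (∫ p, _ ∂_), ← integral_prod_mul, integral_const_mul]
    congr 1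
    · norm_num
    · congr 1
      ext p
      simp only [hA, hB, pairDiff]
      ring
  unfold projCovSq
  simp only [hinner]
  have hb : ∀ a : E, ∫ b : Metric.sphere (0 : F) 1, ∫ q, 4⁻¹ * (A a q * B b q) ∂Q
        ∂((volume : Measure F).toSphere)
      = ∫ q, A a q * (4⁻¹ * ∫ b : Metric.sphere (0 : F) 1, B b q
        ∂((volume : Measure F).toSphere)) ∂Q := by
    intro a
    rw [integral_integral_swap]
    · congr 1
      ext q
      rw [← integral_const_mul, ← integral_const_mul]
      congr 1
      ext b
      ring
    · exact integrable_of_abs_le (((mA measurable_const measurable_snd).mul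
        (mB (measurable_subtype_coe.comp measurable_fst) measurable_snd)).const_mul _) 1
        (fun p => bAB a p.1 p.2)
  simp only [hb]
  rw [integral_integral_swap]
  · have hm : Measurable (fun q : (E × F) × (((E × F) × (E × F)) × ((E × F) × (E × F))) =>
        (![q.1, q.2.1.1, q.2.1.2, q.2.2.1, q.2.2.2] : Fin 5 → E × F)) := by
      rw [measurable_pi_iff]
      intro i
      fin_cases i <;> simp <;> fun_prop
    unfold angleCov
    rw [← map_finFive_eq_pi μ, integral_map hm.aemeasurable
      measurable_covKernel.aestronglyMeasurable, ← integral_const_mul]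
    have t1 := ae_of_ae_map hm.aemeasurable ((map_finFive_eq_pi μ).symm ▸
      ae_pi_ne (ι := Fin 5) (μ := μ) measurable_fst h₁)
    have t2 := ae_of_ae_map hm.aemeasurable ((map_finFive_eq_pi μ).symm ▸
      ae_pi_ne (ι := Fin 5) (μ := μ) measurable_snd h₂)
    apply integral_congr_ae
    filter_upwards [t1, t2] with q q1 q2
    rw [integral_mul_const]
    simp only [hA, hB]
    have e1 := integral_pairDiff volume (q1 1 0 (by decide)) (q1 2 0 (by decide))
      (q1 3 0 (by decide)) (q1 4 0 (by decide))
    have e2 := integral_pairDiff volume (q2 1 0 (by decide)) (q2 2 0 (by decide))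
      (q2 3 0 (by decide)) (q2 4 0 (by decide))
    simp only [covKernel]
    change _ * (4⁻¹ * _) = _
    refine (congrArg₂ (fun x y : ℝ => x * (4⁻¹ * y)) e1 e2).trans ?_
    ring
  · have hmB : Measurable fun q => ∫ b : Metric.sphere (0 : F) 1, B b q
        ∂((volume : Measure F).toSphere) := by
      apply StronglyMeasurable.measurable
      exact StronglyMeasurable.integral_prod_right
        (f := fun q (b : Metric.sphere (0 : F) 1) => B b q)
        ((mB (measurable_subtype_coe.comp measurable_snd) measurable_fst).stronglyMeasurable)
    refine integrable_of_abs_le ((mA (measurable_subtype_coe.comp measurable_fst)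
      measurable_snd).mul ((hmB.comp measurable_snd).const_mul _))
      (1 * (4⁻¹ * (volume : Measure F).toSphere.real univ)) fun p => ?_
    rw [Function.uncurry, abs_mul, abs_mul, abs_of_pos (by norm_num : (0 : ℝ) < 4⁻¹)]
    gcongr
    · exact bA _ _
    · have := norm_integral_le_of_norm_le_const (μ := (volume : Measure F).toSphere)
        (f := fun b : Metric.sphere (0 : F) 1 => B b p.2) (C := 1)
        (Filter.Eventually.of_forall fun b => bB _ _)
      simpa using this

/-- The normalised projection variance. -/
def angleVar (ν : Measure E) : ℝ := angleCov (ν.map fun x => (x, x))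

lemma projVarSq_eq_angleVar (ν : Measure E) [IsProbabilityMeasure ν] (h : NullSingletonClass ν) :
    projVarSq ν = sphereConst (volume : Measure E) ^ 2 * angleVar ν := by
  have hm : Measurable fun x : E => (x, x) := by fun_prop
  have : IsProbabilityMeasure (ν.map fun x => (x, x)) :=
    Measure.isProbabilityMeasure_map hm.aemeasurable
  have e1 : (ν.map fun x => (x, x)).fst = ν := by
    rw [Measure.fst, Measure.map_map measurable_fst hm]; exact Measure.map_id
  have e2 : (ν.map fun x => (x, x)).snd = ν := by
    rw [Measure.snd, Measure.map_map measurable_snd hm]; exact Measure.map_id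
  rw [projVarSq, projCovSq_eq_angleCov _ (by rwa [e1]) (by rwa [e2]), angleVar]
  ring

theorem projCorrSq_eq [Nontrivial E] [Nontrivial F] (μ : Measure (E × F)) [IsProbabilityMeasure μ]
    (h₁ : NullSingletonClass μ.fst) (h₂ : NullSingletonClass μ.snd) :
    projCorrSq μ = angleCov μ / (√(angleVar μ.fst) * √(angleVar μ.snd)) := by
  have hE := sphereConst_pos (volume : Measure E)
  have hF := sphereConst_pos (volume : Measure F)
  rw [projCorrSq, projCovSq_eq_angleCov μ h₁ h₂, projVarSq_eq_angleVar _ h₁,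
    projVarSq_eq_angleVar _ h₂, Real.sqrt_mul (by positivity), Real.sqrt_mul (by positivity),
    Real.sqrt_sq hE.le, Real.sqrt_sq hF.le, mul_mul_mul_comm]
  exact mul_div_mul_left _ _ (mul_pos hE hF).ne'

end ProjCov

/-! ### A uniform lower bound for the projection variance of atomless laws -/

lemma measurable_comp_index {ι κ Z : Type*} [MeasurableSpace Z] (f : κ → ι) :
    Measurable fun w : ι → Z => w ∘ f :=
  measurable_pi_lambda _ fun i => measurable_pi_apply (f i)

lemma map_comp_injective_pi {ι κ Z : Type*} [Fintype ι] [Fintype κ] [MeasurableSpace Z]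
    (μ : Measure Z) [IsProbabilityMeasure μ] {f : κ → ι} (hf : Function.Injective f) :
    (Measure.pi fun _ : ι => μ).map (fun w => w ∘ f) = Measure.pi fun _ : κ => μ := by
  have h1 : iIndepFun (fun (i : ι) (w : ι → Z) => w i) (Measure.pi fun _ : ι => μ) :=
    iIndepFun_pi (X := fun _ => id) (fun _ => aemeasurable_id)
  have h2 := h1.precomp hf
  have h3 := (iIndepFun_iff_map_fun_eq_pi_map
    (fun k => (measurable_pi_apply (f k)).aemeasurable)).1 h2
  have h4 : ∀ k, (Measure.pi fun _ : ι => μ).map (fun w => w (f k)) = μ := fun k =>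
    (measurePreserving_eval (fun _ : ι => μ) (f k)).map_eq
  have h5 : (fun k => (Measure.pi fun _ : ι => μ).map ((fun (i : ι) (w : ι → Z) => w i) (f k)))
      = fun _ => μ := funext h4
  exact h3.trans (congrArg Measure.pi h5)

lemma map_finThree_eq_pi {Z : Type*} [MeasurableSpace Z] (μ : Measure Z) [IsProbabilityMeasure μ] :
    (μ.prod (μ.prod μ)).map (fun q => (![q.1, q.2.1, q.2.2] : Fin 3 → Z))
      = Measure.pi fun _ => μ := by
  symm
  apply Measure.pi_eq
  intro s hs
  rw [Measure.map_apply _ (MeasurableSet.univ_pi hs)]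
  · have : (fun q : Z × (Z × Z) => (![q.1, q.2.1, q.2.2] : Fin 3 → Z)) ⁻¹' univ.pi s
        = s 0 ×ˢ (s 1 ×ˢ s 2) := by
      ext q
      simp [Fin.forall_fin_succ]
    rw [this]
    simp only [Measure.prod_prod, Fin.prod_univ_three]
    ring
  · rw [measurable_pi_iff]
    intro i
    fin_cases i <;> simp <;> fun_prop

section LowerBound

variable {E : Type*} [NormedAddCommGroup E] [InnerProductSpace ℝ E] [FiniteDimensional ℝ E]

variable (E) in
lemma exists_finite_angle_cover {δ : ℝ} (hδ : 0 < δ) :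
    ∃ T : Finset E, ∀ u : E, u ≠ 0 → ∃ c ∈ T, InnerProductGeometry.angle u c < δ := by
  have hc : IsCompact (Metric.sphere (0 : E) 1) := isCompact_sphere 0 1
  obtain ⟨T, -, hT⟩ := hc.elim_nhds_subcover (fun c => {u | InnerProductGeometry.angle u c < δ})
    (by
      intro c hc
      have hc0 : c ≠ 0 := by rintro rfl; simp at hc
      have hcont : ContinuousAt (fun u => InnerProductGeometry.angle u c) c := by
        have h := InnerProductGeometry.continuousAt_angle (x := (c, c)) hc0 hc0
        exact h.comp (f := fun u : E => (u, c)) (by fun_prop)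
      apply hcont.eventually_lt_const
      simpa [InnerProductGeometry.angle_self hc0] using hδ)
  refine ⟨T, fun u hu => ?_⟩
  have hn : 0 < ‖u‖ := norm_pos_iff.2 hu
  have : ‖u‖⁻¹ • u ∈ Metric.sphere (0 : E) 1 := by
    rw [mem_sphere_zero_iff_norm, norm_smul, norm_inv, norm_norm]; field_simp
  obtain ⟨c, hcT, hcu⟩ := mem_iUnion₂.1 (hT this)
  refine ⟨c, hcT, ?_⟩
  rw [mem_ofPred_eq, InnerProductGeometry.angle_smul_left_of_pos _ _ (inv_pos.2 hn)] at hcu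
  exact hcu

variable [MeasurableSpace E] [BorelSpace E]

lemma integral_triangle_angle (ν : Measure E) [IsProbabilityMeasure ν]
    (h : NullSingletonClass ν) :
    ∫ w : Fin 3 → E, vertexAngle (w 1 - w 0) (w 2 - w 0) ∂(Measure.pi fun _ => ν)
      = Real.pi / 3 := by
  set m := Measure.pi fun _ : Fin 3 => ν with hm
  set τ : (Fin 3 → E) → ℝ := fun w => vertexAngle (w 1 - w 0) (w 2 - w 0) with hτ
  have hτm : Measurable τ := Measurable.vertexAngle (by fun_prop) (by fun_prop)
  have hτb : ∀ w, |τ w| ≤ Real.pi := fun w => by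
    rw [abs_of_nonneg (vertexAngle_nonneg _ _)]; exact vertexAngle_le_pi _ _
  have hinv : ∀ σ : Fin 3 → Fin 3, Function.Injective σ → ∫ w, τ (w ∘ σ) ∂m = ∫ w, τ w ∂m := by
    intro σ hσ
    conv_rhs => rw [hm, ← map_comp_injective_pi ν hσ]
    rw [integral_map (measurable_comp_index σ).aemeasurable hτm.aestronglyMeasurable]
  have hint : ∀ σ : Fin 3 → Fin 3, Integrable (fun w => τ (w ∘ σ)) m := fun σ =>
    integrable_of_abs_le (hτm.comp (measurable_comp_index σ)) _
      fun w => hτb _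
  have hsum : ∫ w, (τ (w ∘ ![0, 1, 2]) + τ (w ∘ ![1, 0, 2]) + τ (w ∘ ![2, 0, 1])) ∂m
      = Real.pi := by
    have hae : ∀ᵐ w ∂m, τ (w ∘ ![0, 1, 2]) + τ (w ∘ ![1, 0, 2]) + τ (w ∘ ![2, 0, 1])
        = Real.pi := by
      filter_upwards [ae_pi_ne (ι := Fin 3) (μ := ν) (f := id) measurable_id
        (by rwa [Measure.map_id])] with w hw
      have h01 : w 0 ≠ w 1 := hw 0 1 (by decide)
      have h02 : w 0 ≠ w 2 := hw 0 2 (by decide)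
      have h12 : w 1 ≠ w 2 := hw 1 2 (by decide)
      have key := InnerProductGeometry.angle_add_angle_sub_add_angle_sub_eq_pi (w 1 - w 0)
        (sub_ne_zero.2 h02.symm)
      simp only [hτ, Function.comp]
      simp
      rw [vertexAngle_of_ne (sub_ne_zero.2 h01.symm) (sub_ne_zero.2 h02.symm),
        vertexAngle_of_ne (sub_ne_zero.2 h01) (sub_ne_zero.2 h12.symm),
        vertexAngle_of_ne (sub_ne_zero.2 h02) (sub_ne_zero.2 h12),
        ← InnerProductGeometry.angle_neg_neg (w 0 - w 1),
        ← InnerProductGeometry.angle_neg_neg (w 0 - w 2)]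
      simpa using key
    rw [integral_congr_ae hae]; simp
  have h012 : Integrable (fun w => τ (w ∘ ![0, 1, 2]) + τ (w ∘ ![1, 0, 2])) m :=
    (hint _).add (hint _)
  rw [integral_add h012 (hint _), integral_add (hint _) (hint _),
    hinv _ (by decide), hinv _ (by decide), hinv _ (by decide)] at hsum
  linarith

lemma angleVar_eq_integral (ν : Measure E) [IsProbabilityMeasure ν] :
    angleVar ν = ∫ z, ∫ p : (E × E) × (E × E), 4⁻¹ * angleDiff z p.1.1 p.1.2 p.2.1 p.2.2 ^ 2
      ∂((ν.prod ν).prod (ν.prod ν)) ∂ν := by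
  have hd : Measurable fun x : E => (x, x) := by fun_prop
  have : IsProbabilityMeasure (ν.map fun x => (x, x)) :=
    Measure.isProbabilityMeasure_map hd.aemeasurable
  have hm : Measurable (fun q : E × ((E × E) × (E × E)) =>
        (![q.1, q.2.1.1, q.2.1.2, q.2.2.1, q.2.2.2] : Fin 5 → E)) := by
    rw [measurable_pi_iff]
    intro i
    fin_cases i <;> simp <;> fun_prop
  have h1 : (Measure.pi fun _ : Fin 5 => ν).map (fun w i => (w i, w i))
      = Measure.pi fun _ : Fin 5 => ν.map fun x => (x, x) :=
    Measure.pi_map_pi (fun _ => hd.aemeasurable)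
  have h2 : Measurable fun (w : Fin 5 → E) i => (w i, w i) := by fun_prop
  have h3 : Measurable fun w : Fin 5 → E => covKernel fun i => (w i, w i) :=
    measurable_covKernel.comp h2
  rw [angleVar, angleCov, ← h1, integral_map h2.aemeasurable
    measurable_covKernel.aestronglyMeasurable, ← map_finFive_eq_pi ν,
    integral_map hm.aemeasurable h3.aestronglyMeasurable, integral_prod]
  · congr 1
    ext z
    congr 1
    ext p
    simp only [covKernel, sq]
    rfl
  · exact integrable_of_abs_le (h3.comp hm) 10 fun q => abs_covKernel_le _

lemma angleDiff_le_of_near {r k k' l l' c c' : E} {δ : ℝ} (hk : k ≠ r) (hk' : k' ≠ r) (hl : l ≠ r)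
    (hl' : l' ≠ r) (ck : InnerProductGeometry.angle (k - r) c < δ)
    (cl : InnerProductGeometry.angle (l - r) c < δ)
    (ck' : InnerProductGeometry.angle (k' - r) c' < δ)
    (cl' : InnerProductGeometry.angle (l' - r) c' < δ) :
    angleDiff r k k' l l' ≤ 8 * δ - 2 * InnerProductGeometry.angle c c' := by
  have hk := sub_ne_zero.2 hk
  have hk' := sub_ne_zero.2 hk'
  have hl := sub_ne_zero.2 hl
  have hl' := sub_ne_zero.2 hl'
  rw [angleDiff, vertexAngle_of_ne hk hl, vertexAngle_of_ne hk hl', vertexAngle_of_ne hk' hl,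
    vertexAngle_of_ne hk' hl']
  generalize k - r = k at *
  generalize k' - r = k' at *
  generalize l - r = l at *
  generalize l' - r = l' at *
  have a1 := InnerProductGeometry.angle_le_angle_add_angle k c l
  have a2 := InnerProductGeometry.angle_le_angle_add_angle k' c' l'
  have a3 := InnerProductGeometry.angle_le_angle_add_angle c k c'
  have a4 := InnerProductGeometry.angle_le_angle_add_angle k l' c'
  have a5 := InnerProductGeometry.angle_le_angle_add_angle c l c'
  have a6 := InnerProductGeometry.angle_le_angle_add_angle l k' c'
  rw [InnerProductGeometry.angle_comm c l] at a1 a5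
  rw [InnerProductGeometry.angle_comm c' l'] at a2
  rw [InnerProductGeometry.angle_comm c k] at a3
  rw [InnerProductGeometry.angle_comm l k'] at a6
  linarith

variable (E) in
theorem exists_angleVar_lower_bound :
    ∃ c : ℝ, 0 < c ∧ ∀ (ν : Measure E) [IsProbabilityMeasure ν], NullSingletonClass ν →
      c ≤ angleVar ν := by
  have hpi := Real.pi_gt_three
  obtain ⟨T, hT⟩ := exists_finite_angle_cover E (δ := Real.pi / 72) (by positivity)
  set N : ℝ := (T.card : ℝ) with hN
  have hN0 : 0 ≤ N := by positivity
  refine ⟨(16 * (N + 1) ^ 4)⁻¹ * 36⁻¹, by positivity, fun ν _ hν => ?_⟩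
  rw [angleVar_eq_integral]
  set G : E → Set (E × E) := fun z =>
    {q | q.1 ≠ z ∧ q.2 ≠ z ∧ Real.pi / 6 ≤ vertexAngle (q.1 - z) (q.2 - z)} with hG
  set C : E → E → Set E := fun z c => {x | x ≠ z ∧ InnerProductGeometry.angle (x - z) c < Real.pi / 72}
    with hC
  have hCm : ∀ z c, MeasurableSet (C z c) := by
    intro z c
    refine (measurableSet_singleton z).compl.inter (measurableSet_lt
      (f := fun x => InnerProductGeometry.angle (x - z) c) ?_ measurable_const)
    unfold InnerProductGeometry.angle
    exact Real.continuous_arccos.measurable.comp (by fun_prop)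
  have hG3 : MeasurableSet {q : E × (E × E) | q.2.1 ≠ q.1 ∧ q.2.2 ≠ q.1 ∧
      Real.pi / 6 ≤ vertexAngle (q.2.1 - q.1) (q.2.2 - q.1)} := by
    refine (measurableSet_eq_fun (by fun_prop) (by fun_prop)).compl.inter
      ((measurableSet_eq_fun (by fun_prop) (by fun_prop)).compl.inter
      (measurableSet_le measurable_const (Measurable.vertexAngle (by fun_prop) (by fun_prop))))
  set p : E → ℝ := fun z => (ν.prod ν).real (G z) with hp
  have hpm : Measurable p := (measurable_measure_prodMk_left (ν := ν.prod ν) hG3).ennreal_toReal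
  have hp0 : ∀ z, 0 ≤ p z := fun z => measureReal_nonneg
  have hp1 : ∀ z, p z ≤ 1 := fun z => measureReal_le_one
  have hGm : ∀ z, MeasurableSet (G z) := fun z => measurable_prodMk_left (x := z) hG3
  -- pointwise bound
  have hpt : ∀ z, (16 * (N + 1) ^ 4)⁻¹ * p z ^ 2
      ≤ ∫ q : (E × E) × (E × E), 4⁻¹ * angleDiff z q.1.1 q.1.2 q.2.1 q.2.2 ^ 2
      ∂((ν.prod ν).prod (ν.prod ν)) := by
    intro z
    have hcov : G z ⊆ ⋃ c ∈ T ×ˢ T, (C z c.1 ×ˢ C z c.2) ∩ G z := by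
      rintro ⟨x, y⟩ ⟨hx, hy, hxy⟩
      obtain ⟨c, hcT, hc⟩ := hT (x - z) (sub_ne_zero.2 hx)
      obtain ⟨c', hcT', hc'⟩ := hT (y - z) (sub_ne_zero.2 hy)
      exact mem_iUnion₂.2 ⟨(c, c'), Finset.mem_product.2 ⟨hcT, hcT'⟩, ⟨⟨hx, hc⟩, hy, hc'⟩,
        hx, hy, hxy⟩
    have hle : p z ≤ ∑ c ∈ T ×ˢ T, (ν.prod ν).real ((C z c.1 ×ˢ C z c.2) ∩ G z) :=
      (measureReal_mono hcov (measure_ne_top _ _)).trans (measureReal_biUnion_finset_le _ _)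
    have hint0 : 0 ≤ ∫ q : (E × E) × (E × E), 4⁻¹ * angleDiff z q.1.1 q.1.2 q.2.1 q.2.2 ^ 2
        ∂((ν.prod ν).prod (ν.prod ν)) := integral_nonneg fun q => by positivity
    rcases (hp0 z).eq_or_lt with h0 | hpos
    · rw [← h0]; simpa using hint0
    obtain ⟨c, hcT, hc⟩ : ∃ c ∈ T ×ˢ T,
        p z / (N + 1) ^ 2 ≤ (ν.prod ν).real ((C z c.1 ×ˢ C z c.2) ∩ G z) := by
      by_contra! hcon
      have := Finset.sum_le_sum fun c hc => (hcon c hc).le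
      rw [Finset.sum_const, Finset.card_product, nsmul_eq_mul, Nat.cast_mul] at this
      have h2 := hle.trans this
      rw [← hN, mul_div_assoc', le_div_iff₀ (by positivity)] at h2
      nlinarith
    have hposc : 0 < p z / (N + 1) ^ 2 := by positivity
    obtain ⟨⟨x, y⟩, ⟨⟨hx, hxc⟩, hy, hyc⟩, -, -, hxy⟩ :
        ((C z c.1 ×ˢ C z c.2) ∩ G z).Nonempty := by
      rw [nonempty_iff_ne_empty]
      intro h
      rw [h] at hc
      simp at hc
      linarith
    simp only at hx hxc hy hyc hxy
    rw [vertexAngle_of_ne (sub_ne_zero.2 hx) (sub_ne_zero.2 hy)] at hxy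
    have b1 := InnerProductGeometry.angle_le_angle_add_angle (x - z) c.1 (y - z)
    have b2 := InnerProductGeometry.angle_le_angle_add_angle c.1 c.2 (y - z)
    rw [InnerProductGeometry.angle_comm c.2] at b2
    set R : Set ((E × E) × (E × E)) := (C z c.1 ×ˢ C z c.2) ×ˢ (C z c.1 ×ˢ C z c.2) with hR
    have hRm : MeasurableSet R := ((hCm _ _).prod (hCm _ _)).prod ((hCm _ _).prod (hCm _ _))
    have hRle : ∀ q, R.indicator (fun _ => (16 : ℝ)⁻¹) q
        ≤ 4⁻¹ * angleDiff z q.1.1 q.1.2 q.2.1 q.2.2 ^ 2 := by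
      intro q
      by_cases hq : q ∈ R
      · rw [indicator_of_mem hq]
        obtain ⟨⟨⟨k1, k2⟩, k'1, k'2⟩, ⟨l1, l2⟩, l'1, l'2⟩ := hq
        have := angleDiff_le_of_near k1 k'1 l1 l'1 k2 l2 k'2 l'2
        have h3 : angleDiff z q.1.1 q.1.2 q.2.1 q.2.2 ≤ -(1 / 2) := by linarith
        nlinarith
      · rw [indicator_of_notMem hq]; positivity
    have hmono : ∫ q, R.indicator (fun _ => (16 : ℝ)⁻¹) q ∂((ν.prod ν).prod (ν.prod ν))
        ≤ ∫ q : (E × E) × (E × E), 4⁻¹ * angleDiff z q.1.1 q.1.2 q.2.1 q.2.2 ^ 2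
        ∂((ν.prod ν).prod (ν.prod ν)) := by
      apply integral_mono
      · exact (integrable_const _).indicator hRm
      · refine integrable_of_abs_le (((Measurable.angleDiff (by fun_prop) (by fun_prop)
          (by fun_prop) (by fun_prop) (by fun_prop)).pow_const 2).const_mul _)
          (4⁻¹ * (2 * Real.pi) ^ 2) fun q => ?_
        rw [abs_mul, abs_of_pos (by norm_num : (0 : ℝ) < 4⁻¹), abs_pow]
        gcongr
        exact abs_angleDiff_le _ _ _ _ _
      · exact hRle
    refine le_trans ?_ hmono
    rw [integral_indicator hRm, setIntegral_const, smul_eq_mul, hR, measureReal_prod_prod]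
    have h4 : p z / (N + 1) ^ 2 ≤ (ν.prod ν).real (C z c.1 ×ˢ C z c.2) :=
      hc.trans (measureReal_mono inter_subset_left)
    have h5 := mul_le_mul h4 h4 hposc.le measureReal_nonneg
    calc (16 * (N + 1) ^ 4)⁻¹ * p z ^ 2
        = p z / (N + 1) ^ 2 * (p z / (N + 1) ^ 2) * 16⁻¹ := by field_simp
      _ ≤ _ := by gcongr
  -- the average of `p`
  have hpavg : 6⁻¹ ≤ ∫ z, p z ∂ν := by
    have hm : Measurable (fun q : E × (E × E) => (![q.1, q.2.1, q.2.2] : Fin 3 → E)) := by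
      rw [measurable_pi_iff]
      intro i
      fin_cases i <;> simp <;> fun_prop
    have hτm : Measurable fun w : Fin 3 → E => vertexAngle (w 1 - w 0) (w 2 - w 0) :=
      Measurable.vertexAngle (by fun_prop) (by fun_prop)
    have htri := integral_triangle_angle ν hν
    have hi : Integrable (fun q : E × (E × E) => vertexAngle (q.2.1 - q.1) (q.2.2 - q.1))
        (ν.prod (ν.prod ν)) :=
      integrable_of_abs_le (Measurable.vertexAngle (by fun_prop) (by fun_prop)) Real.pi fun q => by
        rw [abs_of_nonneg (vertexAngle_nonneg _ _)]; exact vertexAngle_le_pi _ _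
    rw [← map_finThree_eq_pi ν, integral_map hm.aemeasurable hτm.aestronglyMeasurable] at htri
    change ∫ q : E × (E × E), vertexAngle (q.2.1 - q.1) (q.2.2 - q.1) ∂_ = _ at htri
    rw [integral_prod _ hi] at htri
    have hzle : ∀ z, ∫ q : E × E, vertexAngle (q.1 - z) (q.2 - z) ∂(ν.prod ν)
        ≤ Real.pi / 6 + Real.pi * p z := by
      intro z
      have hle : ∀ q : E × E, vertexAngle (q.1 - z) (q.2 - z)
          ≤ Real.pi / 6 + (G z).indicator (fun _ => Real.pi) q := by
        intro q
        by_cases hq : q ∈ G z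
        · rw [indicator_of_mem hq]
          have := vertexAngle_le_pi (q.1 - z) (q.2 - z)
          linarith
        · rw [indicator_of_notMem hq]
          by_cases h1 : q.1 = z
          · simp [vertexAngle, h1]; positivity
          by_cases h2 : q.2 = z
          · simp [vertexAngle, h2]; positivity
          simp only [hG, mem_ofPred_eq, not_and, not_le] at hq
          linarith [hq h1 h2]
      have hind : Integrable ((G z).indicator (fun _ => Real.pi)) (ν.prod ν) :=
        (integrable_const _).indicator (hGm z)
      have := integral_mono (μ := ν.prod ν) (integrable_of_abs_le
        (Measurable.vertexAngle (by fun_prop) (by fun_prop)) Real.pi fun q => by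
          rw [abs_of_nonneg (vertexAngle_nonneg _ _)]; exact vertexAngle_le_pi _ _)
        ((integrable_const _).add hind) hle
      refine this.trans (le_of_eq ?_)
      simp only [Pi.add_apply]
      rw [integral_add (integrable_const _) hind, integral_indicator (hGm z), setIntegral_const]
      simp [hp, mul_comm]
    have hpi' : Integrable p ν := integrable_of_abs_le hpm 1 fun z => by
      rw [abs_of_nonneg (hp0 z)]; exact hp1 z
    have := integral_mono hi.integral_prod_left
      ((integrable_const (μ := ν) (Real.pi / 6)).add (hpi'.const_mul Real.pi)) hzle
    simp only [Pi.add_apply] at this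
    rw [integral_add (integrable_const _) (hpi'.const_mul _), integral_const_mul] at this
    simp only [integral_const, probReal_univ, smul_eq_mul, one_mul] at this
    rw [htri] at this
    have hh : Real.pi * 6⁻¹ ≤ Real.pi * ∫ z, p z ∂ν := by linarith
    exact le_of_mul_le_mul_left hh (by positivity)
  have hpi' : Integrable p ν := integrable_of_abs_le hpm 1 fun z => by
    rw [abs_of_nonneg (hp0 z)]; exact hp1 z
  have hpsq : Integrable (fun z => p z ^ 2) ν := integrable_of_abs_le (hpm.pow_const 2) 1 fun z => by
    rw [abs_of_nonneg (by positivity)]; exact pow_le_one₀ (hp0 z) (hp1 z)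
  have hsq : 36⁻¹ ≤ ∫ z, p z ^ 2 ∂ν := by
    have h1 : ∀ z, 3⁻¹ * p z - 36⁻¹ ≤ p z ^ 2 := fun z => by nlinarith [sq_nonneg (p z - 6⁻¹)]
    have := integral_mono ((hpi'.const_mul 3⁻¹).sub (integrable_const (36⁻¹ : ℝ))) hpsq h1
    simp only [Pi.sub_apply] at this
    rw [integral_sub (hpi'.const_mul 3⁻¹) (integrable_const _), integral_const_mul] at this
    simp only [integral_const, probReal_univ, smul_eq_mul, one_mul] at this
    linarith
  calc (16 * (N + 1) ^ 4)⁻¹ * 36⁻¹ ≤ (16 * (N + 1) ^ 4)⁻¹ * ∫ z, p z ^ 2 ∂ν := by gcongr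
    _ = ∫ z, (16 * (N + 1) ^ 4)⁻¹ * p z ^ 2 ∂ν := by rw [integral_const_mul]
    _ ≤ _ := by
      apply integral_mono (hpsq.const_mul _) _ hpt
      have hi : Integrable (fun q : E × ((E × E) × (E × E)) =>
          4⁻¹ * angleDiff q.1 q.2.1.1 q.2.1.2 q.2.2.1 q.2.2.2 ^ 2)
          (ν.prod ((ν.prod ν).prod (ν.prod ν))) := by
        refine integrable_of_abs_le (((Measurable.angleDiff (by fun_prop) (by fun_prop)
          (by fun_prop) (by fun_prop) (by fun_prop)).pow_const 2).const_mul _)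
          (4⁻¹ * (2 * Real.pi) ^ 2) fun q => ?_
        rw [abs_mul, abs_of_pos (by norm_num : (0 : ℝ) < 4⁻¹), abs_pow]
        gcongr
        exact abs_angleDiff_le _ _ _ _ _
      exact hi.integral_prod_left

end LowerBound

/-! ### Bounded differences and V-statistics -/

section BoundedDifferences

variable {Z : Type*} [MeasurableSpace Z] (μ : Measure Z) [IsProbabilityMeasure μ]

lemma measurable_finCons {n : ℕ} :
    Measurable fun p : Z × (Fin n → Z) => (Fin.cons p.1 p.2 : Fin (n + 1) → Z) := by
  rw [measurable_pi_iff]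
  intro i
  refine Fin.cases ?_ (fun j => ?_) i
  · simpa using measurable_fst
  · simp only [Fin.cons_succ]; fun_prop

lemma map_finCons_pi (n : ℕ) :
    (μ.prod (Measure.pi fun _ : Fin n => μ)).map
      (fun p => (Fin.cons p.1 p.2 : Fin (n + 1) → Z)) = Measure.pi fun _ => μ := by
  symm
  apply Measure.pi_eq
  intro s hs
  rw [Measure.map_apply measurable_finCons (MeasurableSet.univ_pi hs)]
  have : (fun p : Z × (Fin n → Z) => (Fin.cons p.1 p.2 : Fin (n + 1) → Z)) ⁻¹' univ.pi s
      = s 0 ×ˢ univ.pi (fun i => s i.succ) := by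
    ext p
    simp [Fin.forall_fin_succ]
  rw [this, Measure.prod_prod, Measure.pi_pi, Fin.prod_univ_succ]

lemma integral_exp_le_of_bounded_differences (n : ℕ) {f : (Fin n → Z) → ℝ} (hf : Measurable f)
    {B c : ℝ} (hB : ∀ w, |f w| ≤ B)
    (hc : ∀ w i z, |f (Function.update w i z) - f w| ≤ c) (t : ℝ) :
    ∫ w, Real.exp (t * (f w - ∫ v, f v ∂Measure.pi fun _ => μ)) ∂(Measure.pi fun _ => μ)
      ≤ Real.exp (n * c ^ 2 * t ^ 2 / 2) := by
  induction n generalizing B with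
  | zero =>
    have : ∀ w : Fin 0 → Z, f w = f default := fun w => congrArg f (Subsingleton.elim _ _)
    have h2 : f = fun _ => f default := funext this
    rw [h2]
    simp
  | succ n ih =>
    set g : (Fin n → Z) → ℝ := fun w => ∫ z, f (Fin.cons z w) ∂μ with hg
    set m := Measure.pi fun _ : Fin n => μ with hm
    have hfc : Measurable fun p : Z × (Fin n → Z) => f (Fin.cons p.1 p.2) :=
      hf.comp measurable_finCons
    have hfw : ∀ w : Fin n → Z, Measurable fun z => f (Fin.cons z w) := fun w =>
      hfc.comp (measurable_id.prodMk measurable_const)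
    have hfi : ∀ w : Fin n → Z, Integrable (fun z => f (Fin.cons z w)) μ := fun w =>
      integrable_of_abs_le (hfw w) B fun _ => hB _
    have hgm : Measurable g :=
      (StronglyMeasurable.integral_prod_right
        (f := fun (w : Fin n → Z) (z : Z) => f (Fin.cons z w))
        ((hfc.comp measurable_swap).stronglyMeasurable)).measurable
    have hgB : ∀ w, |g w| ≤ B := fun w => by
      have := norm_integral_le_of_norm_le_const (μ := μ) (f := fun z => f (Fin.cons z w)) (C := B)
        (Filter.Eventually.of_forall fun _ => hB _)
      simpa using this
    have hgc : ∀ w i z, |g (Function.update w i z) - g w| ≤ c := by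
      intro w i z
      rw [hg, ← integral_sub (hfi _) (hfi _)]
      have := norm_integral_le_of_norm_le_const (μ := μ) (C := c)
        (f := fun x => f (Fin.cons x (Function.update w i z)) - f (Fin.cons x w))
        (Filter.Eventually.of_forall fun x => by
          rw [Fin.cons_update, Real.norm_eq_abs]
          exact hc _ _ _)
      simpa using this
    have hEg : ∫ v, f v ∂(Measure.pi fun _ => μ) = ∫ w, g w ∂m := by
      rw [← map_finCons_pi μ n, integral_map measurable_finCons.aemeasurable
        hf.aestronglyMeasurable, ← hm, integral_prod_symm]
      exact integrable_of_abs_le hfc B fun _ => hB _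
    rw [hEg]
    set e := ∫ w, g w ∂m with he
    have heB : |e| ≤ B := by
      have := norm_integral_le_of_norm_le_const (μ := m) (f := g) (C := B)
        (Filter.Eventually.of_forall fun _ => hgB _)
      simpa using this
    have hexpm : Measurable fun w : Fin (n + 1) → Z => Real.exp (t * (f w - e)) := by fun_prop
    have hexpb : ∀ w : Fin (n + 1) → Z, |Real.exp (t * (f w - e))| ≤ Real.exp (|t| * (B + B)) := by
      intro w
      rw [Real.abs_exp, Real.exp_le_exp]
      refine (le_abs_self _).trans ?_
      rw [abs_mul]
      gcongr
      exact (abs_sub _ _).trans (add_le_add (hB _) heB)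
    rw [← map_finCons_pi μ n, integral_map measurable_finCons.aemeasurable
      hexpm.aestronglyMeasurable, ← hm]
    have hexpi : Integrable (fun p : Z × (Fin n → Z) => Real.exp (t * (f (Fin.cons p.1 p.2) - e)))
        (μ.prod m) :=
      integrable_of_abs_le (hexpm.comp measurable_finCons) _ fun _ => hexpb _
    rw [integral_prod_symm _ hexpi]
    have hz : ∀ w, ∫ z, Real.exp (t * (f (Fin.cons z w) - e)) ∂μ
        ≤ Real.exp (c ^ 2 * t ^ 2 / 2) * Real.exp (t * (g w - e)) := by
      intro w
      have h1 : ∀ z, Real.exp (t * (f (Fin.cons z w) - e))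
          = Real.exp (t * (f (Fin.cons z w) - g w)) * Real.exp (t * (g w - e)) := fun z => by
        rw [← Real.exp_add]; ring_nf
      simp only [h1]
      rw [integral_mul_const]
      gcongr
      have hosc : ∀ z, |f (Fin.cons z w) - g w| ≤ c := by
        intro z
        have h2 : f (Fin.cons z w) - g w = ∫ x, (f (Fin.cons z w) - f (Fin.cons x w)) ∂μ := by
          rw [integral_sub (integrable_const _) (hfi w)]; simp [hg]
        rw [h2]
        have := norm_integral_le_of_norm_le_const (μ := μ) (C := c)
          (f := fun x => f (Fin.cons z w) - f (Fin.cons x w))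
          (Filter.Eventually.of_forall fun x => by
            have h3 := hc (Fin.cons x w) 0 z
            rw [Fin.update_cons_zero] at h3
            exact h3)
        simpa using this
      have hsg := hasSubgaussianMGF_of_mem_Icc_of_integral_eq_zero (μ := μ) (a := -c) (b := c)
        (X := fun z => f (Fin.cons z w) - g w) ((hfw w).sub_const _).aemeasurable
        (Filter.Eventually.of_forall fun z => abs_le.1 (hosc z))
        (by rw [integral_sub (hfi w) (integrable_const _)]; simp [hg])
      have h4 := hsg.mgf_le t
      unfold mgf at h4
      have h5 : (((‖c - -c‖₊ / 2) ^ 2 : NNReal) : ℝ) = c ^ 2 := by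
        push_cast
        rw [Real.norm_eq_abs, div_pow, sq_abs]
        ring
      rwa [h5] at h4
    have hgexp : Integrable (fun w => Real.exp (t * (g w - e))) m := by
      refine integrable_of_abs_le (by fun_prop) (Real.exp (|t| * (B + B))) fun w => ?_
      rw [Real.abs_exp, Real.exp_le_exp]
      refine (le_abs_self _).trans ?_
      rw [abs_mul]
      gcongr
      exact (abs_sub _ _).trans (add_le_add (hgB _) heB)
    calc _ ≤ ∫ w, Real.exp (c ^ 2 * t ^ 2 / 2) * Real.exp (t * (g w - e)) ∂m := by
          exact integral_mono hexpi.integral_prod_right (hgexp.const_mul _) hz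
      _ = Real.exp (c ^ 2 * t ^ 2 / 2) * ∫ w, Real.exp (t * (g w - e)) ∂m := integral_const_mul _ _
      _ ≤ Real.exp (c ^ 2 * t ^ 2 / 2) * Real.exp (n * c ^ 2 * t ^ 2 / 2) := by
          gcongr
          exact ih hgm hgB hgc
      _ = _ := by rw [← Real.exp_add]; push_cast; ring_nf

/-- McDiarmid's inequality (with a suboptimal constant). -/
theorem measure_abs_sub_integral_ge_le {n : ℕ} {f : (Fin n → Z) → ℝ} (hf : Measurable f)
    {B c : ℝ} (hB : ∀ w, |f w| ≤ B)
    (hc : ∀ w i z, |f (Function.update w i z) - f w| ≤ c) {ε : ℝ} (hε : 0 ≤ ε) :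
    (Measure.pi fun _ => μ).real {w | ε ≤ |f w - ∫ v, f v ∂Measure.pi fun _ => μ|}
      ≤ 2 * Real.exp (-ε ^ 2 / (2 * (n * c ^ 2))) := by
  set m := Measure.pi fun _ : Fin n => μ with hm
  have key : ∀ f : (Fin n → Z) → ℝ, Measurable f → (∀ w, |f w| ≤ B) →
      (∀ w i z, |f (Function.update w i z) - f w| ≤ c) →
      m.real {w | ε ≤ f w - ∫ v, f v ∂m} ≤ Real.exp (-ε ^ 2 / (2 * (n * c ^ 2))) := by
    intro f hf hB hc
    have hsg : HasSubgaussianMGF (fun w => f w - ∫ v, f v ∂m)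
        ⟨n * c ^ 2, by positivity⟩ m := by
      constructor
      · intro t
        refine integrable_of_abs_le (by fun_prop) (Real.exp (|t| * (B + |∫ v, f v ∂m|)))
          fun w => ?_
        rw [Real.abs_exp, Real.exp_le_exp]
        refine (le_abs_self _).trans ?_
        rw [abs_mul]
        gcongr
        exact (abs_sub _ _).trans (add_le_add (hB _) le_rfl)
      · intro t
        exact integral_exp_le_of_bounded_differences μ n hf hB hc t
    exact hsg.measure_ge_le hε
  have h1 := key f hf hB hc
  have h2 := key (fun w => - f w) hf.neg (fun w => by rw [abs_neg]; exact hB w) (fun w i z => by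
    rw [← abs_neg]; simpa [add_comm, ← sub_eq_add_neg] using hc w i z)
  rw [integral_neg] at h2
  have hsub : {w | ε ≤ |f w - ∫ v, f v ∂m|}
      ⊆ {w | ε ≤ f w - ∫ v, f v ∂m} ∪ {w | ε ≤ - f w - - ∫ v, f v ∂m} := by
    intro w hw
    rcases le_abs.1 (show ε ≤ |f w - ∫ v, f v ∂m| from hw) with h | h
    · exact Or.inl h
    · right
      show ε ≤ - f w - - ∫ v, f v ∂m
      linarith
  calc _ ≤ _ := measureReal_mono hsub
    _ ≤ _ := measureReal_union_le _ _
    _ ≤ _ := by linarith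

end BoundedDifferences

section VStatistic

variable {Z : Type*}

/-- The V-statistic with kernel `h`. -/
def vStat {n : ℕ} {m : ℕ} (h : (Fin (m + 1) → Z) → ℝ) (w : Fin n → Z) : ℝ :=
  ((n : ℝ) ^ (m + 1))⁻¹ * ∑ i : Fin (m + 1) → Fin n, h (w ∘ i)

lemma card_filter_apply_eq_le {n m : ℕ} (a : Fin (m + 1)) (j : Fin n) :
    (Finset.univ.filter fun i : Fin (m + 1) → Fin n => i a = j).card ≤ n ^ m := by
  rw [← Fintype.card_subtype]
  have : Function.Injective fun (i : {i : Fin (m + 1) → Fin n // i a = j})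
      (x : {x : Fin (m + 1) // x ≠ a}) => i.1 x := by
    intro i i' hii
    ext x : 2
    by_cases hx : x = a
    · rw [hx, i.2, i'.2]
    · exact congrFun hii ⟨x, hx⟩
  refine (Fintype.card_le_of_injective _ this).trans ?_
  simp

lemma card_filter_apply_eq_apply_le {n m : ℕ} {a b : Fin (m + 1)} (hab : a ≠ b) :
    (Finset.univ.filter fun i : Fin (m + 1) → Fin n => i a = i b).card ≤ n ^ m := by
  rw [← Fintype.card_subtype]
  have : Function.Injective fun (i : {i : Fin (m + 1) → Fin n // i a = i b})
      (x : {x : Fin (m + 1) // x ≠ a}) => i.1 x := by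
    intro i i' hii
    ext x : 2
    by_cases hx : x = a
    · rw [hx, i.2, i'.2]; exact congrFun hii ⟨b, hab.symm⟩
    · exact congrFun hii ⟨x, hx⟩
  refine (Fintype.card_le_of_injective _ this).trans ?_
  simp

lemma card_filter_mem_range_le {n m : ℕ} (j : Fin n) :
    (Finset.univ.filter fun i : Fin (m + 1) → Fin n => ∃ a, i a = j).card
      ≤ (m + 1) * n ^ m := by
  have : (Finset.univ.filter fun i : Fin (m + 1) → Fin n => ∃ a, i a = j)
      ⊆ Finset.univ.biUnion fun a => Finset.univ.filter fun i : Fin (m + 1) → Fin n => i a = j := by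
    intro i hi
    simpa using hi
  refine (Finset.card_le_card this).trans (Finset.card_biUnion_le.trans ?_)
  refine (Finset.sum_le_card_nsmul _ _ _ fun a _ => card_filter_apply_eq_le a j).trans ?_
  simp

lemma card_filter_not_injective_le {n m : ℕ} :
    (Finset.univ.filter fun i : Fin (m + 1) → Fin n => ¬ Function.Injective i).card
      ≤ (m + 1) ^ 2 * n ^ m := by
  have : (Finset.univ.filter fun i : Fin (m + 1) → Fin n => ¬ Function.Injective i)
      ⊆ (Finset.univ.filter fun p : Fin (m + 1) × Fin (m + 1) => p.1 ≠ p.2).biUnion fun p =>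
        Finset.univ.filter fun i : Fin (m + 1) → Fin n => i p.1 = i p.2 := by
    intro i hi
    have hi := (Finset.mem_filter.1 hi).2
    unfold Function.Injective at hi
    push Not at hi
    obtain ⟨a, b, h1, h2⟩ := hi
    simp only [Finset.mem_biUnion, Finset.mem_filter, Finset.mem_univ, true_and]
    exact ⟨(a, b), h2, h1⟩
  refine (Finset.card_le_card this).trans (Finset.card_biUnion_le.trans ?_)
  refine (Finset.sum_le_card_nsmul _ _ (n ^ m) fun p hp =>
    card_filter_apply_eq_apply_le (by simpa using hp)).trans ?_
  rw [smul_eq_mul]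
  refine Nat.mul_le_mul_right _ ((Finset.card_filter_le _ _).trans ?_)
  simp [sq]

variable {n m : ℕ} {h : (Fin (m + 1) → Z) → ℝ} {B : ℝ}

lemma abs_vStat_le (hn : 0 < n) (hB : ∀ v, |h v| ≤ B) (w : Fin n → Z) : |vStat h w| ≤ B := by
  have hn' : (0 : ℝ) < n := by exact_mod_cast hn
  rw [vStat, abs_mul, abs_of_pos (by positivity), inv_mul_le_iff₀ (by positivity)]
  refine (Finset.abs_sum_le_sum_abs _ _).trans ?_
  refine (Finset.sum_le_card_nsmul _ _ B fun i _ => hB _).trans ?_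
  simp

lemma abs_vStat_update_sub_le (hn : 0 < n) (hB : ∀ v, |h v| ≤ B) (w : Fin n → Z) (j : Fin n)
    (z : Z) : |vStat h (Function.update w j z) - vStat h w| ≤ 2 * B * (m + 1) / n := by
  have hn' : (0 : ℝ) < n := by exact_mod_cast hn
  rw [vStat, vStat, ← mul_sub, ← Finset.sum_sub_distrib, abs_mul, abs_of_pos (by positivity),
    inv_mul_le_iff₀ (by positivity)]
  refine (Finset.abs_sum_le_sum_abs _ _).trans ?_
  have h0 : 0 ≤ B := (abs_nonneg _).trans (hB fun _ => z)
  have h1 : ∀ i : Fin (m + 1) → Fin n, |h (Function.update w j z ∘ i) - h (w ∘ i)|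
      ≤ if ∃ a, i a = j then 2 * B else 0 := by
    intro i
    split_ifs with hi
    · refine (abs_sub _ _).trans ?_
      linarith [hB (Function.update w j z ∘ i), hB (w ∘ i)]
    · push Not at hi
      have : Function.update w j z ∘ i = w ∘ i := by
        ext a
        simp [Function.update_of_ne (hi a)]
      rw [this]; simp
  refine (Finset.sum_le_sum fun i _ => h1 i).trans ?_
  rw [← Finset.sum_filter, Finset.sum_const, nsmul_eq_mul]
  have h2 : ((Finset.univ.filter fun i : Fin (m + 1) → Fin n => ∃ a, i a = j).card : ℝ)
      ≤ (m + 1) * n ^ m := by exact_mod_cast card_filter_mem_range_le j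
  calc _ ≤ ((m + 1) * n ^ m : ℝ) * (2 * B) := by gcongr
    _ = _ := by rw [pow_succ (n : ℝ) m]; field_simp

variable [MeasurableSpace Z]

lemma measurable_vStat (hm : Measurable h) : Measurable (vStat h : (Fin n → Z) → ℝ) := by
  unfold vStat
  exact (Finset.measurable_sum _ fun i _ => hm.comp (measurable_comp_index i)).const_mul _

variable (μ : Measure Z) [IsProbabilityMeasure μ]

lemma abs_integral_vStat_sub_le (hn : 0 < n) (hm : Measurable h) (hB : ∀ v, |h v| ≤ B) :
    |∫ w, vStat h w ∂(Measure.pi fun _ : Fin n => μ) - ∫ v, h v ∂(Measure.pi fun _ => μ)|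
      ≤ 2 * B * (m + 1) ^ 2 / n := by
  have hn' : (0 : ℝ) < n := by exact_mod_cast hn
  set θ := ∫ v, h v ∂(Measure.pi fun _ => μ) with hθ
  have hm' : ∀ i : Fin (m + 1) → Fin n, Measurable fun w : Fin n → Z => h (w ∘ i) := fun i =>
    hm.comp (measurable_comp_index i)
  have hb : ∀ i : Fin (m + 1) → Fin n,
      |∫ w, h (w ∘ i) ∂(Measure.pi fun _ : Fin n => μ)| ≤ B := fun i => by
    have := norm_integral_le_of_norm_le_const (μ := Measure.pi fun _ : Fin n => μ) (C := B)
      (f := fun w => h (w ∘ i)) (Filter.Eventually.of_forall fun _ => hB _)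
    simpa using this
  have hθb : |θ| ≤ B := by
    have := norm_integral_le_of_norm_le_const (μ := Measure.pi fun _ : Fin (m + 1) => μ) (C := B)
      (f := h) (Filter.Eventually.of_forall fun _ => hB _)
    simpa using this
  have hB0 : 0 ≤ B := (abs_nonneg _).trans hθb
  have h1 : ∫ w, vStat h w ∂(Measure.pi fun _ : Fin n => μ) - θ
      = ((n : ℝ) ^ (m + 1))⁻¹ * ∑ i : Fin (m + 1) → Fin n,
        (∫ w, h (w ∘ i) ∂(Measure.pi fun _ : Fin n => μ) - θ) := by
    unfold vStat
    rw [integral_const_mul, integral_finsetSum _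
      (fun i _ => integrable_of_abs_le (hm' i) B fun _ => hB _), Finset.sum_sub_distrib, mul_sub]
    congr 1
    simp
    field_simp
  rw [h1, abs_mul, abs_of_pos (by positivity), inv_mul_le_iff₀ (by positivity)]
  refine (Finset.abs_sum_le_sum_abs _ _).trans ?_
  have h2 : ∀ i : Fin (m + 1) → Fin n,
      |∫ w, h (w ∘ i) ∂(Measure.pi fun _ : Fin n => μ) - θ|
      ≤ if ¬ Function.Injective i then 2 * B else 0 := by
    intro i
    split_ifs with hi
    · rw [hθ, ← map_comp_injective_pi μ hi, integral_map
        (measurable_comp_index i).aemeasurable hm.aestronglyMeasurable]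
      simp
    · refine (abs_sub _ _).trans ?_
      linarith [hb i]
  refine (Finset.sum_le_sum fun i _ => h2 i).trans ?_
  rw [← Finset.sum_filter, Finset.sum_const, nsmul_eq_mul]
  have h3 : ((Finset.univ.filter fun i : Fin (m + 1) → Fin n => ¬ Function.Injective i).card : ℝ)
      ≤ (m + 1) ^ 2 * n ^ m := by exact_mod_cast card_filter_not_injective_le
  calc _ ≤ ((m + 1) ^ 2 * n ^ m : ℝ) * (2 * B) := by gcongr
    _ = _ := by rw [pow_succ (n : ℝ) m]; field_simp

/-- Exponential concentration of a V-statistic with bounded kernel. -/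
theorem measure_vStat_sub_ge_le (hn : 0 < n) (hm : Measurable h) (hB0 : 0 < B)
    (hB : ∀ v, |h v| ≤ B) {ε : ℝ} (hε : 0 < ε) (hε1 : ε ≤ 1) :
    (Measure.pi fun _ : Fin n => μ).real {w | ε ≤ |vStat h w - ∫ v, h v ∂(Measure.pi fun _ => μ)|}
      ≤ 2 * Real.exp ((2 * B)⁻¹) * Real.exp (-(n * ε ^ 2 / (8 * (2 * B * (m + 1)) ^ 2))) := by
  have hn' : (0 : ℝ) < n := by exact_mod_cast hn
  set θ := ∫ v, h v ∂(Measure.pi fun _ => μ) with hθ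
  set D : ℝ := 2 * B * (m + 1) with hD
  have hD0 : 0 < D := by positivity
  have hbias := abs_integral_vStat_sub_le μ hn hm hB (n := n)
  rw [← hθ, show 2 * B * ((m : ℝ) + 1) ^ 2 / n = D * (m + 1) / n by rw [hD]; ring] at hbias
  by_cases hlarge : 2 * (D * (m + 1)) / n ≤ ε
  · have hsub : {w | ε ≤ |vStat h w - θ|} ⊆ {w : Fin n → Z | ε / 2 ≤ |vStat h w -
        ∫ v, vStat h v ∂(Measure.pi fun _ : Fin n => μ)|} := by
      intro w hw
      simp only [mem_ofPred_eq] at hw ⊢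
      have h1 := abs_sub_le (vStat h w) (∫ v, vStat h v ∂(Measure.pi fun _ : Fin n => μ)) θ
      have h2 : 2 * (D * (m + 1)) / n = 2 * (D * (m + 1) / n) := by ring
      linarith
    refine (measureReal_mono hsub).trans ((measure_abs_sub_integral_ge_le μ (measurable_vStat hm)
      (abs_vStat_le hn hB) (abs_vStat_update_sub_le hn hB) (by positivity)).trans ?_)
    rw [← hD]
    have h3 : -(ε / 2) ^ 2 / (2 * (n * (D / n) ^ 2)) = -(n * ε ^ 2 / (8 * D ^ 2)) := by
      field_simp; ring
    rw [h3]
    have h4 : 1 ≤ Real.exp ((2 * B)⁻¹) := Real.one_le_exp (by positivity)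
    have h5 := Real.exp_pos (-(n * ε ^ 2 / (8 * D ^ 2)))
    nlinarith
  · refine measureReal_le_one.trans ?_
    rw [not_le, lt_div_iff₀ hn'] at hlarge
    rw [mul_assoc, ← Real.exp_add]
    have h1 : (n : ℝ) * ε ^ 2 ≤ 2 * (D * (m + 1)) := by
      have : (n : ℝ) * ε ^ 2 ≤ ε * n := by nlinarith [mul_pos hn' hε]
      linarith
    have h2 : n * ε ^ 2 / (8 * D ^ 2) ≤ (2 * B)⁻¹ := by
      rw [div_le_iff₀ (by positivity)]
      have : (2 * B)⁻¹ * (8 * D ^ 2) = 8 * (D * (m + 1)) := by rw [hD]; field_simp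
      rw [this]
      have : 0 < D * (m + 1) := by positivity
      linarith
    have := Real.one_le_exp (x := (2 * B)⁻¹ + -(n * ε ^ 2 / (8 * D ^ 2))) (by linarith)
    linarith

end VStatistic

/-! ### The sample projection correlation concentrates -/

section Algebra

lemma sum_sum_sub_mul_sub {ι : Type*} [Fintype ι] (u v : ι → ℝ) (hu : ∑ i, u i = 0) :
    ∑ i, ∑ j, (u i - u j) * (v i - v j) = 2 * Fintype.card ι * ∑ i, u i * v i := by
  have h : ∀ i j, (u i - u j) * (v i - v j) = u i * v i - u i * v j - u j * v i + u j * v j :=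
    fun i j => by ring
  simp only [h, Finset.sum_add_distrib, Finset.sum_sub_distrib, ← Finset.mul_sum,
    ← Finset.sum_mul, hu, Finset.sum_const, Finset.card_univ, nsmul_eq_mul]
  have e : ∑ i, u i * Fintype.card ι * v i = Fintype.card ι * ∑ i, u i * v i := by
    rw [Finset.mul_sum]
    exact Finset.sum_congr rfl fun i _ => by ring
  simp only [← mul_assoc]
  rw [e]
  ring

lemma sum_four_double_diff {ι : Type*} [Fintype ι] (A B : ι → ι → ℝ)
    (hr : ∀ k, ∑ l, A k l = 0) (hc : ∀ l, ∑ k, A k l = 0) :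
    ∑ k, ∑ k', ∑ l, ∑ l', (A k l - A k l' - A k' l + A k' l')
        * (B k l - B k l' - B k' l + B k' l')
      = 4 * (Fintype.card ι : ℝ) ^ 2 * ∑ k, ∑ l, A k l * B k l := by
  have h1 : ∀ k k', ∑ l, ∑ l', (A k l - A k l' - A k' l + A k' l')
        * (B k l - B k l' - B k' l + B k' l')
      = 2 * Fintype.card ι * ∑ l, (A k l - A k' l) * (B k l - B k' l) := by
    intro k k'
    rw [← sum_sum_sub_mul_sub (fun l => A k l - A k' l) (fun l => B k l - B k' l)
      (by rw [Finset.sum_sub_distrib, hr, hr, sub_zero])]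
    refine Finset.sum_congr rfl fun l _ => Finset.sum_congr rfl fun l' _ => ?_
    ring
  simp only [h1, ← Finset.mul_sum]
  have h2 : ∑ k, ∑ k', ∑ l, (A k l - A k' l) * (B k l - B k' l)
      = ∑ l, ∑ k, ∑ k', (A k l - A k' l) * (B k l - B k' l) := by
    rw [Finset.sum_comm]
    rw [Finset.sum_congr rfl fun k' _ => Finset.sum_comm]
    rw [Finset.sum_comm]
    refine Finset.sum_congr rfl fun l _ => ?_
    rw [Finset.sum_comm]
  rw [h2, Finset.sum_congr rfl fun l _ =>
    sum_sum_sub_mul_sub (fun k => A k l) (fun k => B k l) (hc l), ← Finset.mul_sum,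
    Finset.sum_comm]
  ring

/-- Fin-indexed quintuples as nested pairs. -/
def finFiveEquiv (Z : Type*) : Z × ((Z × Z) × (Z × Z)) ≃ (Fin 5 → Z) where
  toFun q := ![q.1, q.2.1.1, q.2.1.2, q.2.2.1, q.2.2.2]
  invFun w := (w 0, ((w 1, w 2), (w 3, w 4)))
  left_inv q := rfl
  right_inv w := by
    ext i
    fin_cases i <;> rfl

end Algebra

section SampleIdentity

variable {n : ℕ} {E F : Type*} [NormedAddCommGroup E] [InnerProductSpace ℝ E]
  [NormedAddCommGroup F] [InnerProductSpace ℝ F]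

lemma angleArr_eq_vertexAngle {x : Fin n → E} (hx : Function.Injective x) (k l r : Fin n) :
    angleArr x k l r = vertexAngle (x k - x r) (x l - x r) := by
  unfold angleArr vertexAngle
  simp only [sub_eq_zero, hx.eq_iff]
  rfl

lemma sum_centredArr_right (x : Fin n → E) (k r : Fin n) : ∑ l, centredArr x k l r = 0 := by
  have hn : (n : ℝ) ≠ 0 := by
    have := k.pos
    positivity
  simp only [centredArr, Finset.sum_add_distrib, Finset.sum_sub_distrib, Finset.sum_const,
    Finset.card_univ, Fintype.card_fin, nsmul_eq_mul, ← Finset.mul_sum]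
  rw [Finset.sum_comm (f := fun l k' => angleArr x k' l r)]
  field_simp
  ring

lemma sum_centredArr_left (x : Fin n → E) (l r : Fin n) : ∑ k, centredArr x k l r = 0 := by
  have hn : (n : ℝ) ≠ 0 := by
    have := l.pos
    positivity
  simp only [centredArr, Finset.sum_add_distrib, Finset.sum_sub_distrib, Finset.sum_const,
    Finset.card_univ, Fintype.card_fin, nsmul_eq_mul, ← Finset.mul_sum]
  field_simp
  ring

lemma angleDiff_eq_centredArr {x : Fin n → E} (hx : Function.Injective x)
    (r k k' l l' : Fin n) : angleDiff (x r) (x k) (x k') (x l) (x l')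
      = centredArr x k l r - centredArr x k l' r - centredArr x k' l r + centredArr x k' l' r := by
  simp only [angleDiff, ← angleArr_eq_vertexAngle hx, centredArr]
  ring

theorem sampleCovSq_eq_vStat {x : Fin n → E} {y : Fin n → F} (hx : Function.Injective x)
    (hy : Function.Injective y) (hn : 0 < n) :
    sampleCovSq x y = vStat (m := 4) covKernel (fun i => (x i, y i)) := by
  have hn' : (n : ℝ) ≠ 0 := by positivity
  unfold vStat sampleCovSq
  rw [← (finFiveEquiv (Fin n)).sum_comp, Fintype.sum_prod_type]
  simp only [Fintype.sum_prod_type]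
  have key : ∀ r : Fin n, ∑ k, ∑ k', ∑ l, ∑ l', (covKernel ((fun i => (x i, y i)) ∘
      (finFiveEquiv (Fin n)) (r, (k, k'), (l, l'))) : ℝ)
      = (n : ℝ) ^ 2 * ∑ k, ∑ l, centredArr x k l r * centredArr y k l r := by
    intro r
    have h1 : ∀ k k' l l', (covKernel ((fun i => (x i, y i)) ∘
      (finFiveEquiv (Fin n)) (r, (k, k'), (l, l'))) : ℝ)
      = 4⁻¹ * ((centredArr x k l r - centredArr x k l' r - centredArr x k' l r
          + centredArr x k' l' r) * (centredArr y k l r - centredArr y k l' r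
          - centredArr y k' l r + centredArr y k' l' r)) := by
      intro k k' l l'
      rw [← angleDiff_eq_centredArr hx, ← angleDiff_eq_centredArr hy]
      rfl
    simp only [h1, ← Finset.mul_sum]
    rw [sum_four_double_diff (fun k l => centredArr x k l r) (fun k l => centredArr y k l r)
      (fun k => sum_centredArr_right x k r) (fun l => sum_centredArr_left x l r),
      Fintype.card_fin]
    ring
  simp only [key, ← Finset.mul_sum]
  have hswap : ∑ k, ∑ l, ∑ r, centredArr x k l r * centredArr y k l r
      = ∑ r, ∑ k, ∑ l, centredArr x k l r * centredArr y k l r := by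
    rw [Finset.sum_congr rfl fun k _ => Finset.sum_comm, Finset.sum_comm]
  rw [hswap, ← mul_assoc]
  congr 1
  field_simp

variable [MeasurableSpace E] [BorelSpace E] [MeasurableSpace F] [BorelSpace F]
  [SecondCountableTopology E] [SecondCountableTopology F]
  {α : Type*} [MeasurableSpace α]

lemma measurable_angleArr {x : α → Fin n → E} (hx : ∀ i, Measurable fun a => x a i)
    (k l r : Fin n) : Measurable fun a => angleArr (x a) k l r := by
  unfold angleArr
  split_ifs
  · exact measurable_const
  · have h1 := (hx k).sub (hx r)
    have h2 := (hx l).sub (hx r)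
    exact Real.continuous_arccos.measurable.comp ((h1.inner h2).div (h1.norm.mul h2.norm))

lemma measurable_centredArr {x : α → Fin n → E} (hx : ∀ i, Measurable fun a => x a i)
    (k l r : Fin n) : Measurable fun a => centredArr (x a) k l r := by
  have h := measurable_angleArr hx
  unfold centredArr
  exact (((h _ _ _).sub ((Finset.measurable_sum _ fun i _ => h _ _ _).const_mul _)).sub
    ((Finset.measurable_sum _ fun i _ => h _ _ _).const_mul _)).add
    ((Finset.measurable_sum _ fun i _ => Finset.measurable_sum _ fun j _ => h _ _ _).const_mul _)

lemma measurable_sampleCovSq {x : α → Fin n → E} {y : α → Fin n → F}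
    (hx : ∀ i, Measurable fun a => x a i) (hy : ∀ i, Measurable fun a => y a i) :
    Measurable fun a => sampleCovSq (x a) (y a) := by
  unfold sampleCovSq
  exact (Finset.measurable_sum _ fun k _ => Finset.measurable_sum _ fun l _ =>
    Finset.measurable_sum _ fun r _ =>
      (measurable_centredArr hx _ _ _).mul (measurable_centredArr hy _ _ _)).const_mul _

lemma measurable_sampleCorrSq {x : α → Fin n → E} {y : α → Fin n → F}
    (hx : ∀ i, Measurable fun a => x a i) (hy : ∀ i, Measurable fun a => y a i) :
    Measurable fun a => sampleCorrSq (x a) (y a) := by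
  unfold sampleCorrSq
  exact (measurable_sampleCovSq hx hy).div
    ((measurable_sampleCovSq hx hx).sqrt.mul (measurable_sampleCovSq hy hy).sqrt)

end SampleIdentity

section Ratio

/-- The Lipschitz constant of the correlation as a function of the covariance and variances. -/
def ratioConst (v : ℝ) : ℝ := 2 / v + 600 / v ^ 3

lemma ratioConst_pos {v : ℝ} (hv : 0 < v) : 0 < ratioConst v := by
  unfold ratioConst; positivity

lemma abs_ratio_sub_le {v ε S S' a a' b b' : ℝ} (hv : 0 < v) (hε1 : ε ≤ 1)
    (hεv : ε ≤ v / 2) (hS : |S| ≤ 10) (ha : v ≤ a) (hb : v ≤ b) (ha10 : a ≤ 10) (hb10 : b ≤ 10)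
    (hSS : |S' - S| ≤ ε) (haa : |a' - a| ≤ ε) (hbb : |b' - b| ≤ ε) :
    |S' / (√a' * √b') - S / (√a * √b)| ≤ ratioConst v * ε := by
  have hε0 : 0 ≤ ε := (abs_nonneg _).trans hSS
  have haa2 := abs_le.1 haa
  have hbb2 := abs_le.1 hbb
  have ha' : v / 2 ≤ a' := by linarith
  have hb' : v / 2 ≤ b' := by linarith
  have ha0 : 0 < a := by linarith
  have hb0 : 0 < b := by linarith
  have ha'0 : 0 < a' := by linarith
  have hb'0 : 0 < b' := by linarith
  rw [← Real.sqrt_mul ha'0.le, ← Real.sqrt_mul ha0.le]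
  set p := √(a' * b') with hp
  set q := √(a * b) with hq
  have hpv : v / 2 ≤ p := by
    rw [hp]; apply Real.le_sqrt_of_sq_le; nlinarith
  have hqv : v ≤ q := by
    rw [hq]; apply Real.le_sqrt_of_sq_le; nlinarith
  have hp0 : 0 < p := by linarith
  have hq0 : 0 < q := by linarith
  have hp2 : p ^ 2 = a' * b' := Real.sq_sqrt (by positivity)
  have hq2 : q ^ 2 = a * b := Real.sq_sqrt (by positivity)
  have hprod : |a * b - a' * b'| ≤ 30 * ε := by
    have : a * b - a' * b' = -((a' - a) * b) - a' * (b' - b) := by ring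
    rw [this]
    refine (abs_sub _ _).trans ?_
    rw [abs_neg, abs_mul, abs_mul, abs_of_pos hb0, abs_of_pos ha'0]
    have h1 : |a' - a| * b ≤ ε * 10 := by gcongr
    have h2 : a' * |b' - b| ≤ 11 * ε := by
      have : a' ≤ 11 := by linarith
      gcongr
    linarith
  have hqp : |q - p| ≤ 30 * ε / v := by
    rw [le_div_iff₀ hv]
    have h1 : |q - p| * (q + p) = |a * b - a' * b'| := by
      have : a * b - a' * b' = (q - p) * (q + p) := by rw [← hq2, ← hp2]; ring
      rw [this, abs_mul, abs_of_pos (by linarith : 0 < q + p)]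
    calc |q - p| * v ≤ |q - p| * (q + p) := by gcongr; linarith
      _ ≤ _ := h1.trans_le hprod
  have hdec : S' / p - S / q = (S' - S) / p + S * (q - p) / (p * q) := by
    field_simp; ring
  rw [hdec]
  refine (abs_add_le _ _).trans ?_
  rw [abs_div, abs_div, abs_mul, abs_mul, abs_of_pos hp0, abs_of_pos hq0]
  have h1 : |S' - S| / p ≤ ε / (v / 2) := by gcongr
  have h2 : |S| * |q - p| / (p * q) ≤ 10 * (30 * ε / v) / (v / 2 * v) := by gcongr
  refine (add_le_add h1 h2).trans (le_of_eq ?_)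
  unfold ratioConst
  field_simp
  ring

end Ratio

section Concentration

variable {Z E F : Type*} [MeasurableSpace Z]
  [NormedAddCommGroup E] [InnerProductSpace ℝ E] [FiniteDimensional ℝ E]
  [NormedAddCommGroup F] [InnerProductSpace ℝ F] [FiniteDimensional ℝ F]

/-- The tail bound of the squared sample projection covariance. -/
def covTail (n : ℕ) (ε : ℝ) : ℝ := 2 * Real.exp 1 * Real.exp (-(n * ε ^ 2 / 80000))

section

variable [MeasurableSpace E] [BorelSpace E] [MeasurableSpace F] [BorelSpace F]

lemma abs_angleCov_le (μ : Measure (E × F)) [IsProbabilityMeasure μ] : |angleCov μ| ≤ 10 := by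
  have := norm_integral_le_of_norm_le_const (μ := Measure.pi fun _ : Fin 5 => μ) (C := 10)
    (f := covKernel) (Filter.Eventually.of_forall fun w => abs_covKernel_le w)
  simpa [angleCov] using this

theorem measure_sampleCovSq_sub_ge_le (ν : Measure Z) [IsProbabilityMeasure ν] {f : Z → E}
    {g : Z → F} (hf : Measurable f) (hg : Measurable g)
    (haf : NullSingletonClass (ν.map f)) (hag : NullSingletonClass (ν.map g))
    {n : ℕ} (hn : 0 < n) {ε : ℝ} (hε : 0 < ε) (hε1 : ε ≤ 1) :
    (Measure.pi fun _ : Fin n => ν).real {D | ε ≤ |sampleCovSq (fun i => f (D i))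
      (fun i => g (D i)) - angleCov (ν.map fun z => (f z, g z))|} ≤ covTail n ε := by
  have hfg : Measurable fun z => (f z, g z) := hf.prodMk hg
  have : IsProbabilityMeasure (ν.map fun z => (f z, g z)) :=
    Measure.isProbabilityMeasure_map hfg.aemeasurable
  have hmap : (Measure.pi fun _ : Fin n => ν).map (fun D i => (f (D i), g (D i)))
      = Measure.pi fun _ : Fin n => ν.map fun z => (f z, g z) :=
    Measure.pi_map_pi (fun _ => hfg.aemeasurable)
  have hDm : Measurable fun (D : Fin n → Z) i => (f (D i), g (D i)) := by fun_prop
  have hset : MeasurableSet {w : Fin n → E × F | ε ≤ |vStat (m := 4) covKernel w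
      - angleCov (ν.map fun z => (f z, g z))|} :=
    measurableSet_le measurable_const
      (((measurable_vStat measurable_covKernel).sub_const _).abs)
  have key := measure_vStat_sub_ge_le (m := 4) (ν.map fun z => (f z, g z)) hn
    measurable_covKernel (B := 10) (by norm_num) abs_covKernel_le hε hε1
  rw [← hmap] at key
  change (Measure.map (fun (D : Fin n → Z) i => (f (D i), g (D i)))
    (Measure.pi fun _ : Fin n => ν)).real {w | ε ≤ |vStat (m := 4) covKernel w
      - angleCov (ν.map fun z => (f z, g z))|} ≤ _ at key
  rw [map_measureReal_apply hDm hset] at key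
  refine le_trans (le_of_eq (measureReal_congr ?_)) (key.trans ?_)
  · filter_upwards [ae_pi_ne (ι := Fin n) hf haf, ae_pi_ne (ι := Fin n) hg hag] with D h1 h2
    apply propext
    show ε ≤ |_ - _| ↔ ε ≤ |_ - _|
    rw [sampleCovSq_eq_vStat (x := fun i => f (D i)) (y := fun i => g (D i))
      (fun i j hij => by_contra fun h => h1 i j h hij)
      (fun i j hij => by_contra fun h => h2 i j h hij) hn]
  · unfold covTail
    have h1 : Real.exp ((2 * 10 : ℝ)⁻¹) ≤ Real.exp 1 := Real.exp_le_exp.2 (by norm_num)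
    have h2 : (8 * (2 * 10 * (((4 : ℕ) : ℝ) + 1)) ^ 2) = (80000 : ℝ) := by norm_num
    rw [h2]
    gcongr

end

variable [MeasureSpace E] [BorelSpace E] [MeasureSpace F] [BorelSpace F]
  [(volume : Measure E).IsAddHaarMeasure] [(volume : Measure F).IsAddHaarMeasure]

theorem measure_sampleCorrSq_sub_gt_le [Nontrivial E] [Nontrivial F] (ν : Measure Z)
    [IsProbabilityMeasure ν] {f : Z → E} {g : Z → F} (hf : Measurable f) (hg : Measurable g)
    (haf : NullSingletonClass (ν.map f)) (hag : NullSingletonClass (ν.map g))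
    {v : ℝ} (hv : 0 < v) (hvf : v ≤ angleVar (ν.map f)) (hvg : v ≤ angleVar (ν.map g))
    {n : ℕ} (hn : 0 < n) {ε : ℝ} (hε : 0 < ε) (hε1 : ε ≤ 1) (hεv : ε ≤ v / 2) :
    (Measure.pi fun _ : Fin n => ν).real {D | ratioConst v * ε < |sampleCorrSq
      (fun i => f (D i)) (fun i => g (D i)) - projCorrSq (ν.map fun z => (f z, g z))|}
      ≤ 3 * covTail n ε := by
  have hfg : Measurable fun z => (f z, g z) := hf.prodMk hg
  have : IsProbabilityMeasure (ν.map fun z => (f z, g z)) :=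
    Measure.isProbabilityMeasure_map hfg.aemeasurable
  have : IsProbabilityMeasure (ν.map fun z => (f z, f z)) :=
    Measure.isProbabilityMeasure_map (hf.prodMk hf).aemeasurable
  have : IsProbabilityMeasure (ν.map fun z => (g z, g z)) :=
    Measure.isProbabilityMeasure_map (hg.prodMk hg).aemeasurable
  have e1 : (ν.map fun z => (f z, g z)).fst = ν.map f := by
    rw [Measure.fst, Measure.map_map measurable_fst hfg]; rfl
  have e2 : (ν.map fun z => (f z, g z)).snd = ν.map g := by
    rw [Measure.snd, Measure.map_map measurable_snd hfg]; rfl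
  have e3 : angleVar (ν.map f) = angleCov (ν.map fun z => (f z, f z)) := by
    rw [angleVar, Measure.map_map (by fun_prop) hf]; rfl
  have e4 : angleVar (ν.map g) = angleCov (ν.map fun z => (g z, g z)) := by
    rw [angleVar, Measure.map_map (by fun_prop) hg]; rfl
  rw [projCorrSq_eq _ (by rwa [e1]) (by rwa [e2]), e1, e2, e3, e4]
  rw [e3] at hvf
  rw [e4] at hvg
  have c1 := measure_sampleCovSq_sub_ge_le ν hf hg haf hag hn hε hε1
  have c2 := measure_sampleCovSq_sub_ge_le ν hf hf haf haf hn hε hε1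
  have c3 := measure_sampleCovSq_sub_ge_le ν hg hg hag hag hn hε hε1
  have hsub : {D : Fin n → Z | ratioConst v * ε < |sampleCorrSq
      (fun i => f (D i)) (fun i => g (D i)) - angleCov (ν.map fun z => (f z, g z))
        / (√(angleCov (ν.map fun z => (f z, f z))) * √(angleCov (ν.map fun z => (g z, g z))))|}
      ⊆ ({D | ε ≤ |sampleCovSq (fun i => f (D i))
        (fun i => g (D i)) - angleCov (ν.map fun z => (f z, g z))|}
        ∪ {D | ε ≤ |sampleCovSq (fun i => f (D i))
        (fun i => f (D i)) - angleCov (ν.map fun z => (f z, f z))|})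
        ∪ {D | ε ≤ |sampleCovSq (fun i => g (D i))
        (fun i => g (D i)) - angleCov (ν.map fun z => (g z, g z))|} := by
    intro D hD
    by_contra hcon
    simp only [mem_union, mem_ofPred_eq, not_or, not_le] at hcon hD
    obtain ⟨⟨h1, h2⟩, h3⟩ := hcon
    exact absurd hD (not_lt.2 (abs_ratio_sub_le hv hε1 hεv (abs_angleCov_le _) hvf hvg
      ((le_abs_self _).trans (abs_angleCov_le _)) ((le_abs_self _).trans (abs_angleCov_le _))
      h1.le h2.le h3.le))
  calc _ ≤ _ := measureReal_mono hsub
    _ ≤ _ := measureReal_union_le _ _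
    _ ≤ _ := add_le_add_left (measureReal_union_le _ _) _
    _ ≤ 3 * covTail n ε := by linarith

end Concentration

/-! ### Swapping null features -/

lemma dependsOn_compl_of_forall {p : ℕ} {β : Type*} {F : (Fin p → ℝ) → β} (T : Finset (Fin p))
    (h : ∀ k ∈ T, DependsOn F ({k}ᶜ : Set (Fin p))) : DependsOn F ((T : Set (Fin p))ᶜ) := by
  classical
  induction T using Finset.induction_on with
  | empty =>
    intro x x' hx
    exact congrArg F (funext fun i => hx i (by simp))
  | insert k T hk ih =>
    intro x x' hx
    have h1 : F x = F (Function.update x k (x' k)) := by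
      apply h k (Finset.mem_insert_self k T)
      intro i hi
      rw [Function.update_of_ne (by simpa using hi)]
    rw [h1]
    apply ih (fun j hj => h j (Finset.mem_insert_of_mem hj))
    intro i hi
    by_cases hik : i = k
    · rw [hik, Function.update_self]
    · rw [Function.update_of_ne hik]
      apply hx
      simp only [Finset.coe_insert, mem_compl_iff, mem_insert_iff, not_or]
      exact ⟨hik, hi⟩

lemma dependsOn_activeSet {p : ℕ} {𝓨 : Type*} [MeasurableSpace 𝓨] (F : Kernel (Fin p → ℝ) 𝓨) :
    DependsOn (fun x => F x) (activeSet F : Set (Fin p)) := by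
  classical
  have := dependsOn_compl_of_forall (F := fun x => F x) (activeSet F)ᶜ (by
    intro k hk
    simpa [activeSet] using hk)
  simpa using this

lemma map_compProd_fst {α α' β : Type*} [MeasurableSpace α] [MeasurableSpace α']
    [MeasurableSpace β] {μ : Measure α} [SFinite μ] {κ : Kernel α β} [IsSFiniteKernel κ]
    {κ' : Kernel α' β} [IsSFiniteKernel κ'] {T : α → α'} (hT : Measurable T)
    (hκ : ∀ a, κ' (T a) = κ a) :
    (μ ⊗ₘ κ).map (fun z => (T z.1, z.2)) = (μ.map T) ⊗ₘ κ' := by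
  have hm : Measurable fun z : α × β => (T z.1, z.2) := by fun_prop
  ext s hs
  rw [Measure.map_apply hm hs, Measure.compProd_apply (hm hs), Measure.compProd_apply hs,
    lintegral_map (Kernel.measurable_kernel_prodMk_left hs) hT]
  refine lintegral_congr fun a => ?_
  rw [hκ]
  rfl

section Swap

variable {ι 𝓨 : Type*} [Fintype ι] [DecidableEq ι] [MeasurableSpace 𝓨]

/-- Exchange the `j`-th entries of `x` and `x̃` in a row `(x, x̃, y)`. -/
def swapRow (j : ι) (w : (ι → ℝ) × (ι → ℝ) × 𝓨) : (ι → ℝ) × (ι → ℝ) × 𝓨 :=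
  ((swapAt j (w.1, w.2.1)).1, (swapAt j (w.1, w.2.1)).2, w.2.2)

lemma measurable_swapAt (j : ι) : Measurable (swapAt j : (ι → ℝ) × (ι → ℝ) → _) := by
  unfold swapAt
  refine Measurable.prodMk ?_ ?_
  · rw [measurable_pi_iff]
    intro i
    by_cases h : i = j
    · subst h; simp only [Function.update_self]; fun_prop
    · simp only [Function.update_of_ne h]; fun_prop
  · rw [measurable_pi_iff]
    intro i
    by_cases h : i = j
    · subst h; simp only [Function.update_self]; fun_prop
    · simp only [Function.update_of_ne h]; fun_prop

lemma measurable_swapRow (j : ι) :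
    Measurable (swapRow j : (ι → ℝ) × (ι → ℝ) × 𝓨 → _) := by
  have h : Measurable fun w : (ι → ℝ) × (ι → ℝ) × 𝓨 => swapAt j (w.1, w.2.1) :=
    (measurable_swapAt j).comp (by fun_prop)
  exact h.fst.prodMk (h.snd.prodMk (by fun_prop))

lemma swapRow_fst_self (j : ι) (w : (ι → ℝ) × (ι → ℝ) × 𝓨) : (swapRow j w).1 j = w.2.1 j := by
  simp [swapRow, swapAt]

lemma swapRow_snd_self (j : ι) (w : (ι → ℝ) × (ι → ℝ) × 𝓨) : (swapRow j w).2.1 j = w.1 j := by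
  simp [swapRow, swapAt]

lemma swapRow_fst_of_ne {i j : ι} (h : i ≠ j) (w : (ι → ℝ) × (ι → ℝ) × 𝓨) :
    (swapRow j w).1 i = w.1 i := by
  simp [swapRow, swapAt, h]

lemma swapRow_snd_of_ne {i j : ι} (h : i ≠ j) (w : (ι → ℝ) × (ι → ℝ) × 𝓨) :
    (swapRow j w).2.1 i = w.2.1 i := by
  simp [swapRow, swapAt, h]

variable [StandardBorelSpace 𝓨]

theorem map_swapRow_eq [Nonempty 𝓨] (ν : ProbabilityMeasure ((ι → ℝ) × (ι → ℝ) × 𝓨))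
    (hν : IsKnockoff ν) (G : Kernel (ι → ℝ) 𝓨) [IsMarkovKernel G]
    (hG : ν.toMeasure.map (fun w => (w.1, w.2.2)) = (ν.toMeasure.map fun w => w.1) ⊗ₘ G)
    (j : ι) (hj : DependsOn (fun x => G x) ({j}ᶜ : Set ι)) :
    ν.toMeasure.map (swapRow j) = ν.toMeasure := by
  set m := ν.toMeasure with hm
  have mx : Measurable fun w : (ι → ℝ) × (ι → ℝ) × 𝓨 => w.1 := by fun_prop
  have mt : Measurable fun w : (ι → ℝ) × (ι → ℝ) × 𝓨 => w.2.1 := by fun_prop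
  have my : Measurable fun w : (ι → ℝ) × (ι → ℝ) × 𝓨 => w.2.2 := by fun_prop
  have mxt : Measurable fun w : (ι → ℝ) × (ι → ℝ) × 𝓨 => (w.1, w.2.1) := by fun_prop
  have h1 : condDistrib (fun w : (ι → ℝ) × (ι → ℝ) × 𝓨 => w.2.2) (fun w => w.1) m
      =ᵐ[m.map fun w => w.1] G :=
    (condDistrib_ae_eq_iff_measure_eq_compProd _ my.aemeasurable _).2 hG
  have h2 := (condIndepFun_iff_condDistrib_prod_ae_eq_prodMkRight (μ := m) my mt mx).1
    hν.condIndep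
  have h3 : condDistrib (fun w : (ι → ℝ) × (ι → ℝ) × 𝓨 => w.2.2) (fun w => (w.1, w.2.1)) m
      =ᵐ[m.map fun w => (w.1, w.2.1)] G.prodMkRight (ι → ℝ) := by
    have h4 : ∀ᵐ a ∂(m.map fun w => (w.1, w.2.1)),
        condDistrib (fun w : (ι → ℝ) × (ι → ℝ) × 𝓨 => w.2.2) (fun w => w.1) m a.1 = G a.1 := by
      have e : m.map (fun w => w.1) = (m.map fun w => (w.1, w.2.1)).map Prod.fst := by
        rw [Measure.map_map measurable_fst mxt]; rfl
      rw [e] at h1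
      exact ae_of_ae_map measurable_fst.aemeasurable h1
    filter_upwards [h2, h4] with a ha hb
    rw [ha, Kernel.prodMkRight_apply, Kernel.prodMkRight_apply, hb]
  have h5 : m.map (fun w => ((w.1, w.2.1), w.2.2))
      = (m.map fun w => (w.1, w.2.1)) ⊗ₘ (G.prodMkRight (ι → ℝ)) :=
    (condDistrib_ae_eq_iff_measure_eq_compProd _ my.aemeasurable _).1 h3
  have h6 : (m.map fun w => (w.1, w.2.1)).map (swapAt j) = m.map fun w => (w.1, w.2.1) := by
    rw [Measure.map_map (measurable_swapAt j) mxt]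
    exact hν.exchangeable j
  have h7 := map_compProd_fst (μ := m.map fun w => (w.1, w.2.1)) (κ := G.prodMkRight (ι → ℝ))
      (κ' := G.prodMkRight (ι → ℝ)) (measurable_swapAt j) (by
    intro a
    rw [Kernel.prodMkRight_apply, Kernel.prodMkRight_apply]
    apply hj
    intro i hi
    simp only [swapAt]
    rw [Function.update_of_ne (by simpa using hi)])
  rw [h6, ← h5, Measure.map_map (by
    exact ((measurable_swapAt j).comp measurable_fst).prodMk measurable_snd) (by fun_prop)] at h7
  have h8 := congrArg (fun μ => Measure.map (fun z : ((ι → ℝ) × (ι → ℝ)) × 𝓨 =>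
    (z.1.1, z.1.2, z.2)) μ) h7
  rw [Measure.map_map (by fun_prop) (by
      refine Measurable.comp ?_ (by fun_prop)
      exact ((measurable_swapAt j).comp measurable_fst).prodMk measurable_snd),
    Measure.map_map (by fun_prop) (by fun_prop)] at h8
  have h9 : ((fun z : ((ι → ℝ) × (ι → ℝ)) × 𝓨 => (z.1.1, z.1.2, z.2)) ∘
      fun w : (ι → ℝ) × (ι → ℝ) × 𝓨 => ((w.1, w.2.1), w.2.2)) = id := rfl
  rw [h9, Measure.map_id] at h8
  exact h8

/-- The law of a knockoff feature is that of the feature. -/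
lemma IsKnockoff.map_knockoff_eq {ν : ProbabilityMeasure ((ι → ℝ) × (ι → ℝ) × 𝓨)}
    (hν : IsKnockoff ν) (j : ι) :
    ν.toMeasure.map (fun w => w.2.1 j) = ν.toMeasure.map fun w => w.1 j := by
  have h := congrArg (fun μ => Measure.map (fun z : (ι → ℝ) × (ι → ℝ) => z.1 j) μ)
    (hν.exchangeable j)
  have hs : Measurable fun w : (ι → ℝ) × (ι → ℝ) × 𝓨 => swapAt j (w.1, w.2.1) :=
    (measurable_swapAt j).comp (by fun_prop)
  rw [Measure.map_map (by fun_prop) hs, Measure.map_map (by fun_prop) (by fun_prop)] at h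
  have e : ((fun z : (ι → ℝ) × (ι → ℝ) => z.1 j) ∘
      fun w : (ι → ℝ) × (ι → ℝ) × 𝓨 => swapAt j (w.1, w.2.1)) = fun w => w.2.1 j := by
    ext w; simp [swapAt]
  rw [e] at h
  exact h

end Swap

lemma popW_eq_zero {ι 𝓨 : Type*} [Fintype ι] [DecidableEq ι] [NormedAddCommGroup 𝓨]
    [InnerProductSpace ℝ 𝓨] [MeasureSpace 𝓨] [BorelSpace 𝓨]
    {ν : ProbabilityMeasure ((ι → ℝ) × (ι → ℝ) × 𝓨)} {j : ι}
    (h : ν.toMeasure.map (swapRow j) = ν.toMeasure) : popW ν j = 0 := by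
  have e : ν.toMeasure.map (fun w => (w.1 j, w.2.2))
      = ν.toMeasure.map fun w => (w.2.1 j, w.2.2) := by
    conv_lhs => rw [← h]
    rw [Measure.map_map (by fun_prop) (measurable_swapRow j)]
    congr 1
    ext w
    · exact swapRow_fst_self j w
    · rfl
  rw [popW, e, sub_self]

/-! ### Sign flips and the asymmetric random walk -/

section Walk

variable {ι : Type*} [DecidableEq ι]

/-- Flip the signs of the entries indexed by `A`. -/
def flipSigns (A : Finset ι) (W : ι → ℝ) (j : ι) : ℝ := if j ∈ A then - W j else W j

/-- At some level `t > 0`, the number of entries `≥ t` exceeds `s` times the number of entries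
`≤ -t` by at least `h`. -/
def Hits (s h : ℕ) (N : Finset ι) (W : ι → ℝ) : Prop :=
  ∃ t : ℝ, 0 < t ∧ h + s * (N.filter fun j => W j ≤ -t).card ≤ (N.filter fun j => t ≤ W j).card

lemma Hits.congr {s h : ℕ} {N : Finset ι} {W W' : ι → ℝ} (hW : ∀ j ∈ N, W j = W' j)
    (hh : Hits s h N W) : Hits s h N W' := by
  obtain ⟨t, ht, hle⟩ := hh
  refine ⟨t, ht, ?_⟩
  have e1 : N.filter (fun j => W' j ≤ -t) = N.filter fun j => W j ≤ -t :=
    Finset.filter_congr fun j hj => by rw [hW j hj]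
  have e2 : N.filter (fun j => t ≤ W' j) = N.filter fun j => t ≤ W j :=
    Finset.filter_congr fun j hj => by rw [hW j hj]
  rwa [e1, e2]

lemma hits_pred_of_hits_insert {s h : ℕ} {N : Finset ι} {W : ι → ℝ} {j : ι}
    (hh : Hits s (h + 1) (insert j N) W) : Hits s h N W := by
  obtain ⟨t, ht, hle⟩ := hh
  refine ⟨t, ht, ?_⟩
  have h1 : (N.filter fun j => W j ≤ -t).card ≤ ((insert j N).filter fun j => W j ≤ -t).card :=
    Finset.card_le_card (Finset.filter_subset_filter _ (Finset.subset_insert j N))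
  have h2 : ((insert j N).filter fun j => t ≤ W j).card ≤ (N.filter fun j => t ≤ W j).card + 1 := by
    rw [Finset.filter_insert]
    split_ifs
    · exact Finset.card_insert_le _ _
    · exact Nat.le_succ _
  have h3 := Nat.mul_le_mul_left s h1
  omega

lemma hits_add_of_hits_insert {s h : ℕ} {N : Finset ι} {W : ι → ℝ} {j : ι} (hj : j ∉ N)
    (hneg : W j ≤ 0) (hmax : ∀ i ∈ N, |W i| ≤ |W j|)
    (hh : Hits s (h + 1) (insert j N) W) : Hits s (h + 1 + s) N W := by
  obtain ⟨t, ht, hle⟩ := hh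
  refine ⟨t, ht, ?_⟩
  have hpos : (insert j N).filter (fun j => t ≤ W j) = N.filter fun j => t ≤ W j := by
    rw [Finset.filter_insert, if_neg (by linarith)]
  rw [hpos] at hle
  by_cases htj : W j ≤ -t
  · rw [Finset.filter_insert, if_pos htj, Finset.card_insert_of_notMem (by simp [hj])] at hle
    rw [mul_add, mul_one] at hle
    omega
  · exfalso
    have : N.filter (fun j => t ≤ W j) = ∅ := by
      rw [Finset.filter_eq_empty_iff]
      intro i hi hti
      have h1 := hmax i hi
      rw [abs_of_nonpos hneg] at h1
      have h2 := le_abs_self (W i)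
      linarith
    rw [this] at hle
    simp at hle

open Classical in
theorem sum_powerset_hits_le {s : ℕ} (hs : 2 ≤ s) (h : ℕ) (N : Finset ι) (W : ι → ℝ) :
    ∑ A ∈ N.powerset, (if Hits s h N (flipSigns A W) then (1 : ℝ) else 0)
      ≤ (2 / 3) ^ h * 2 ^ N.card := by
  induction hn : N.card generalizing N h with
  | zero =>
    rw [Finset.card_eq_zero] at hn
    subst hn
    rcases h with _ | h
    · rw [Finset.powerset_empty, Finset.sum_singleton]
      split_ifs <;> simp
    · have : ¬ Hits s (h + 1) ∅ (flipSigns ∅ W) := by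
        rintro ⟨t, _, hle⟩
        simp at hle
      rw [Finset.powerset_empty, Finset.sum_singleton, if_neg this]
      positivity
  | succ n ih =>
    rcases h with _ | h
    · calc _ ≤ ∑ A ∈ N.powerset, (1 : ℝ) := by
            apply Finset.sum_le_sum; intro A _; split_ifs <;> simp
        _ = _ := by simp [hn]
    have hne : N.Nonempty := Finset.card_pos.1 (by omega)
    obtain ⟨j, hjN, hmax⟩ := Finset.exists_max_image N (fun i => |W i|) hne
    obtain ⟨N', hjN', rfl⟩ : ∃ N', j ∉ N' ∧ insert j N' = N :=
      ⟨N.erase j, Finset.notMem_erase j N, Finset.insert_erase hjN⟩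
    have hn' : N'.card = n := by
      rw [Finset.card_insert_of_notMem hjN'] at hn; omega
    rw [Finset.sum_powerset_insert hjN']
    have habs : ∀ (A : Finset ι) (i : ι), |flipSigns A W i| = |W i| := by
      intro A i; unfold flipSigns; split_ifs <;> simp
    have hcongr : ∀ A ∈ N'.powerset, ∀ i ∈ N', flipSigns (insert j A) W i = flipSigns A W i := by
      intro A _ i hi
      have : i ≠ j := fun h => hjN' (h ▸ hi)
      simp [flipSigns, this]
    have hmax' : ∀ (A : Finset ι), ∀ i ∈ N', |flipSigns A W i| ≤ |flipSigns A W j| := by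
      intro A i hi
      rw [habs, habs]
      exact hmax i (Finset.mem_insert_of_mem hi)
    have hoff : ∀ A ∈ N'.powerset, flipSigns A W j = W j := by
      intro A hA
      have : j ∉ A := fun h => hjN' (Finset.mem_powerset.1 hA h)
      simp [flipSigns, this]
    have hon : ∀ A : Finset ι, flipSigns (insert j A) W j = - W j := by
      intro A; simp [flipSigns]
    have i1 := ih h N' hn'
    have i2 := ih (h + 1 + s) N' hn'
    have hmono : ∀ {P Q : Prop} [Decidable P] [Decidable Q], (P → Q) →
        (if P then (1 : ℝ) else 0) ≤ if Q then 1 else 0 := by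
      intro P Q _ _ hPQ
      split_ifs <;> first | exact absurd (hPQ ‹_›) ‹_› | norm_num
    have hbound : (∑ A ∈ N'.powerset, if Hits s (h + 1) (insert j N') (flipSigns A W)
          then (1 : ℝ) else 0)
        + ∑ A ∈ N'.powerset, (if Hits s (h + 1) (insert j N') (flipSigns (insert j A) W)
          then (1 : ℝ) else 0)
        ≤ (2 / 3) ^ h * 2 ^ n + (2 / 3) ^ (h + 1 + s) * 2 ^ n := by
      rcases le_total 0 (W j) with hw | hw
      · refine add_le_add (le_trans (Finset.sum_le_sum fun A hA => hmono fun hh => ?_) i1)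
          (le_trans (Finset.sum_le_sum fun A hA => hmono fun hh => ?_) i2)
        · exact hits_pred_of_hits_insert hh
        · exact (hits_add_of_hits_insert hjN' (by rw [hon]; linarith) (hmax' _) hh).congr
            (hcongr A hA)
      · rw [add_comm]
        refine add_le_add (le_trans (Finset.sum_le_sum fun A hA => hmono fun hh => ?_) i1)
          (le_trans (Finset.sum_le_sum fun A hA => hmono fun hh => ?_) i2)
        · exact (hits_pred_of_hits_insert hh).congr (hcongr A hA)
        · exact hits_add_of_hits_insert hjN' (by rw [hoff A hA]; exact hw) (hmax' _) hh
    refine hbound.trans ?_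
    have hs2 : ((2 : ℝ) / 3) ^ s ≤ (2 / 3) ^ 2 :=
      pow_le_pow_of_le_one (by norm_num) (by norm_num) hs
    have hpow : 0 < ((2 : ℝ) / 3) ^ h * 2 ^ n := by positivity
    rw [pow_add, pow_succ, pow_succ (2 : ℝ) n]
    nlinarith [mul_le_mul_of_nonneg_left hs2 hpow.le]

lemma hits_one_iff {s : ℕ} {N : Finset ι} {W : ι → ℝ} :
    Hits s 1 N W ↔ ∃ i ∈ N, 0 < W i ∧ 1 + s * (N.filter fun j => W j ≤ -W i).card
      ≤ (N.filter fun j => W i ≤ W j).card := by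
  constructor
  · rintro ⟨t, ht, hle⟩
    have hne : (N.filter fun j => t ≤ W j).Nonempty := Finset.card_pos.1 (by omega)
    obtain ⟨i, hi, hmin⟩ := Finset.exists_min_image _ W hne
    rw [Finset.mem_filter] at hi
    refine ⟨i, hi.1, by linarith [hi.2], ?_⟩
    have h1 : (N.filter fun j => W j ≤ -W i) ⊆ N.filter fun j => W j ≤ -t := by
      intro j hj
      rw [Finset.mem_filter] at hj ⊢
      exact ⟨hj.1, by linarith [hj.2, hi.2]⟩
    have h2 : (N.filter fun j => t ≤ W j) ⊆ N.filter fun j => W i ≤ W j := by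
      intro j hj
      have := hmin j hj
      rw [Finset.mem_filter] at hj ⊢
      exact ⟨hj.1, this⟩
    have h3 := Nat.mul_le_mul_left s (Finset.card_le_card h1)
    have h4 := Finset.card_le_card h2
    omega
  · rintro ⟨i, _, hi, hle⟩
    exact ⟨W i, hi, hle⟩

lemma measurableSet_hits_one {α : Type*} [MeasurableSpace α] {W : α → ι → ℝ}
    (hW : ∀ i, Measurable fun a => W a i) (s : ℕ) (N : Finset ι) :
    MeasurableSet {a | Hits s 1 N (W a)} := by
  have : {a | Hits s 1 N (W a)} = ⋃ i ∈ N, ({a | 0 < W a i} ∩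
      {a | 1 + s * (N.filter fun j => W a j ≤ -W a i).card
        ≤ (N.filter fun j => W a i ≤ W a j).card}) := by
    ext a
    simp only [mem_ofPred_eq, hits_one_iff, mem_iUnion, mem_inter_iff, exists_prop]
  rw [this]
  refine Finset.measurableSet_biUnion _ fun i _ => (measurableSet_lt measurable_const (hW i)).inter
    (measurableSet_le ?_ ?_)
  · simp only [Finset.card_filter]
    exact ((Finset.measurable_sum _ fun j _ => Measurable.ite (measurableSet_le (hW j) (hW i).neg)
      measurable_const measurable_const).const_mul s).const_add 1
  · simp only [Finset.card_filter]
    exact Finset.measurable_sum _ fun j _ => Measurable.ite (measurableSet_le (hW i) (hW j))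
      measurable_const measurable_const

/-- If flipping the sign of any single entry of `W` in `N` is realised by a measure preserving
map, then `Hits` has probability at most `2 / 3`. -/
theorem measure_hits_le {α : Type*} [MeasurableSpace α] {Q : Measure α} [IsProbabilityMeasure Q]
    {W : α → ι → ℝ} (hW : ∀ i, Measurable fun a => W a i) {s : ℕ} (hs : 2 ≤ s) (N : Finset ι)
    (hflip : ∀ j ∈ N, ∃ g : α → α, MeasurePreserving g Q Q ∧
      ∀ a, W (g a) = flipSigns {j} (W a)) :
    Q.real {a | Hits s 1 N (W a)} ≤ 2 / 3 := by
  classical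
  have hflips : ∀ A : Finset ι, A ⊆ N → ∃ g : α → α, MeasurePreserving g Q Q ∧
      ∀ a, W (g a) = flipSigns A (W a) := by
    intro A
    induction A using Finset.induction_on with
    | empty => exact fun _ => ⟨id, MeasurePreserving.id Q, fun a => by ext i; simp [flipSigns]⟩
    | insert j A hj ih =>
      intro hA
      obtain ⟨g, hg, hgW⟩ := ih ((Finset.subset_insert j A).trans hA)
      obtain ⟨g', hg', hgW'⟩ := hflip j (hA (Finset.mem_insert_self j A))
      refine ⟨g ∘ g', hg.comp hg', fun a => ?_⟩
      ext i
      simp only [Function.comp, hgW, hgW', flipSigns, Finset.mem_insert, Finset.mem_singleton]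
      by_cases hij : i = j
      · subst hij; simp [hj]
      · simp [hij]
  have hm := measurableSet_hits_one hW s N
  have heq : ∀ A ∈ N.powerset, Q.real {a | Hits s 1 N (W a)}
      = ∫ a, (if Hits s 1 N (flipSigns A (W a)) then (1 : ℝ) else 0) ∂Q := by
    intro A hA
    obtain ⟨g, hg, hgW⟩ := hflips A (Finset.mem_powerset.1 hA)
    rw [← hg.measureReal_preimage hm.nullMeasurableSet, ← integral_indicator_one (hg.measurable hm)]
    congr 1
    ext a
    simp only [indicator_apply, mem_preimage, mem_ofPred_eq, hgW, Pi.one_apply]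
  have hmA : ∀ A ∈ N.powerset, MeasurableSet {a | Hits s 1 N (flipSigns A (W a))} := by
    intro A hA
    apply measurableSet_hits_one (W := fun a => flipSigns A (W a))
    intro i
    simp only [flipSigns]
    split_ifs
    exacts [(hW i).neg, hW i]
  have hi : ∀ A ∈ N.powerset, Integrable
      (fun a => if Hits s 1 N (flipSigns A (W a)) then (1 : ℝ) else 0) Q := fun A hA =>
    integrable_of_abs_le (Measurable.ite (hmA A hA) measurable_const measurable_const) 1
      fun a => by split_ifs <;> simp
  have hsum : (2 : ℝ) ^ N.card * Q.real {a | Hits s 1 N (W a)}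
      = ∫ a, ∑ A ∈ N.powerset, (if Hits s 1 N (flipSigns A (W a)) then (1 : ℝ) else 0) ∂Q := by
    rw [integral_finsetSum _ hi, ← Finset.sum_congr rfl heq, Finset.sum_const,
      Finset.card_powerset, nsmul_eq_mul]
    push_cast; rfl
  have hle : (2 : ℝ) ^ N.card * Q.real {a | Hits s 1 N (W a)}
      ≤ ∫ _, (2 / 3) ^ 1 * (2 : ℝ) ^ N.card ∂Q := by
    rw [hsum]
    exact integral_mono (integrable_finsetSum _ hi) (integrable_const _)
      fun a => sum_powerset_hits_le hs 1 N (W a)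
  simp only [integral_const, probReal_univ, smul_eq_mul, one_mul, pow_one] at hle
  rw [mul_comm (2 / 3 : ℝ)] at hle
  exact le_of_mul_le_mul_left hle (by positivity)

end Walk

/-! ### The selection step -/

section Selection

variable {p : ℕ} {S A : Finset (Fin p)} {W : Fin p → ℝ} {α τ : ℝ}

lemma subset_selected_of_le (hAS : A ⊆ S) (hτ : 0 ≤ τ) (hA : ∀ k ∈ A, τ < W k)
    (hN : ∀ j ∈ S, j ∉ A → |W j| < τ) (hα : 1 / (A.card : ℝ) ≤ α) : A ⊆ selected S W α := by
  rcases A.eq_empty_or_nonempty with rfl | hne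
  · simp
  obtain ⟨i, hiA, hmin⟩ := Finset.exists_min_image A W hne
  have hi0 : 0 < W i := hτ.trans_lt (hA i hiA)
  have hadm : W i ∈ admissible S W α := by
    have hneg : S.filter (fun j => W j ≤ -W i) = ∅ := by
      rw [Finset.filter_eq_empty_iff]
      intro j hj hle
      by_cases hjA : j ∈ A
      · have := hA j hjA; linarith
      · have h1 := (abs_lt.1 (hN j hj hjA)).1
        have := hA i hiA
        linarith
    have hsub : A ⊆ S.filter fun j => W i ≤ W j := fun k hk =>
      Finset.mem_filter.2 ⟨hAS hk, hmin k hk⟩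
    have hcard := Finset.card_le_card hsub
    have hA0 : 0 < A.card := Finset.card_pos.2 hne
    refine Finset.mem_filter.2 ⟨Finset.mem_erase.2 ⟨hi0.ne', Finset.mem_image.2
      ⟨i, hAS hiA, abs_of_pos hi0⟩⟩, by omega, ?_⟩
    rw [hneg, Finset.card_empty, Nat.cast_zero, add_zero]
    refine le_trans ?_ hα
    have : (0 : ℝ) < A.card := by exact_mod_cast hA0
    gcongr
  intro k hk
  refine Finset.mem_filter.2 ⟨hAS hk, ?_⟩
  exact (Finset.min_le hadm).trans (WithTop.coe_le_coe.2 (hmin k hk))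

lemma subset_selected_or_empty (hAS : A ⊆ S) (hA : ∀ k ∈ A, τ < W k)
    (hN : ∀ j ∈ S, j ∉ A → |W j| < τ) (hα : α < 1 / (A.card : ℝ)) :
    A ⊆ selected S W α ∨ selected S W α = ∅ := by
  by_cases htop : threshold S W α = ⊤
  · right
    unfold selected
    rw [htop, Finset.filter_eq_empty_iff]
    intro j _ h
    simp at h
  · left
    obtain ⟨t, ht⟩ := WithTop.ne_top_iff_exists.1 htop
    have htadm : t ∈ admissible S W α := Finset.mem_of_min ht.symm
    intro k hk
    refine Finset.mem_filter.2 ⟨hAS hk, ?_⟩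
    rw [← ht, WithTop.coe_le_coe]
    by_contra hcon
    rw [not_le] at hcon
    obtain ⟨_, hpos, hle⟩ := Finset.mem_filter.1 htadm
    have hsub : S.filter (fun j => t ≤ W j) ⊆ A := by
      intro j hj
      obtain ⟨hjS, hjt⟩ := Finset.mem_filter.1 hj
      by_contra hjA
      have h1 := (abs_lt.1 (hN j hjS hjA)).2
      have := hA k hk
      linarith
    have hcard : ((S.filter fun j => t ≤ W j).card : ℝ) ≤ A.card := by
      exact_mod_cast Finset.card_le_card hsub
    have hpos' : (0 : ℝ) < (S.filter fun j => t ≤ W j).card := by exact_mod_cast hpos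
    have h1 : 1 / (A.card : ℝ) ≤ 1 / ((S.filter fun j => t ≤ W j).card : ℝ) := by gcongr
    have h2 : 1 / ((S.filter fun j => t ≤ W j).card : ℝ)
        ≤ (1 + ((S.filter fun j => W j ≤ -t).card : ℝ)) / ((S.filter fun j => t ≤ W j).card : ℝ) := by
      gcongr
      linarith [Nat.cast_nonneg (α := ℝ) (S.filter fun j => W j ≤ -t).card]
    linarith

lemma hits_of_subset_selected (hne : A.Nonempty) (hα : α < 1 / (A.card : ℝ))
    (hsel : A ⊆ selected S W α) : Hits A.card 1 (S \ A) W := by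
  obtain ⟨k, hk⟩ := hne
  have hA0 : (0 : ℝ) < A.card := by exact_mod_cast Finset.card_pos.2 ⟨k, hk⟩
  have hkT := (Finset.mem_filter.1 (hsel hk)).2
  have htop : threshold S W α ≠ ⊤ := by
    intro h; rw [h] at hkT; simp at hkT
  obtain ⟨t, ht⟩ := WithTop.ne_top_iff_exists.1 htop
  have htadm : t ∈ admissible S W α := Finset.mem_of_min ht.symm
  obtain ⟨htm, hpos, hle⟩ := Finset.mem_filter.1 htadm
  obtain ⟨ht0, htim⟩ := Finset.mem_erase.1 htm
  obtain ⟨i, _, rfl⟩ := Finset.mem_image.1 htim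
  refine ⟨|W i|, lt_of_le_of_ne (abs_nonneg _) (Ne.symm ht0), ?_⟩
  have hpos' : (0 : ℝ) < (S.filter fun j => |W i| ≤ W j).card := by exact_mod_cast hpos
  have h1 := hle.trans_lt hα
  rw [div_lt_div_iff₀ hpos' hA0, one_mul] at h1
  have h2 : (1 + (S.filter fun j => W j ≤ -|W i|).card) * A.card
      < (S.filter fun j => |W i| ≤ W j).card := by exact_mod_cast h1
  have h3 : (S.filter fun j => |W i| ≤ W j) ⊆ A ∪ ((S \ A).filter fun j => |W i| ≤ W j) := by
    intro j hj
    rw [Finset.mem_filter] at hj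
    by_cases hjA : j ∈ A
    · exact Finset.mem_union_left _ hjA
    · exact Finset.mem_union_right _ (Finset.mem_filter.2 ⟨Finset.mem_sdiff.2 ⟨hj.1, hjA⟩, hj.2⟩)
  have h4 := (Finset.card_le_card h3).trans (Finset.card_union_le _ _)
  have h5 : ((S \ A).filter fun j => W j ≤ -|W i|).card ≤ (S.filter fun j => W j ≤ -|W i|).card :=
    Finset.card_le_card (Finset.filter_subset_filter _ Finset.sdiff_subset)
  have h6 := Nat.mul_le_mul_left A.card h5
  rw [add_mul, one_mul, mul_comm _ A.card] at h2
  omega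

end Selection

/-! ### Conditioning on the value of a discrete variable -/

section Mixture

variable {Ω β : Type*} [MeasurableSpace Ω] {P : Measure Ω} [IsProbabilityMeasure P]
  {f : Ω → β} {T : Finset β} {E : Set Ω} {a : ℝ}

lemma measureReal_cond_apply {s : Set Ω} (hs : MeasurableSet s) (t : Set Ω) :
    (P[|s]).real t = (P.real s)⁻¹ * P.real (s ∩ t) := by
  simp only [measureReal_def, cond_apply hs, ENNReal.toReal_mul, ENNReal.toReal_inv]

lemma measureReal_mem_inter_eq_sum (hf : ∀ b, MeasurableSet {ω | f ω = b}) :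
    P.real ({ω | f ω ∈ T} ∩ E) = ∑ b ∈ T, P.real ({ω | f ω = b} ∩ E) := by
  have hT : {ω | f ω ∈ T} = ⋃ b ∈ T, {ω | f ω = b} := by ext ω; simp
  have hm : MeasurableSet {ω | f ω ∈ T} := by
    rw [hT]; exact Finset.measurableSet_biUnion _ fun b _ => hf b
  rw [← measureReal_restrict_apply hm, hT, measureReal_biUnion_finset _ fun b _ => hf b]
  · exact Finset.sum_congr rfl fun b _ => measureReal_restrict_apply (hf b)
  · intro b _ c _ hbc
    rw [Function.onFun, Set.disjoint_left]
    rintro ω rfl h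
    exact hbc h

lemma le_cond_mem_of_forall (hf : ∀ b, MeasurableSet {ω | f ω = b}) (hT : P {ω | f ω ∈ T} ≠ 0)
    (h : ∀ b ∈ T, P {ω | f ω = b} ≠ 0 → a ≤ (P[|{ω | f ω = b}]).real E) :
    a ≤ (P[|{ω | f ω ∈ T}]).real E := by
  have hm : MeasurableSet {ω | f ω ∈ T} := by
    have hT : {ω | f ω ∈ T} = ⋃ b ∈ T, {ω | f ω = b} := by ext ω; simp
    rw [hT]; exact Finset.measurableSet_biUnion _ fun b _ => hf b
  have hpos : 0 < P.real {ω | f ω ∈ T} := by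
    rw [measureReal_def]; exact ENNReal.toReal_pos hT (measure_ne_top _ _)
  rw [measureReal_cond_apply hm, le_inv_mul_iff₀ hpos, measureReal_mem_inter_eq_sum hf]
  have h1 := measureReal_mem_inter_eq_sum (P := P) (T := T) (E := univ) hf
  simp only [inter_univ] at h1
  rw [h1, Finset.sum_mul]
  refine Finset.sum_le_sum fun b hb => ?_
  by_cases h0 : P {ω | f ω = b} = 0
  · simp [measureReal_def, h0]
  · have hb0 : 0 < P.real {ω | f ω = b} := by
      rw [measureReal_def]; exact ENNReal.toReal_pos h0 (measure_ne_top _ _)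
    have := h b hb h0
    rwa [measureReal_cond_apply (hf b), le_inv_mul_iff₀ hb0] at this

lemma cond_mem_le_of_forall (hf : ∀ b, MeasurableSet {ω | f ω = b}) (hT : P {ω | f ω ∈ T} ≠ 0)
    (h : ∀ b ∈ T, P {ω | f ω = b} ≠ 0 → (P[|{ω | f ω = b}]).real E ≤ a) :
    (P[|{ω | f ω ∈ T}]).real E ≤ a := by
  have hm : MeasurableSet {ω | f ω ∈ T} := by
    have hT : {ω | f ω ∈ T} = ⋃ b ∈ T, {ω | f ω = b} := by ext ω; simp
    rw [hT]; exact Finset.measurableSet_biUnion _ fun b _ => hf b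
  have hpos : 0 < P.real {ω | f ω ∈ T} := by
    rw [measureReal_def]; exact ENNReal.toReal_pos hT (measure_ne_top _ _)
  rw [measureReal_cond_apply hm, inv_mul_le_iff₀ hpos, measureReal_mem_inter_eq_sum hf]
  have h1 := measureReal_mem_inter_eq_sum (P := P) (T := T) (E := univ) hf
  simp only [inter_univ] at h1
  rw [h1, Finset.sum_mul]
  refine Finset.sum_le_sum fun b hb => ?_
  by_cases h0 : P {ω | f ω = b} = 0
  · rw [measureReal_def, measure_mono_null inter_subset_left h0]
    simp [measureReal_def, h0]
  · have hb0 : 0 < P.real {ω | f ω = b} := by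
      rw [measureReal_def]; exact ENNReal.toReal_pos h0 (measure_ne_top _ _)
    have := h b hb h0
    rwa [measureReal_cond_apply (hf b), inv_mul_le_iff₀ hb0] at this

end Mixture

lemma selected_congr {p : ℕ} {S : Finset (Fin p)} {W W' : Fin p → ℝ} {α : ℝ}
    (h : ∀ j ∈ S, W j = W' j) : selected S W α = selected S W' α := by
  have h1 : S.image (fun j => |W j|) = S.image fun j => |W' j| :=
    Finset.image_congr fun j hj => by simp only [h j hj]
  have h2 : ∀ t, S.filter (fun j => t ≤ W j) = S.filter fun j => t ≤ W' j := fun t =>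
    Finset.filter_congr fun j hj => by rw [h j hj]
  have h3 : ∀ t, S.filter (fun j => W j ≤ -t) = S.filter fun j => W' j ≤ -t := fun t =>
    Finset.filter_congr fun j hj => by rw [h j hj]
  have h4 : threshold S W α = threshold S W' α := by
    simp only [threshold, admissible, h1, h2, h3]
  unfold selected
  rw [h4]
  exact Finset.filter_congr fun j hj => by rw [h j hj]

/-! ### The knockoff statistics as functions of the rows -/

section RowStat

variable {p q n : ℕ} {S : Finset (Fin p)}

/-- The knockoff statistics computed from the rows `(x_S, x̃_S, y)`. -/
def rowStat (D : Fin n → (S → ℝ) × (S → ℝ) × EuclideanSpace ℝ (Fin q)) (j : Fin p) : ℝ :=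
  if h : j ∈ S then
    sampleCorrSq (fun i => (D i).1 ⟨j, h⟩) (fun i => (D i).2.2)
      - sampleCorrSq (fun i => (D i).2.1 ⟨j, h⟩) (fun i => (D i).2.2)
  else 0

lemma measurable_rowStat (j : Fin p) :
    Measurable fun D : Fin n → (S → ℝ) × (S → ℝ) × EuclideanSpace ℝ (Fin q) => rowStat D j := by
  unfold rowStat
  split_ifs with h
  · exact (measurable_sampleCorrSq (fun i => by fun_prop) (fun i => by fun_prop)).sub
      (measurable_sampleCorrSq (fun i => by fun_prop) (fun i => by fun_prop))
  · exact measurable_const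

lemma rowStat_swapRow (D : Fin n → (S → ℝ) × (S → ℝ) × EuclideanSpace ℝ (Fin q)) (j : S) :
    rowStat (fun i => swapRow j (D i)) = flipSigns {(j : Fin p)} (rowStat D) := by
  ext k
  simp only [flipSigns, Finset.mem_singleton]
  split_ifs with hk
  · subst hk
    simp only [rowStat, j.2, dif_pos, Subtype.coe_eta, swapRow_fst_self, swapRow_snd_self, neg_sub]
    rfl
  · by_cases hS : k ∈ S
    · have hne : (⟨k, hS⟩ : S) ≠ j := fun h => hk (congrArg Subtype.val h)
      simp only [rowStat, hS, dif_pos, swapRow_fst_of_ne hne, swapRow_snd_of_ne hne]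
      rfl
    · simp [rowStat, hS]

theorem measure_hits_rowStat_le
    (ν : Measure ((S → ℝ) × (S → ℝ) × EuclideanSpace ℝ (Fin q))) [IsProbabilityMeasure ν]
    {s : ℕ} (hs : 2 ≤ s) (N : Finset (Fin p)) (hNS : N ⊆ S)
    (hν : ∀ j : S, (j : Fin p) ∈ N → ν.map (swapRow j) = ν) :
    (Measure.pi fun _ : Fin n => ν).real {D | Hits s 1 N (rowStat D)} ≤ 2 / 3 := by
  refine measure_hits_le (fun j => measurable_rowStat j) hs N fun j hj => ?_
  refine ⟨fun D i => swapRow ⟨j, hNS hj⟩ (D i), ?_, fun D => rowStat_swapRow D ⟨j, hNS hj⟩⟩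
  exact measurePreserving_pi (fun _ : Fin n => ν) (fun _ => ν)
    (fun _ => ⟨measurable_swapRow _, hν ⟨j, hNS hj⟩ hj⟩)

theorem measure_rowStat_sub_popW_ge_le [Nontrivial (EuclideanSpace ℝ (Fin q))]
    (ν : ProbabilityMeasure ((S → ℝ) × (S → ℝ) × EuclideanSpace ℝ (Fin q)))
    (hx : ∀ j : S, NullSingletonClass (ν.toMeasure.map fun w => w.1 j))
    (hxt : ∀ j : S, NullSingletonClass (ν.toMeasure.map fun w => w.2.1 j))
    (hy : NullSingletonClass (ν.toMeasure.map fun w => w.2.2))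
    {v : ℝ} (hv : 0 < v)
    (hvx : ∀ (m : Measure ℝ) [IsProbabilityMeasure m], NullSingletonClass m → v ≤ angleVar m)
    (hvy : ∀ (m : Measure (EuclideanSpace ℝ (Fin q))) [IsProbabilityMeasure m],
      NullSingletonClass m → v ≤ angleVar m)
    (hn : 0 < n) {ε δ : ℝ} (hε : 0 < ε) (hε1 : ε ≤ 1) (hεv : ε ≤ v / 2)
    (hδ : ratioConst v * ε < δ) :
    (Measure.pi fun _ : Fin n => ν.toMeasure).real
      {D | ∃ j : S, 2 * δ ≤ |rowStat D j - popW ν j|} ≤ S.card * (6 * covTail n ε) := by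
  have hsub : {D : Fin n → (S → ℝ) × (S → ℝ) × EuclideanSpace ℝ (Fin q) |
      ∃ j : S, 2 * δ ≤ |rowStat D j - popW ν j|}
      ⊆ ⋃ j ∈ (Finset.univ : Finset S),
        ({D | ratioConst v * ε < |sampleCorrSq (fun i => (D i).1 j) (fun i => (D i).2.2)
          - projCorrSq (ν.toMeasure.map fun w => (w.1 j, w.2.2))|}
        ∪ {D | ratioConst v * ε < |sampleCorrSq (fun i => (D i).2.1 j) (fun i => (D i).2.2)
          - projCorrSq (ν.toMeasure.map fun w => (w.2.1 j, w.2.2))|}) := by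
    rintro D ⟨j, hj⟩
    refine mem_iUnion₂.2 ⟨j, Finset.mem_univ j, ?_⟩
    by_contra hcon
    simp only [mem_union, mem_ofPred_eq, not_or, not_lt] at hcon
    obtain ⟨h1, h2⟩ := hcon
    simp only [rowStat, j.2, dif_pos, popW, Subtype.coe_eta] at hj
    rw [sub_sub_sub_comm] at hj
    have := hj.trans (abs_sub _ _)
    linarith
  have hpt : ∀ j : S, (Measure.pi fun _ : Fin n => ν.toMeasure).real
      ({D | ratioConst v * ε < |sampleCorrSq (fun i => (D i).1 j) (fun i => (D i).2.2)
          - projCorrSq (ν.toMeasure.map fun w => (w.1 j, w.2.2))|}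
        ∪ {D | ratioConst v * ε < |sampleCorrSq (fun i => (D i).2.1 j) (fun i => (D i).2.2)
          - projCorrSq (ν.toMeasure.map fun w => (w.2.1 j, w.2.2))|}) ≤ 6 * covTail n ε := by
    intro j
    have m1 : Measurable fun w : (S → ℝ) × (S → ℝ) × EuclideanSpace ℝ (Fin q) => w.1 j := by
      fun_prop
    have m2 : Measurable fun w : (S → ℝ) × (S → ℝ) × EuclideanSpace ℝ (Fin q) => w.2.1 j := by
      fun_prop
    have m3 : Measurable fun w : (S → ℝ) × (S → ℝ) × EuclideanSpace ℝ (Fin q) => w.2.2 := by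
      fun_prop
    have := Measure.isProbabilityMeasure_map (μ := ν.toMeasure) m1.aemeasurable
    have := Measure.isProbabilityMeasure_map (μ := ν.toMeasure) m2.aemeasurable
    have := Measure.isProbabilityMeasure_map (μ := ν.toMeasure) m3.aemeasurable
    have c1 := measure_sampleCorrSq_sub_gt_le ν.toMeasure m1 m3 (hx j) hy hv (hvx _ (hx j))
      (hvy _ hy) hn hε hε1 hεv
    have c2 := measure_sampleCorrSq_sub_gt_le ν.toMeasure m2 m3 (hxt j) hy hv (hvx _ (hxt j))
      (hvy _ hy) hn hε hε1 hεv
    exact (measureReal_union_le _ _).trans (by linarith)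
  refine (measureReal_mono hsub (measure_ne_top _ _)).trans
    ((measureReal_biUnion_finset_le _ _).trans ?_)
  refine (Finset.sum_le_card_nsmul _ _ _ fun j _ => hpt j).trans (le_of_eq ?_)
  simp

end RowStat

namespace Experiment

variable {n₁ n₂ p q d : ℕ} {Ω : Type*} {M : Experiment n₁ n₂ p q Ω} {σ₀ : ℝ}

lemma isProbabilityMeasure_popLaw (h : M.IsRegular σ₀) : IsProbabilityMeasure M.popLaw := by
  have := h.markov
  unfold popLaw
  infer_instance

lemma IsRegular.nontrivial_response (h : M.IsRegular σ₀) :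
    Nontrivial (EuclideanSpace ℝ (Fin q)) := by
  by_contra hcon
  rw [not_nontrivial_iff_subsingleton] at hcon
  have := isProbabilityMeasure_popLaw h
  have h1 := h.response_continuous.measure_singleton 0
  have h2 : ({0} : Set (EuclideanSpace ℝ (Fin q))) = univ :=
    Set.eq_univ_of_forall fun x => Subsingleton.elim x 0
  rw [h2, measure_univ] at h1
  exact one_ne_zero h1

variable [MeasurableSpace Ω] {P : Measure Ω} {S : Finset (Fin p)}

/-- Extension by zero of a vector of screened features. -/
def extendZero (S : Finset (Fin p)) (v : S → ℝ) (i : Fin p) : ℝ := if h : i ∈ S then v ⟨i, h⟩ else 0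

lemma measurable_extendZero (S : Finset (Fin p)) : Measurable (extendZero S) := by
  rw [measurable_pi_iff]
  intro i
  unfold extendZero
  split_ifs <;> fun_prop

lemma measurable_restrict_coords (S : Finset (Fin p)) :
    Measurable fun (x : Fin p → ℝ) (j : S) => x j := by fun_prop

/-- The conditional law of the response given the screened features. -/
def screenedKernel (M : Experiment n₁ n₂ p q Ω) (S : Finset (Fin p)) :
    Kernel (S → ℝ) (EuclideanSpace ℝ (Fin q)) :=
  M.condLaw.comap (extendZero S) (measurable_extendZero S)

lemma screenedKernel_restrict (hAS : M.active ⊆ S) (x : Fin p → ℝ) :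
    M.screenedKernel S (fun j : S => x j) = M.condLaw x := by
  rw [screenedKernel, Kernel.comap_apply]
  apply dependsOn_activeSet M.condLaw
  intro i hi
  have : i ∈ S := hAS hi
  simp [extendZero, this]

lemma dependsOn_screenedKernel {j : S} (hj : (j : Fin p) ∉ M.active) :
    DependsOn (fun v => M.screenedKernel S v) ({j}ᶜ : Set S) := by
  intro v v' hv
  simp only [screenedKernel, Kernel.comap_apply]
  apply dependsOn_activeSet M.condLaw
  intro i hi
  unfold extendZero
  split_ifs with h
  · apply hv
    simp only [mem_compl_iff, mem_singleton_iff]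
    rintro rfl
    exact hj hi
  · rfl

lemma IsProcedure.map_knockLaw_fst (hreg : M.IsRegular σ₀) (h : M.IsProcedure P d)
    (hS : P {ω | M.screened ω = S} ≠ 0) :
    (M.knockLaw S).toMeasure.map (fun w => w.1) = M.xLaw.toMeasure.map fun x (j : S) => x j := by
  have := hreg.markov
  have h1 := congrArg Measure.fst (h.knock_marginal S hS)
  rw [Measure.fst, Measure.fst, Measure.map_map (by fun_prop) (by fun_prop),
    Measure.map_map (by fun_prop) (by fun_prop)] at h1
  have h2 : M.popLaw.map (fun z => fun j : S => z.1 j)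
      = (M.popLaw.fst).map fun x (j : S) => x j := by
    rw [Measure.fst, Measure.map_map (by fun_prop) (by fun_prop)]; rfl
  rw [popLaw, Measure.fst_compProd] at h2
  exact h1.trans h2

lemma IsProcedure.map_knockLaw_feature (hreg : M.IsRegular σ₀) (h : M.IsProcedure P d)
    (hS : P {ω | M.screened ω = S} ≠ 0) (j : S) :
    (M.knockLaw S).toMeasure.map (fun w => w.1 j) = M.xLaw.toMeasure.map fun x => x j := by
  have h1 := congrArg (fun m => Measure.map (fun v : S → ℝ => v j) m)
    (h.map_knockLaw_fst hreg hS)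
  rw [Measure.map_map (by fun_prop) (by fun_prop), Measure.map_map (by fun_prop)
    (by fun_prop)] at h1
  exact h1

lemma IsProcedure.map_knockLaw_response (h : M.IsProcedure P d)
    (hS : P {ω | M.screened ω = S} ≠ 0) :
    (M.knockLaw S).toMeasure.map (fun w => w.2.2) = M.popLaw.snd := by
  have h1 := congrArg Measure.snd (h.knock_marginal S hS)
  rw [Measure.snd, Measure.snd, Measure.map_map (by fun_prop) (by fun_prop),
    Measure.map_map (by fun_prop) (by fun_prop)] at h1
  exact h1

lemma IsProcedure.map_swapRow_knockLaw (hreg : M.IsRegular σ₀) (h : M.IsProcedure P d)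
    (hS : P {ω | M.screened ω = S} ≠ 0) (hAS : M.active ⊆ S) {j : S}
    (hj : (j : Fin p) ∉ M.active) :
    (M.knockLaw S).toMeasure.map (swapRow j) = (M.knockLaw S).toMeasure := by
  have := hreg.markov
  have : IsMarkovKernel (M.screenedKernel S) := by unfold screenedKernel; infer_instance
  refine map_swapRow_eq _ (h.knock_exact S hS) (M.screenedKernel S) ?_ j
    (dependsOn_screenedKernel hj)
  rw [h.knock_marginal S hS, h.map_knockLaw_fst hreg hS, popLaw]
  exact map_compProd_fst (measurable_restrict_coords S) (screenedKernel_restrict hAS)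

lemma IsProcedure.measurable_knockRow (h : M.IsProcedure P d) (S : Finset (Fin p)) (i : Fin n₂) :
    Measurable (M.knockRow S i) := by
  have h1 := h.measurable_X (Sum.inr i)
  have h2 := h.measurable_Y (Sum.inr i)
  have h3 := h.measurable_Xt i
  unfold knockRow
  exact ((measurable_restrict_coords S).comp h1).prodMk
    (((measurable_restrict_coords S).comp h3).prodMk h2)

lemma IsProcedure.map_knockRows [IsProbabilityMeasure P] (h : M.IsProcedure P d)
    (hS : P {ω | M.screened ω = S} ≠ 0) :
    (P[|{ω | M.screened ω = S}]).map (fun ω i => M.knockRow S i ω)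
      = Measure.pi fun _ : Fin n₂ => (M.knockLaw S).toMeasure := by
  have := cond_isProbabilityMeasure hS
  have h1 := (iIndepFun_iff_map_fun_eq_pi_map
    (fun i => (h.measurable_knockRow S i).aemeasurable)).1 (h.knock_indep S hS)
  rw [h1]
  exact congrArg Measure.pi (funext fun i => h.knock_law S hS i)

lemma output_eq_selected_rowStat {ω : Ω} (hω : M.screened ω = S) (α : ℝ) :
    M.output α ω = selected S (rowStat fun i => M.knockRow S i ω) α := by
  unfold output
  rw [hω]
  apply selected_congr
  intro j hj
  simp only [What, rowStat, hj, dif_pos, knockRow]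

/-- Events about the output that follow from a measurable event about the rows. -/
lemma IsProcedure.measure_le_cond [IsProbabilityMeasure P] (h : M.IsProcedure P d)
    (hS : P {ω | M.screened ω = S} ≠ 0)
    {B : Set (Fin n₂ → (S → ℝ) × (S → ℝ) × EuclideanSpace ℝ (Fin q))} (hB : MeasurableSet B)
    {E : Set Ω} (hBE : ∀ ω, M.screened ω = S → (fun i => M.knockRow S i ω) ∈ B → ω ∈ E) :
    (Measure.pi fun _ : Fin n₂ => (M.knockLaw S).toMeasure).real B
      ≤ (P[|{ω | M.screened ω = S}]).real E := by
  have hm : Measurable fun ω i => M.knockRow S i ω :=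
    measurable_pi_lambda _ fun i => h.measurable_knockRow S i
  have := cond_isProbabilityMeasure hS
  rw [← h.map_knockRows hS, map_measureReal_apply hm hB]
  refine ENNReal.toReal_mono (measure_ne_top _ _) (measure_mono_ae ?_)
  filter_upwards [ae_cond_mem (h.measurable_screened S)] with ω hω hωB
  exact hBE ω hω hωB

lemma IsProcedure.cond_le_measure [IsProbabilityMeasure P] (h : M.IsProcedure P d)
    (hS : P {ω | M.screened ω = S} ≠ 0)
    {B : Set (Fin n₂ → (S → ℝ) × (S → ℝ) × EuclideanSpace ℝ (Fin q))} (hB : MeasurableSet B)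
    {E : Set Ω} (hEB : ∀ ω, M.screened ω = S → ω ∈ E → (fun i => M.knockRow S i ω) ∈ B) :
    (P[|{ω | M.screened ω = S}]).real E
      ≤ (Measure.pi fun _ : Fin n₂ => (M.knockLaw S).toMeasure).real B := by
  have hm : Measurable fun ω i => M.knockRow S i ω :=
    measurable_pi_lambda _ fun i => h.measurable_knockRow S i
  have := cond_isProbabilityMeasure hS
  rw [← h.map_knockRows hS, map_measureReal_apply hm hB]
  refine ENNReal.toReal_mono (measure_ne_top _ _) (measure_mono_ae ?_)
  filter_upwards [ae_cond_mem (h.measurable_screened S)] with ω hω hωE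
  exact hEB ω hω hωE

lemma measurableSet_rowStat_close
    (ν : ProbabilityMeasure ((S → ℝ) × (S → ℝ) × EuclideanSpace ℝ (Fin q))) (τ : ℝ) :
    MeasurableSet {D : Fin n₂ → (S → ℝ) × (S → ℝ) × EuclideanSpace ℝ (Fin q) |
      ∃ j : S, τ ≤ |rowStat D j - popW ν j|} := by
  have : {D : Fin n₂ → (S → ℝ) × (S → ℝ) × EuclideanSpace ℝ (Fin q) |
      ∃ j : S, τ ≤ |rowStat D j - popW ν j|}
      = ⋃ j : S, {D | τ ≤ |rowStat D j - popW ν j|} := by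
    ext D; simp
  rw [this]
  exact MeasurableSet.iUnion fun j =>
    measurableSet_le measurable_const ((measurable_rowStat _).sub_const _).abs

/-- Away from a rare event, the statistics of active features exceed those of null features. -/
lemma IsProcedure.separated (hreg : M.IsRegular σ₀) (h : M.IsProcedure P d)
    (hS : P {ω | M.screened ω = S} ≠ 0) (hAS : M.active ⊆ S) {τ : ℝ}
    (hsig : M.SignalAtLeast P (2 * τ))
    {D : Fin n₂ → (S → ℝ) × (S → ℝ) × EuclideanSpace ℝ (Fin q)}
    (hD : ¬ ∃ j : S, τ ≤ |rowStat D j - popW (M.knockLaw S) j|) :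
    (∀ k ∈ M.active, τ < rowStat D k) ∧ ∀ j ∈ S, j ∉ M.active → |rowStat D j| < τ := by
  push Not at hD
  constructor
  · intro k hk
    have h1 := (abs_lt.1 (hD ⟨k, hAS hk⟩)).1
    have h2 := hsig S hS hAS ⟨k, hAS hk⟩ hk
    simp only at h1 h2
    linarith
  · intro j hj hjA
    have h1 := hD ⟨j, hj⟩
    rwa [popW_eq_zero (h.map_swapRow_knockLaw hreg hS hAS hjA), sub_zero] at h1

end Experiment

/-! ### The two-step procedure at a fixed screened set -/

lemma exists_deviation_scale {v c κ : ℝ} (hv : 0 < v) (hc : 0 < c) (hκ : 0 ≤ κ) :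
    ∃ b : ℝ, 0 < b ∧ ∀ n : ℕ, 0 < n → ∃ ε : ℝ, 0 < ε ∧ ε ≤ 1 ∧ ε ≤ v / 2 ∧
      ratioConst v * ε < c * (n : ℝ) ^ (-κ) ∧
      covTail n ε = 2 * Real.exp 1 * Real.exp (-b * (n : ℝ) ^ (1 - 2 * κ)) := by
  have hL := ratioConst_pos hv
  set c' : ℝ := min (min (v / 2) 1) (c / (2 * ratioConst v)) with hc'
  have hc'0 : 0 < c' := by positivity
  refine ⟨c' ^ 2 / 80000, by positivity, fun n hn => ?_⟩
  have hn0 : (0 : ℝ) < n := by exact_mod_cast hn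
  have hn1 : (1 : ℝ) ≤ n := by exact_mod_cast hn
  have hr0 : 0 < (n : ℝ) ^ (-κ) := Real.rpow_pos_of_pos hn0 _
  have hr1 : (n : ℝ) ^ (-κ) ≤ 1 := Real.rpow_le_one_of_one_le_of_nonpos hn1 (by linarith)
  have hle : c' * (n : ℝ) ^ (-κ) ≤ c' := mul_le_of_le_one_right hc'0.le hr1
  have h1 : c' ≤ v / 2 := (min_le_left _ _).trans (min_le_left _ _)
  have h2 : c' ≤ 1 := (min_le_left _ _).trans (min_le_right _ _)
  have h3 : c' ≤ c / (2 * ratioConst v) := min_le_right _ _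
  refine ⟨c' * (n : ℝ) ^ (-κ), by positivity, hle.trans h2, hle.trans h1, ?_, ?_⟩
  · rw [← mul_assoc]
    refine mul_lt_mul_of_pos_right ?_ hr0
    have := (le_div_iff₀ (by positivity)).1 h3
    nlinarith
  · have hpow : (n : ℝ) * ((n : ℝ) ^ (-κ)) ^ 2 = (n : ℝ) ^ (1 - 2 * κ) := by
      rw [← Real.rpow_natCast, ← Real.rpow_mul hn0.le]
      nth_rw 1 [← Real.rpow_one (n : ℝ)]
      rw [← Real.rpow_add hn0]
      congr 1
      push_cast
      ring
    unfold covTail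
    rw [← hpow]
    congr 2
    ring

namespace Experiment

variable {n₁ n₂ p q d : ℕ} {Ω : Type*} [MeasurableSpace Ω] {P : Measure Ω}
  {M : Experiment n₁ n₂ p q Ω} {σ₀ : ℝ} {S : Finset (Fin p)}

lemma IsProcedure.measure_rowStat_sub_popW_ge_le (hreg : M.IsRegular σ₀)
    (h : M.IsProcedure P d) (hS : P {ω | M.screened ω = S} ≠ 0) {v : ℝ} (hv : 0 < v)
    (hvx : ∀ (m : Measure ℝ) [IsProbabilityMeasure m], NullSingletonClass m → v ≤ angleVar m)
    (hvy : ∀ (m : Measure (EuclideanSpace ℝ (Fin q))) [IsProbabilityMeasure m],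
      NullSingletonClass m → v ≤ angleVar m)
    (hn : 0 < n₂) {ε δ : ℝ} (hε : 0 < ε) (hε1 : ε ≤ 1) (hεv : ε ≤ v / 2)
    (hδ : ratioConst v * ε < δ) :
    (Measure.pi fun _ : Fin n₂ => (M.knockLaw S).toMeasure).real
      {D | ∃ j : S, 2 * δ ≤ |rowStat D j - popW (M.knockLaw S) j|} ≤ d * (6 * covTail n₂ ε) := by
  have := hreg.nontrivial_response
  have hcard : S.card = d := by
    obtain ⟨ω, hω⟩ := nonempty_of_measure_ne_zero hS
    have hω' : M.screened ω = S := hω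
    rw [← hω']
    exact h.screened_card ω
  have hx : ∀ j : S, NullSingletonClass ((M.knockLaw S).toMeasure.map fun w => w.1 j) := by
    intro j
    rw [h.map_knockLaw_feature hreg hS j]
    exact hreg.feature_continuous j
  rw [← hcard]
  refine PCKnockoff.measure_rowStat_sub_popW_ge_le (M.knockLaw S) hx (fun j => ?_) ?_ hv hvx hvy
    hn hε hε1 hεv hδ
  · rw [(h.knock_exact S hS).map_knockoff_eq j]
    exact hx j
  · rw [h.map_knockLaw_response hS]
    exact hreg.response_continuous

lemma IsProcedure.measure_separated_le_cond [IsProbabilityMeasure P] (hreg : M.IsRegular σ₀)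
    (h : M.IsProcedure P d) (hS : P {ω | M.screened ω = S} ≠ 0) (hAS : M.active ⊆ S) {τ η : ℝ}
    (hsig : M.SignalAtLeast P (2 * τ))
    (hη : (Measure.pi fun _ : Fin n₂ => (M.knockLaw S).toMeasure).real
      {D | ∃ j : S, τ ≤ |rowStat D j - popW (M.knockLaw S) j|} ≤ η)
    {α : ℝ} {R : Finset (Fin p) → Prop}
    (hR : ∀ W : Fin p → ℝ, (∀ k ∈ M.active, τ < W k) → (∀ j ∈ S, j ∉ M.active → |W j| < τ) →
      R (selected S W α)) :
    1 - η ≤ (P[|{ω | M.screened ω = S}]).real {ω | R (M.output α ω)} := by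
  have hm := measurableSet_rowStat_close (n₂ := n₂) (M.knockLaw S) τ
  refine le_trans ?_ (h.measure_le_cond hS hm.compl (E := {ω | R (M.output α ω)}) ?_)
  · rw [probReal_compl_eq_one_sub hm]
    linarith
  · intro ω hω hD
    obtain ⟨h1, h2⟩ := h.separated hreg hS hAS hsig hD
    show R (M.output α ω)
    rw [output_eq_selected_rowStat hω]
    exact hR _ h1 h2

lemma IsProcedure.cond_subset_output_le [IsProbabilityMeasure P] (hreg : M.IsRegular σ₀)
    (h : M.IsProcedure P d) (hS : P {ω | M.screened ω = S} ≠ 0) (hAS : M.active ⊆ S) {α : ℝ}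
    (hα : α < 1 / (M.active.card : ℝ)) (hs : 2 ≤ M.active.card) :
    (P[|{ω | M.screened ω = S}]).real {ω | M.active ⊆ M.output α ω} ≤ 2 / 3 := by
  refine (h.cond_le_measure hS
    (measurableSet_hits_one (fun j => measurable_rowStat j) M.active.card (S \ M.active)) ?_).trans
    (measure_hits_rowStat_le (M.knockLaw S).toMeasure hs _ Finset.sdiff_subset fun j hj =>
      h.map_swapRow_knockLaw hreg hS hAS (Finset.mem_sdiff.1 hj).2)
  intro ω hω hE
  have hE' : M.active ⊆ M.output α ω := hE
  rw [output_eq_selected_rowStat hω] at hE'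
  exact hits_of_subset_selected (Finset.card_pos.1 (by omega)) hα hE'

end Experiment

end PCKnockoff

end

theorem theorem5 :
    ∃ Cs : ℕ → ℝ, (∀ s, 2 < s → 0 < Cs s ∧ Cs s < 1) ∧
      ∀ (q : ℕ) (σ₀ c₃ κ : ℝ), 0 < σ₀ → 0 < c₃ → 0 ≤ κ → κ < 1 / 2 →
        ∃ K c₄ : ℝ, 0 < K ∧ 0 < c₄ ∧
          ∀ (n₁ n₂ p d : ℕ) (Ω : Type*) [MeasurableSpace Ω] (P : Measure Ω)
            [IsProbabilityMeasure P] (M : PCKnockoff.Experiment n₁ n₂ p q Ω) (α : ℝ),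
            2 * d < n₂ →
            M.IsRegular σ₀ →
            M.IsProcedure P d →
            P M.sureScreen ≠ 0 →
            M.SignalAtLeast P (4 * c₃ * (n₂ : ℝ) ^ (-κ)) →
            0 ≤ α → α ≤ 1 →
            (1 / (M.active.card : ℝ) ≤ α →
              1 - K * (n₂ * Real.exp (-c₄ * (n₂ : ℝ) ^ (1 - 2 * κ)))
                ≤ (P[|M.sureScreen]).real {ω | M.active ⊆ M.output α ω}) ∧
            (α < 1 / (M.active.card : ℝ) →
              1 - K * (n₂ * Real.exp (-c₄ * (n₂ : ℝ) ^ (1 - 2 * κ)))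
                ≤ (P[|M.sureScreen]).real {ω | M.active ⊆ M.output α ω ∨ M.output α ω = ∅} ∧
              (2 < M.active.card →
                (P[|M.sureScreen]).real {ω | M.active ⊆ M.output α ω}
                  ≤ Cs M.active.card
                    + K * (n₂ * Real.exp (-c₄ * (n₂ : ℝ) ^ (1 - 2 * κ))))) := by
  refine ⟨fun _ => 2 / 3, fun s _ => by norm_num, fun q σ₀ c₃ κ _ hc₃ hκ _ => ?_⟩
  obtain ⟨cE, hcE, hE⟩ := PCKnockoff.exists_angleVar_lower_bound ℝ
  obtain ⟨cF, hcF, hF⟩ := PCKnockoff.exists_angleVar_lower_bound (EuclideanSpace ℝ (Fin q))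
  have hv : 0 < min cE cF := lt_min hcE hcF
  obtain ⟨c₄, hc₄, hscale⟩ := PCKnockoff.exists_deviation_scale (c := c₃) (κ := κ) hv hc₃ hκ
  refine ⟨12 * Real.exp 1, c₄, by positivity, hc₄, ?_⟩
  intro n₁ n₂ p d Ω _ P _ M α hd hreg hproc hscr hsig hα0 _
  obtain ⟨ε, hε, hε1, hεv, hδ, htail⟩ := hscale n₂ (by omega)
  set η : ℝ := 12 * Real.exp 1 * (n₂ * Real.exp (-c₄ * (n₂ : ℝ) ^ (1 - 2 * κ))) with hη
  have hη0 : 0 ≤ η := by positivity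
  have hdn : (d : ℝ) ≤ n₂ := by exact_mod_cast (by omega : d ≤ n₂)
  have hbad : ∀ S, P {ω | M.screened ω = S} ≠ 0 →
      (Measure.pi fun _ : Fin n₂ => (M.knockLaw S).toMeasure).real
        {D | ∃ j : S, 2 * (c₃ * (n₂ : ℝ) ^ (-κ))
          ≤ |PCKnockoff.rowStat D j - PCKnockoff.popW (M.knockLaw S) j|} ≤ η := by
    intro S hS
    refine (hproc.measure_rowStat_sub_popW_ge_le hreg hS hv
      (fun m _ hm => (min_le_left _ _).trans (hE m hm))
      (fun m _ hm => (min_le_right _ _).trans (hF m hm)) (by omega) hε hε1 hεv hδ).trans ?_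
    rw [htail]
    calc (d : ℝ) * (6 * (2 * Real.exp 1 * Real.exp (-c₄ * (n₂ : ℝ) ^ (1 - 2 * κ))))
        ≤ n₂ * (6 * (2 * Real.exp 1 * Real.exp (-c₄ * (n₂ : ℝ) ^ (1 - 2 * κ)))) := by gcongr
      _ = η := by rw [hη]; ring
  have hsig' : M.SignalAtLeast P (2 * (2 * (c₃ * (n₂ : ℝ) ^ (-κ)))) := by
    convert hsig using 1
    ring
  have hscr_eq : M.sureScreen
      = {ω | M.screened ω ∈ Finset.univ.filter fun S => M.active ⊆ S} := by
    ext ω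
    simp [PCKnockoff.Experiment.sureScreen]
  rw [hscr_eq] at hscr ⊢
  have hτ : 0 ≤ 2 * (c₃ * (n₂ : ℝ) ^ (-κ)) := by positivity
  refine ⟨fun hα => ?_, fun hα => ⟨?_, fun hs => ?_⟩⟩
  · refine PCKnockoff.le_cond_mem_of_forall hproc.measurable_screened hscr fun S hAS hS => ?_
    have hAS' := (Finset.mem_filter.1 hAS).2
    exact hproc.measure_separated_le_cond hreg hS hAS' hsig' (hbad S hS)
      (R := fun B => M.active ⊆ B) fun W h1 h2 =>
        PCKnockoff.subset_selected_of_le hAS' hτ h1 h2 hα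
  · refine PCKnockoff.le_cond_mem_of_forall hproc.measurable_screened hscr fun S hAS hS => ?_
    have hAS' := (Finset.mem_filter.1 hAS).2
    exact hproc.measure_separated_le_cond hreg hS hAS' hsig' (hbad S hS)
      (R := fun B => M.active ⊆ B ∨ B = ∅) fun W h1 h2 =>
        PCKnockoff.subset_selected_or_empty hAS' h1 h2 hα
  · refine PCKnockoff.cond_mem_le_of_forall hproc.measurable_screened hscr fun S hAS hS => ?_
    have := hproc.cond_subset_output_le hreg hS (Finset.mem_filter.1 hAS).2 hα hs.le
    linarith
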